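/- A \emph{braced polygon graph} is a finite simple graph $G$ on vertices $1,\dots,n$ ($n\ge 3$) containing the distinguished Hamilton cycle $1,2,\dots,n,1$; the edges of this cycle are the \emph{boundary edges}, all other edges are the \emph{braces}. It is \emph{minimally 3-connected} if it is 3-connected (it has more than $3$ vertices and stays connected whenever at most two vertices are removed) and deleting any brace yields a graph that is not 3-connected. A graph with $n$ vertices and $m$ edges is a \emph{generic rigidity circuit} if $m=2n-2$ and every subgraph on $k$ vertices with $2\le k<n$ has at most $2k-3$ edges. A \emph{strictly convex realisation} of $G$ is a configuration $\mathbf p=(p_1,\dots,p_n)$ of points of $\mathbb R^2$ that are, in this cyclic order, the distinct vertices of a strictly convex polygon, so that its sides are the segments $p_ip_{i+1}$ (indices modulo $n$). A \emph{proper stress} of $(G,\mathbf p)$ is a function $\omega:E(G)\to\mathbb R$ with $\sum_{j:\,ij\in E(G)}\omega_{ij}(p_i-p_j)=0$ for every vertex $i$ that is positive on every boundary edge and negative on every brace. Lemma. Let $G$ be a minimally 3-connected braced polygon graph with $n$ vertices and $m$ edges. If $m\ge 2n-2$, then $G$ is a generic rigidity circuit (in particular $m=2n-2$), and every strictly convex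 realisation $(G,\mathbf p)$ of $G$ has a proper stress. -/

import Mathlib

/-- The Euclidean plane. -/
abbrev Plane : Type := EuclideanSpace ℝ (Fin 2)

/-- `G` is (vertex) `k`-connected: it has more than `k` vertices, and it stays connected whenever
fewer than `k` vertices are removed. -/
def IsKConnected {V : Type*} (k : ℕ) (G : SimpleGraph V) : Prop :=
  k < Nat.card V ∧ ∀ S : Finset V, S.card < k → (G.induce {v | v ∉ S}).Connected

/-- A braced polygon graph on the vertices `0, 1, …, n - 1` (`n ≥ 3`): a simple graph that contains
the distinguished Hamilton cycle `0, 1, …, n - 1, 0`, whose edges are the boundary edges. -/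
structure IsBracedPolygonGraph {n : ℕ} (G : SimpleGraph (Fin n)) : Prop where
  three_le : 3 ≤ n
  cycle_le : SimpleGraph.cycleGraph n ≤ G

/-- The boundary edges: the edges `{i, i + 1}` (indices modulo `n`). -/
def boundaryEdges (n : ℕ) : Set (Sym2 (Fin n)) := (SimpleGraph.cycleGraph n).edgeSet

/-- The braces (interior edges) of a braced polygon graph: its edges off the distinguished
Hamilton cycle. -/
def braces {n : ℕ} (G : SimpleGraph (Fin n)) : Set (Sym2 (Fin n)) := G.edgeSet \ boundaryEdges n

/-- A braced polygon graph is minimally `k`-connected if it is `k`-connected and removing any brace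
destroys `k`-connectivity. (Boundary edges are not considered for removal.) -/
def IsMinimallyKConnected {n : ℕ} (k : ℕ) (G : SimpleGraph (Fin n)) : Prop :=
  IsKConnected k G ∧ ∀ e ∈ braces G, ¬ IsKConnected k (G.deleteEdges {e})

/-- A graph with `n` vertices and `m` edges is a generic rigidity circuit (in the plane) if
`m = 2n - 2` and every subgraph on `k` vertices, `2 ≤ k < n`, has at most `2k - 3` edges. -/
def IsGenericRigidityCircuit {V : Type*} (G : SimpleGraph V) : Prop :=
  (G.edgeSet.ncard : ℤ) = 2 * (Nat.card V : ℤ) - 2 ∧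
    ∀ H : G.Subgraph, 2 ≤ H.verts.ncard → H.verts.ncard < Nat.card V →
      (H.edgeSet.ncard : ℤ) ≤ 2 * (H.verts.ncard : ℤ) - 3

/-- The points `p 0, …, p (n - 1)` are distinct and are, in this cyclic order (clockwise or
counterclockwise), the vertices of a strictly convex polygon: the boundary of their convex hull is
the union of the segments joining cyclically consecutive points, and each `p i` lies on a supporting
line that meets the polygon only at `p i`. -/
structure IsStrictlyConvexPolygon {n : ℕ} (p : Fin n → Plane) : Prop where
  three_le : 3 ≤ n
  injective : Function.Injective p
  frontier_eq : frontier (convexHull ℝ (Set.range p)) =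
    {x | ∃ i j, (SimpleGraph.cycleGraph n).Adj i j ∧ x ∈ segment ℝ (p i) (p j)}
  exposed : ∀ i, p i ∈ (convexHull ℝ (Set.range p)).exposedPoints ℝ

/-- `ω` is an equilibrium stress of the framework `(G, p)`: a real function on the edges of `G`,
extended by zero to all other pairs, with `∑ j, ω i j (p i - p j) = 0` at every vertex `i`. -/
structure IsEquilibriumStress {V : Type*} [Fintype V] (G : SimpleGraph V) (p : V → Plane)
    (ω : Sym2 V → ℝ) : Prop where
  eq_zero_of_notMem : ∀ e, e ∉ G.edgeSet → ω e = 0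
  equilibrium : ∀ i, ∑ j, ω s(i, j) • (p i - p j) = 0

/-- A proper stress of a convex braced polygon: an equilibrium stress that is positive on the
boundary edges and negative on the braces. -/
structure IsProperStress {n : ℕ} (G : SimpleGraph (Fin n)) (p : Fin n → Plane)
    (ω : Sym2 (Fin n) → ℝ) : Prop where
  isEquilibriumStress : IsEquilibriumStress G p ω
  boundary_pos : ∀ e ∈ boundaryEdges n, 0 < ω e
  brace_neg : ∀ e ∈ braces G, ω e < 0

/-- The braced polygon `(G, p)` is properly stressed. -/
def IsProperlyStressed {n : ℕ} (G : SimpleGraph (Fin n)) (p : Fin n → Plane) : Prop :=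
  ∃ ω : Sym2 (Fin n) → ℝ, IsProperStress G p ω

/-!
The braces of a minimally 3-connected braced polygon are described by crossings alone. Removing two
non-consecutive vertices `a`, `b` disconnects the graph exactly if no brace crosses the chord
`{a, b}`, so 3-connectivity says that every chord is crossed by a brace, and minimality says that
each brace is the only one that crosses a certain *private* chord. This is `BraceSystem`; its
vertices are an arbitrary finite set `V` of natural numbers in their cyclic order, so that vertices
can be removed.

The link with stresses is `IsWeaklySigned.exists_crosses`. In a strictly convex polygon, let a
nonzero stress be nonnegative on the sides and nonpositive on the chords. Then every chord `{a, b}`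
is crossed by its support: if not, each of the two sides of the chord acts on `a` with a force along
the chord that points away from `b`, and the nonpositive stress on `{a, b}` cannot balance these.
Applied to private chords, this shows that for a brace system weak signs are strict
(`BraceSystem.isProper`).

The equation `|B| = |V| - 2` and the existence of proper stresses are then proved together, by
induction on `|V|`, for brace systems with `|B| ≥ |V| - 2`
(`BraceSystem.card_eq_and_exists_isProper`).

* Some vertex `x` is *removable*: the braces that do not end at `x` still cross every chord of `V \
  {x}` (`BraceSystem.exists_removable`). A vertex `x` with two braces `{x, y}`, `{x, z}` exists by
  counting. A private chord of `{x, y}`, chosen with the fewest vertices on the side of `x`, cuts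
  the polygon into two smaller ones, each completed by the far end of `{x, y}`; should `y` be alone
  on its side, then `y` is removable. The braces of the two polygons again form brace systems, if
  need be with the chord added to one of them. The induction hypothesis bounds the numbers of
  braces, so that one of the two has as many as possible; by induction such a system has proper
  stresses at all strictly convex realisations, and in it each vertex whose neighbours are not
  joined by a brace is removable (`BraceSystem.removable`). Indeed, as this vertex is slid to the
  midpoint of its neighbours the stresses have a limit, which is a weakly signed stress of the other
  vertices, so that its support crosses all of their chords. If the chord belongs to the braces of
  that polygon, then one of its inner vertices is removable in this way, and removable in the whole
  polygon, too; otherwise there is a contradiction, as an end of the chord would be removable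
  (`Cut.exists_not_removable_side`).
* A removable vertex `x` carries a single brace, and deleting it leaves a brace system
  (`BraceSystem.erase`), which has proper stresses by induction. Placing `x` at the midpoint of its
  neighbours subdivides a side and keeps the stress. Now `x` is slid to its final position
  (`BraceSystem.exists_isProper_of_erase`). As there are at least `2 |V| - 2` edges, there is always
  a nonzero stress (`exists_stress_ne_zero`); weak signs are always strict; and if one stress is
  strictly signed then so are all nonzero ones, up to a factor `-1` (`pos_or_neg_of_forall`). Hence
  the positions with and those without a strictly signed stress both form closed sets, and
  connectedness gives a proper stress at the end (`exists_strictly_signed_of_path`).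

The sparsity condition follows from the same facts: a subgraph on `k < n` vertices with `2 k - 2`
edges has a nonzero stress, which vanishes on some sides of the polygon, whereas all nonzero
stresses are strictly signed up to a factor (`BraceSystem.card_le_of_ssubset`).
-/

namespace BracedPolygon

/-! ### Cyclic order and crossing pairs -/

/-- The natural numbers `a`, `b`, `c` are distinct and occur in this cyclic order. -/
def Cyc (a b c : ℕ) : Prop := (a < b ∧ b < c) ∨ (b < c ∧ c < a) ∨ (c < a ∧ a < b)

/-- The pairs `{a, b}` and `{c, d}` cross: their four members are distinct and alternate in the
cyclic order. -/
def Crosses (a b c d : ℕ) : Prop := (Cyc a c b ∧ Cyc b d a) ∨ (Cyc a d b ∧ Cyc b c a)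

/-- `a` lies on the closed arc that runs from `u` to `v` in the cyclic order. -/
def OnArc (u v a : ℕ) : Prop := a = u ∨ a = v ∨ Cyc u a v

theorem Cyc.rotate {a b c : ℕ} (h : Cyc a b c) : Cyc b c a := by unfold Cyc at *; omega

theorem cyc_or_cyc {u v a : ℕ} (huv : u ≠ v) : OnArc u v a ∨ Cyc v a u := by
  unfold OnArc Cyc; omega

theorem not_cyc_of_onArc {u v a : ℕ} (h : OnArc u v a) : ¬ Cyc v a u := by
  unfold OnArc Cyc at *; omega

theorem not_cyc_of_cyc {u v a : ℕ} (h : Cyc u a v) : ¬ Cyc v a u := by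
  unfold Cyc at *; omega

theorem Cyc.ne {a b c : ℕ} (h : Cyc a b c) : a ≠ b ∧ b ≠ c ∧ a ≠ c := by
  unfold Cyc at *; omega

theorem cyc_total {a b c : ℕ} (h₁ : a ≠ b) (h₂ : b ≠ c) (h₃ : a ≠ c) : Cyc a b c ∨ Cyc c b a := by
  unfold Cyc; omega

theorem Crosses.swap_left {a b c d : ℕ} (h : Crosses a b c d) : Crosses b a c d := by
  unfold Crosses at *; tauto

theorem Crosses.swap_right {a b c d : ℕ} (h : Crosses a b c d) : Crosses a b d c := by
  unfold Crosses at *; tauto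

theorem Crosses.comm {a b c d : ℕ} (h : Crosses a b c d) : Crosses c d a b := by
  unfold Crosses Cyc at *; grind (splits := 60)

theorem Crosses.ne {a b c d : ℕ} (h : Crosses a b c d) :
    a ≠ b ∧ a ≠ c ∧ a ≠ d ∧ b ≠ c ∧ b ≠ d ∧ c ≠ d := by
  unfold Crosses Cyc at *; grind (splits := 60)

theorem Crosses.congr_right {a b c d e f : ℕ} (h : Crosses a b c d) (he : s(c, d) = s(e, f)) :
    Crosses a b e f := by
  rcases Sym2.eq_iff.1 he with ⟨rfl, rfl⟩ | ⟨rfl, rfl⟩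
  · exact h
  · exact h.swap_right

theorem crosses_of_cyc {u v x y : ℕ} (hx : Cyc u x v) (hy : Cyc v y u) : Crosses u v x y :=
  Or.inl ⟨hx, hy⟩

/-- If `{s, t}` joins the two arcs between `u` and `v`, then its end `t` may be replaced by any
other vertex `y` of its arc as far as crossings with pairs on the other arc are concerned. -/
theorem crosses_change_far {u v s t y e f : ℕ} (hs : Cyc u s v) (ht : Cyc v t u) (hy : Cyc v y u)
    (he : OnArc u v e) (hf : OnArc u v f) (hc : Crosses s t e f) : Crosses s y e f := by
  unfold Crosses OnArc Cyc at *; grind (splits := 60)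

theorem not_crosses_of_onArc {u v a b e f : ℕ} (ha : OnArc u v a) (hb : OnArc u v b)
    (he : OnArc v u e) (hf : OnArc v u f) : ¬ Crosses a b e f := by
  unfold Crosses OnArc Cyc at *; grind (splits := 60)

theorem onArc_of_cyc_of_cyc {u v a b w y : ℕ} (ha : OnArc u v a) (hb : OnArc u v b)
    (hy : Cyc v y u) (hy' : Cyc b y a) (hw : Cyc a w b) : OnArc u v w := by
  unfold OnArc Cyc at *; grind (splits := 60)

theorem cyc_or_cyc_of_onArc {u v a b y : ℕ} (ha : OnArc u v a) (hb : OnArc u v b) (hab : a ≠ b)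
    (hy : Cyc v y u) : Cyc a y b ∨ Cyc b y a := by
  unfold OnArc Cyc at *; omega

/-! ### Brace systems -/

/-- `{a, b}` is a chord of the polygon with vertex set `V`: a pair of vertices that are not
consecutive in the cyclic order of `V`. -/
def IsChord (V : Finset ℕ) (a b : ℕ) : Prop :=
  a ∈ V ∧ b ∈ V ∧ (∃ c ∈ V, Cyc a c b) ∧ ∃ d ∈ V, Cyc b d a

/-- `b` is the successor of `a` in the cyclic order of `V`. -/
def IsNext (V : Finset ℕ) (a b : ℕ) : Prop :=
  a ∈ V ∧ b ∈ V ∧ a ≠ b ∧ ∀ c ∈ V, ¬ Cyc a c b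

/-- A set `B` of chords of the polygon with vertex set `V` such that every chord is crossed by a
member of `B`, and every member of `B` is the only one that crosses a certain chord. These are the
brace sets of the minimally 3-connected braced polygons on `V`. -/
structure BraceSystem (V : Finset ℕ) (B : Finset (Sym2 ℕ)) : Prop where
  four_le : 4 ≤ V.card
  isChord : ∀ a b, s(a, b) ∈ B → IsChord V a b
  cover : ∀ a b, IsChord V a b → ∃ c d, s(c, d) ∈ B ∧ Crosses a b c d
  priv : ∀ a b, s(a, b) ∈ B → ∃ c d, IsChord V c d ∧ Crosses c d a b ∧
    ∀ e f, s(e, f) ∈ B → Crosses c d e f → s(e, f) = s(a, b)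

/-- Every chord of the polygon `V \ {x}` is crossed by a member of `B` that does not end at `x`. -/
def Removable (V : Finset ℕ) (B : Finset (Sym2 ℕ)) (x : ℕ) : Prop :=
  ∀ c d, IsChord (V.erase x) c d → ∃ e f, s(e, f) ∈ B ∧ e ≠ x ∧ f ≠ x ∧ Crosses c d e f

theorem IsChord.symm {V : Finset ℕ} {a b : ℕ} (h : IsChord V a b) : IsChord V b a :=
  ⟨h.2.1, h.1, h.2.2.2, h.2.2.1⟩

theorem IsChord.mono {V W : Finset ℕ} {a b : ℕ} (h : IsChord V a b) (hVW : V ⊆ W) :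
    IsChord W a b := by
  obtain ⟨ha, hb, ⟨c, hc, hc'⟩, ⟨d, hd, hd'⟩⟩ := h
  exact ⟨hVW ha, hVW hb, ⟨c, hVW hc, hc'⟩, ⟨d, hVW hd, hd'⟩⟩

theorem IsChord.ne {V : Finset ℕ} {a b : ℕ} (h : IsChord V a b) : a ≠ b := by
  obtain ⟨_, _, ⟨c, _, hc'⟩, _⟩ := h
  exact hc'.ne.2.2

theorem IsNext.not_isChord {V : Finset ℕ} {a b : ℕ} (h : IsNext V a b) : ¬ IsChord V a b := by
  rintro ⟨_, _, ⟨c, hc, hc'⟩, _⟩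
  exact h.2.2.2 c hc hc'

theorem isNext_or_isNext_or_isChord {V : Finset ℕ} {a b : ℕ} (ha : a ∈ V) (hb : b ∈ V)
    (hab : a ≠ b) : IsNext V a b ∨ IsNext V b a ∨ IsChord V a b := by
  by_cases h1 : ∃ c ∈ V, Cyc a c b
  · by_cases h2 : ∃ c ∈ V, Cyc b c a
    · exact Or.inr (Or.inr ⟨ha, hb, h1, h2⟩)
    · push Not at h2
      exact Or.inr (Or.inl ⟨hb, ha, hab.symm, h2⟩)
  · push Not at h1
    exact Or.inl ⟨ha, hb, hab, h1⟩

theorem isChord_of_crosses {V : Finset ℕ} {a b c d : ℕ} (ha : a ∈ V) (hb : b ∈ V) (hc : c ∈ V)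
    (hd : d ∈ V) (h : Crosses a b c d) : IsChord V a b := by
  rcases h with h | h
  · exact ⟨ha, hb, ⟨c, hc, h.1⟩, ⟨d, hd, h.2⟩⟩
  · exact ⟨ha, hb, ⟨d, hd, h.1⟩, ⟨c, hc, h.2⟩⟩

/-- A rank function on `V` that orders the vertices as they are met when running once around the
polygon from `a`. -/
theorem exists_rank (V : Finset ℕ) (a : ℕ) (ha : a ∈ V) :
    ∃ r : ℕ → ℕ, ∀ b ∈ V, ∀ c ∈ V, b ≠ a → c ≠ a → (r b < r c ↔ Cyc a b c) := by
  obtain ⟨N, hN⟩ : ∃ N, ∀ b ∈ V, b < N := ⟨V.sup id + 1, fun b hb =>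
    Nat.lt_succ_of_le (Finset.le_sup (f := id) hb)⟩
  refine ⟨fun b => if a < b then b else b + N, fun b hb c hc hba hca => ?_⟩
  have := hN b hb
  have := hN c hc
  have := hN a ha
  unfold Cyc
  dsimp only
  split_ifs <;> omega

theorem exists_isNext {V : Finset ℕ} {a b : ℕ} (ha : a ∈ V) (hb : b ∈ V) (hab : a ≠ b) :
    ∃ c, IsNext V a c := by
  obtain ⟨r, hr⟩ := exists_rank V a ha
  obtain ⟨c, hc, hmin⟩ := Finset.exists_min_image (V.erase a) r
    ⟨b, Finset.mem_erase.2 ⟨hab.symm, hb⟩⟩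
  rw [Finset.mem_erase] at hc
  refine ⟨c, ha, hc.2, hc.1.symm, fun w hw h => ?_⟩
  have := hmin w (Finset.mem_erase.2 ⟨h.ne.1.symm, hw⟩)
  have := (hr w hw c hc.2 h.ne.1.symm hc.1).2 h
  omega

theorem exists_isNext_left {V : Finset ℕ} {a b : ℕ} (ha : a ∈ V) (hb : b ∈ V) (hab : a ≠ b) :
    ∃ c, IsNext V c a := by
  obtain ⟨r, hr⟩ := exists_rank V a ha
  obtain ⟨c, hc, hmax⟩ := Finset.exists_max_image (V.erase a) r
    ⟨b, Finset.mem_erase.2 ⟨hab.symm, hb⟩⟩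
  rw [Finset.mem_erase] at hc
  refine ⟨c, hc.2, ha, hc.1, fun w hw h => ?_⟩
  have := hmax w (Finset.mem_erase.2 ⟨h.ne.2.1, hw⟩)
  have := (hr c hc.2 w hw hc.1 h.ne.2.1).2 h.rotate.rotate
  omega

theorem IsNext.unique {V : Finset ℕ} {a b c : ℕ} (hb : IsNext V a b) (hc : IsNext V a c) :
    b = c := by
  by_contra h
  have h1 := hb.2.2.2 c hc.2.1
  have h2 := hc.2.2.2 b hb.2.1
  have h3 := hb.2.2.1
  have h4 := hc.2.2.1
  unfold Cyc at *; omega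

theorem IsNext.unique_left {V : Finset ℕ} {a b c : ℕ} (hb : IsNext V b a) (hc : IsNext V c a) :
    b = c := by
  by_contra h
  have h1 := hb.2.2.2 c hc.1
  have h2 := hc.2.2.2 b hb.1
  have h3 := hb.2.2.1
  have h4 := hc.2.2.1
  unfold Cyc at *; omega

/-- The neighbours `u`, `v` of `x` on a polygon with a further vertex `w`. -/
theorem IsNext.cyc {V : Finset ℕ} {u x v w : ℕ} (hu : IsNext V u x) (hv : IsNext V x v)
    (hw : w ∈ V) (hwx : w ≠ x) (hwu : w ≠ u) : Cyc u x v := by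
  have h1 := hu.2.2.2 w hw
  have h2 := hv.2.2.2 w hw
  have h3 := hu.2.2.2 v hv.2.1
  have h4 := hu.2.2.1
  have h5 := hv.2.2.1
  unfold Cyc at *; omega

theorem IsNext.cyc' {V : Finset ℕ} {u x v w : ℕ} (hu : IsNext V u x) (hv : IsNext V x v)
    (hw : w ∈ V) (hwx : w ≠ x) (hwu : w ≠ u) (hwv : w ≠ v) : Cyc v w u := by
  have h0 := hu.cyc hv hw hwx hwu
  have h1 := hu.2.2.2 w hw
  have h2 := hv.2.2.2 w hw
  unfold Cyc at *; omega

theorem IsNext.eq_of_crosses {V : Finset ℕ} {u x v e f : ℕ} (hu : IsNext V u x)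
    (hv : IsNext V x v) (he : e ∈ V) (hf : f ∈ V) (h : Crosses u v e f) : e = x ∨ f = x := by
  have h1 := hu.2.2.2 e he
  have h2 := hv.2.2.2 e he
  have h3 := hu.2.2.2 f hf
  have h4 := hv.2.2.2 f hf
  have h5 := hu.2.2.1
  have h6 := hv.2.2.1
  have h7 := hu.2.2.2 v hv.2.1
  unfold Crosses Cyc at *; grind (splits := 60)

theorem isChord_erase {V : Finset ℕ} {u x v c d : ℕ} (hu : IsNext V u x) (hv : IsNext V x v)
    (h : IsChord V c d) (hcx : c ≠ x) (hdx : d ≠ x) (hne : s(c, d) ≠ s(u, v)) :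
    IsChord (V.erase x) c d := by
  have key : ∀ c d, c ∈ V → d ∈ V → c ≠ x → d ≠ x → ¬ (c = u ∧ d = v) → (∃ w ∈ V, Cyc c w d) →
      ∃ w ∈ V.erase x, Cyc c w d := by
    rintro c d hc hd hcx hdx hne ⟨w, hw, hwc⟩
    by_cases hwx : w = x
    · subst hwx
      have h1 := hu.2.2.2 c hc
      have h2 := hv.2.2.2 d hd
      by_cases hcu : c = u
      · refine ⟨v, Finset.mem_erase.2 ⟨hv.2.2.1.symm, hv.2.1⟩, ?_⟩
        have h5 : d ≠ v := fun h => hne ⟨hcu, h⟩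
        have h6 := hv.2.2.1
        have h7 := hv.2.2.2 c hc
        have h8 := hu.2.2.2 v hv.2.1
        clear hu hv
        unfold Cyc at *; omega
      · refine ⟨u, Finset.mem_erase.2 ⟨hu.2.2.1, hu.1⟩, ?_⟩
        have h6 := hu.2.2.1
        have h7 := hu.2.2.2 d hd
        clear hu hv
        unfold Cyc at *; omega
    · exact ⟨w, Finset.mem_erase.2 ⟨hwx, hw⟩, hwc⟩
  refine ⟨Finset.mem_erase.2 ⟨hcx, h.1⟩, Finset.mem_erase.2 ⟨hdx, h.2.1⟩,
    key c d h.1 h.2.1 hcx hdx ?_ h.2.2.1, key d c h.2.1 h.1 hdx hcx ?_ h.2.2.2⟩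
  · rintro ⟨rfl, rfl⟩; exact hne rfl
  · rintro ⟨rfl, rfl⟩; exact hne Sym2.eq_swap

theorem isChord_of_isNext {V : Finset ℕ} {u x v : ℕ} (hV : 4 ≤ V.card) (hu : IsNext V u x)
    (hv : IsNext V x v) : IsChord V u v := by
  obtain ⟨w, hw, hw'⟩ : ∃ w ∈ V, w ∉ ({x, u, v} : Finset ℕ) :=
    Finset.exists_mem_notMem_of_card_lt_card (lt_of_le_of_lt Finset.card_le_three hV)
  simp only [Finset.mem_insert, Finset.mem_singleton, not_or] at hw'
  exact ⟨hu.1, hv.2.1, ⟨x, hu.2.1, hu.cyc hv hw hw'.1 hw'.2.1⟩,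
    ⟨w, hw, hu.cyc' hv hw hw'.1 hw'.2.1 hw'.2.2⟩⟩

theorem BraceSystem.mem_of_mem {V : Finset ℕ} {B : Finset (Sym2 ℕ)} (h : BraceSystem V B)
    {a b : ℕ} (hab : s(a, b) ∈ B) : a ∈ V ∧ b ∈ V :=
  ⟨(h.isChord a b hab).1, (h.isChord a b hab).2.1⟩

/-- The pair of neighbours of `x` is crossed by every brace at `x`. -/
theorem crosses_of_isChord {V : Finset ℕ} {u x v y : ℕ} (hu : IsNext V u x) (hv : IsNext V x v)
    (h : IsChord V x y) : Crosses u v x y := by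
  have hyx := h.ne.symm
  have hyu : y ≠ u := by rintro rfl; exact hu.not_isChord h.symm
  have hyv : y ≠ v := by rintro rfl; exact hv.not_isChord h
  exact crosses_of_cyc (hu.cyc hv h.2.1 hyx hyu) (hu.cyc' hv h.2.1 hyx hyu hyv)

theorem crosses_neighbour {V : Finset ℕ} {u x d e f : ℕ} (hu : IsNext V u x)
    (he : e ∈ V) (hf : f ∈ V) (hex : e ≠ x) (hfx : f ≠ x) (hdx : d ≠ x)
    (h : Crosses u d e f) : Crosses x d e f := by
  have h1 := hu.2.2.2 e he
  have h3 := hu.2.2.2 f hf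
  have h5 := hu.2.2.1
  clear hu
  unfold Crosses Cyc at *; grind (splits := 60)

theorem crosses_neighbour' {V : Finset ℕ} {v x d e f : ℕ} (hv : IsNext V x v)
    (he : e ∈ V) (hf : f ∈ V) (hex : e ≠ x) (hfx : f ≠ x) (hdx : d ≠ x)
    (h : Crosses v d e f) : Crosses x d e f := by
  have h1 := hv.2.2.2 e he
  have h3 := hv.2.2.2 f hf
  have h5 := hv.2.2.1
  clear hv
  unfold Crosses Cyc at *; grind (splits := 60)

/-! ### Deleting a vertex -/

/-- A chord of `V` that ends at `x` becomes a chord of `V \ {x}` when its end `x` is moved to one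
of the two neighbours of `x`, and the braces away from `x` that cross the new chord cross the
old one. -/
theorem exists_isChord_erase {V : Finset ℕ} {u x v d : ℕ} (hV : 5 ≤ V.card) (hu : IsNext V u x)
    (hv : IsNext V x v) (hd : IsChord V x d) :
    ∃ u', IsChord (V.erase x) u' d ∧ (u' = u ∨ u' = v) ∧ ∀ e ∈ V, ∀ f ∈ V, e ≠ x → f ≠ x →
      Crosses u' d e f → Crosses x d e f := by
  have hdx := hd.ne.symm
  have hdu : d ≠ u := by rintro rfl; exact hu.not_isChord hd.symm
  have hdv : d ≠ v := by rintro rfl; exact hv.not_isChord hd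
  have huxv := hu.cyc hv hd.2.1 hdx hdu
  have hvdu := hu.cyc' hv hd.2.1 hdx hdu hdv
  obtain ⟨w, hw, hw'⟩ : ∃ w ∈ V, w ∉ ({x, u, v, d} : Finset ℕ) :=
    Finset.exists_mem_notMem_of_card_lt_card (lt_of_le_of_lt Finset.card_le_four hV)
  simp only [Finset.mem_insert, Finset.mem_singleton, not_or] at hw'
  have hvwu := hu.cyc' hv hw hw'.1 hw'.2.1 hw'.2.2.1
  have hmem : ∀ a ∈ V, a ≠ x → a ∈ V.erase x := fun a ha hax => Finset.mem_erase.2 ⟨hax, ha⟩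
  rcases cyc_total hw'.2.2.2 hdu hw'.2.1 with h | h
  · refine ⟨v, ⟨hmem v hv.2.1 hv.2.2.1.symm, hmem d hd.2.1 hdx, ⟨w, hmem w hw hw'.1, ?_⟩,
      ⟨u, hmem u hu.1 hu.2.2.1, ?_⟩⟩, Or.inr rfl, fun e he f hf hex hfx hc =>
      crosses_neighbour' hv he hf hex hfx hdx hc⟩
    · unfold Cyc at *; omega
    · exact hvdu.rotate
  · refine ⟨u, ⟨hmem u hu.1 hu.2.2.1, hmem d hd.2.1 hdx, ⟨v, hmem v hv.2.1 hv.2.2.1.symm, ?_⟩,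
      ⟨w, hmem w hw hw'.1, ?_⟩⟩, Or.inl rfl, fun e he f hf hex hfx hc =>
      crosses_neighbour hu he hf hex hfx hdx hc⟩
    · exact hvdu.rotate.rotate
    · unfold Cyc at *; omega

/-- A removable vertex of a brace system carries exactly one brace, its two neighbours are not
joined by a brace, and deleting it leaves a brace system. -/
theorem BraceSystem.erase {V : Finset ℕ} {B : Finset (Sym2 ℕ)} (h : BraceSystem V B)
    (hV : 5 ≤ V.card) {u x v : ℕ} (hu : IsNext V u x) (hv : IsNext V x v)
    (hr : Removable V B x) :
    ∃ y, s(x, y) ∈ B ∧ (∀ z, s(x, z) ∈ B → z = y) ∧ s(u, v) ∉ B ∧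
      BraceSystem (V.erase x) (B.erase s(x, y)) := by
  have huv := isChord_of_isNext (by omega) hu hv
  -- the chord of the two neighbours is crossed only by braces at `x`
  obtain ⟨y, hy⟩ : ∃ y, s(x, y) ∈ B := by
    obtain ⟨e, f, hef, hc⟩ := h.cover u v huv
    have hm := h.mem_of_mem hef
    rcases hu.eq_of_crosses hv hm.1 hm.2 hc with rfl | rfl
    · exact ⟨f, hef⟩
    · exact ⟨e, Sym2.eq_swap ▸ hef⟩
  have huniq : ∀ z, s(x, z) ∈ B → z = y := by
    intro z hz
    obtain ⟨c, d, hcd, hc, hp⟩ := h.priv x y hy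
    have hne := hc.ne
    by_cases huvcd : s(c, d) = s(u, v)
    · have h1 := (crosses_of_isChord hu hv (h.isChord x z hz)).comm.congr_right huvcd.symm
      have h2 := hp x z hz h1.comm
      rcases Sym2.eq_iff.1 h2 with h3 | h3
      · exact h3.2
      · exact h3.2.trans h3.1
    · obtain ⟨e, f, hef, hex, hfx, hc'⟩ :=
        hr c d (isChord_erase hu hv hcd hne.2.1 hne.2.2.2.1 huvcd)
      rcases Sym2.eq_iff.1 (hp e f hef hc') with h3 | h3
      · exact absurd h3.1 hex
      · exact absurd h3.2 hfx
  have hmemB : ∀ a b, s(a, b) ∈ B.erase s(x, y) ↔ s(a, b) ∈ B ∧ a ≠ x ∧ b ≠ x := by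
    intro a b
    rw [Finset.mem_erase]
    constructor
    · rintro ⟨h1, h2⟩
      refine ⟨h2, ?_, ?_⟩
      · rintro rfl; exact h1 (by rw [huniq b h2])
      · rintro rfl; rw [Sym2.eq_swap] at h1 h2; exact h1 (by rw [huniq a h2])
    · rintro ⟨h1, h2, h3⟩
      refine ⟨fun h4 => ?_, h1⟩
      rcases Sym2.eq_iff.1 h4 with h5 | h5
      · exact h2 h5.1
      · exact h3 h5.2
  have hpriv : ∀ a b, s(a, b) ∈ B.erase s(x, y) → ∃ c d, IsChord (V.erase x) c d ∧
      Crosses c d a b ∧ ∀ e f, s(e, f) ∈ B.erase s(x, y) → Crosses c d e f →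
        s(e, f) = s(a, b) := by
    intro a b hab
    obtain ⟨hab, hax, hbx⟩ := (hmemB a b).1 hab
    have hm := h.mem_of_mem hab
    -- a private chord that avoids `x` stays private, one at `x` is moved to a neighbour of `x`
    have hmove : ∀ d, IsChord V x d → (∀ e f, s(e, f) ∈ B → Crosses x d e f →
        s(e, f) = s(a, b)) → ∃ c d, IsChord (V.erase x) c d ∧
        Crosses c d a b ∧ ∀ e f, s(e, f) ∈ B.erase s(x, y) → Crosses c d e f →
        s(e, f) = s(a, b) := by
      intro d hd hp
      obtain ⟨u', hu', -, hcr⟩ := exists_isChord_erase hV hu hv hd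
      obtain ⟨e, f, hef, hex, hfx, hc'⟩ := hr u' d hu'
      have hm' := h.mem_of_mem hef
      have heq := hp e f hef (hcr e hm'.1 f hm'.2 hex hfx hc')
      refine ⟨u', d, hu', hc'.congr_right heq, fun e' f' hef' hc'' => ?_⟩
      obtain ⟨h1, h2, h3⟩ := (hmemB e' f').1 hef'
      have hm'' := h.mem_of_mem h1
      exact hp e' f' h1 (hcr e' hm''.1 f' hm''.2 h2 h3 hc'')
    obtain ⟨c, d, hcd, hc, hp⟩ := h.priv a b hab
    by_cases hcx : c = x
    · subst hcx
      exact hmove d hcd hp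
    by_cases hdx : d = x
    · subst hdx
      exact hmove c hcd.symm fun e f hef hce => hp e f hef hce.swap_left
    · refine ⟨c, d, isChord_erase hu hv hcd hcx hdx fun heq => ?_, hc,
        fun e f hef hc' => hp e f ((hmemB e f).1 hef).1 hc'⟩
      rcases hu.eq_of_crosses hv hm.1 hm.2 (hc.comm.congr_right heq).comm with h1 | h1
      · exact hax h1
      · exact hbx h1
  have huvB : s(u, v) ∉ B := by
    intro huvB
    obtain ⟨c, d, hcd, hc, -⟩ := hpriv u v ((hmemB u v).2 ⟨huvB, hu.2.2.1, hv.2.2.1.symm⟩)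
    have h1 := Finset.mem_erase.1 hcd.1
    have h2 := Finset.mem_erase.1 hcd.2.1
    rcases hu.eq_of_crosses hv h1.2 h2.2 hc.comm with h3 | h3
    · exact h1.1 h3
    · exact h2.1 h3
  refine ⟨y, hy, huniq, huvB, ?_, ?_, ?_, hpriv⟩
  · rw [Finset.card_erase_of_mem hu.2.1]; omega
  · intro a b hab
    obtain ⟨hab, hax, hbx⟩ := (hmemB a b).1 hab
    exact isChord_erase hu hv (h.isChord a b hab) hax hbx fun heq => huvB (heq ▸ hab)
  · intro a b hab
    obtain ⟨e, f, hef, hex, hfx, hc⟩ := hr a b hab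
    exact ⟨e, f, (hmemB e f).2 ⟨hef, hex, hfx⟩, hc⟩

/-! ### Cutting along a private chord -/

/-- The pair `{u, v}` separates the ends `x` and `y` of a brace and is crossed by no other brace;
`x` lies on the arc from `u` to `v`. -/
structure Cut (V : Finset ℕ) (B : Finset (Sym2 ℕ)) (u v x y : ℕ) : Prop where
  system : BraceSystem V B
  left_mem : u ∈ V
  right_mem : v ∈ V
  cyc_left : Cyc u x v
  cyc_right : Cyc v y u
  brace : s(x, y) ∈ B
  unique : ∀ a b, s(a, b) ∈ B → Crosses u v a b → s(a, b) = s(x, y)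

open Classical in
/-- One side of a cut: the vertices on the arc from `u` to `v`, together with the far end `y` of the
brace that crosses `{u, v}`. -/
noncomputable def sideV (V : Finset ℕ) (u v y : ℕ) : Finset ℕ :=
  insert y (V.filter (OnArc u v))

open Classical in
/-- The braces with both ends on the arc from `u` to `v`. -/
noncomputable def innerB (B : Finset (Sym2 ℕ)) (u v : ℕ) : Finset (Sym2 ℕ) :=
  B.filter fun e => ∀ a ∈ e, OnArc u v a

/-- Some pair `{s, y}`, with `s` inside the arc from `u` to `v`, is crossed by no brace of this side
of the cut other than possibly `{u, v}`. -/
def Needs (V : Finset ℕ) (B : Finset (Sym2 ℕ)) (u v y : ℕ) : Prop :=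
  ∃ s ∈ V, Cyc u s v ∧ ∀ a b, s(a, b) ∈ B → OnArc u v a → OnArc u v b → s(a, b) ≠ s(u, v) →
    ¬ Crosses s y a b

open Classical in
/-- The braces of one side of a cut: the inner ones, the brace `{x, y}` across the cut, and the pair
`{u, v}` if it is needed to have all chords crossed. -/
noncomputable def sideB (V : Finset ℕ) (B : Finset (Sym2 ℕ)) (u v x y : ℕ) : Finset (Sym2 ℕ) :=
  insert s(x, y) (if Needs V B u v y then insert s(u, v) (innerB B u v) else innerB B u v)

theorem mem_sideV {V : Finset ℕ} {u v y a : ℕ} :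
    a ∈ sideV V u v y ↔ a = y ∨ (a ∈ V ∧ OnArc u v a) := by
  simp [sideV]

theorem mem_innerB {B : Finset (Sym2 ℕ)} {u v a b : ℕ} :
    s(a, b) ∈ innerB B u v ↔ s(a, b) ∈ B ∧ OnArc u v a ∧ OnArc u v b := by
  simp [innerB]

theorem mem_sideB {V : Finset ℕ} {B : Finset (Sym2 ℕ)} {u v x y a b : ℕ} :
    s(a, b) ∈ sideB V B u v x y ↔ s(a, b) = s(x, y) ∨
      (s(a, b) ∈ B ∧ OnArc u v a ∧ OnArc u v b) ∨ (Needs V B u v y ∧ s(a, b) = s(u, v)) := by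
  rw [← mem_innerB]
  unfold sideB
  split_ifs with h
  · simp only [Finset.mem_insert, h, true_and]; tauto
  · simp only [Finset.mem_insert, h, false_and, or_false]

theorem onArc_left {u v : ℕ} : OnArc u v u := Or.inl rfl

theorem onArc_right {u v : ℕ} : OnArc u v v := Or.inr (Or.inl rfl)

theorem OnArc.of_eq {u v a b c d : ℕ} (hc : OnArc u v c) (hd : OnArc u v d)
    (h : s(a, b) = s(c, d)) : OnArc u v a ∧ OnArc u v b := by
  rcases Sym2.eq_iff.1 h with ⟨rfl, rfl⟩ | ⟨rfl, rfl⟩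
  · exact ⟨hc, hd⟩
  · exact ⟨hd, hc⟩

theorem eq_of_onArc_of_onArc {u v a b : ℕ} (hab : a ≠ b) (ha : OnArc u v a) (hb : OnArc u v b)
    (ha' : OnArc v u a) (hb' : OnArc v u b) : s(a, b) = s(u, v) := by
  rw [Sym2.eq_iff]
  unfold OnArc Cyc at *; omega

namespace Cut

variable {V : Finset ℕ} {B : Finset (Sym2 ℕ)} {u v x y : ℕ}

theorem symm (h : Cut V B u v x y) : Cut V B v u y x where
  system := h.system
  left_mem := h.right_mem
  right_mem := h.left_mem
  cyc_left := h.cyc_right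
  cyc_right := h.cyc_left
  brace := Sym2.eq_swap ▸ h.brace
  unique a b hab hc := (h.unique a b hab hc.swap_left).trans Sym2.eq_swap

theorem ne (h : Cut V B u v x y) : u ≠ v := h.cyc_left.ne.2.2

theorem mem_x (h : Cut V B u v x y) : x ∈ V := (h.system.mem_of_mem h.brace).1

theorem mem_y (h : Cut V B u v x y) : y ∈ V := (h.system.mem_of_mem h.brace).2

theorem isChord (h : Cut V B u v x y) : IsChord V u v :=
  ⟨h.left_mem, h.right_mem, ⟨x, h.mem_x, h.cyc_left⟩, ⟨y, h.mem_y, h.cyc_right⟩⟩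

theorem crosses (h : Cut V B u v x y) : Crosses u v x y := crosses_of_cyc h.cyc_left h.cyc_right

theorem sideV_subset (h : Cut V B u v x y) : sideV V u v y ⊆ V := by
  intro a ha
  rcases mem_sideV.1 ha with rfl | ha
  · exact h.mem_y
  · exact ha.1

/-- Every brace other than the one across the cut lies on one of the two closed arcs. -/
theorem onArc_or_onArc (h : Cut V B u v x y) {a b : ℕ} (hab : s(a, b) ∈ B)
    (hne : s(a, b) ≠ s(x, y)) :
    (OnArc u v a ∧ OnArc u v b) ∨ (OnArc v u a ∧ OnArc v u b) := by
  have h1 : ¬ Crosses u v a b := fun hc => hne (h.unique a b hab hc)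
  have huv := h.ne
  clear h
  unfold Crosses OnArc Cyc at *; grind (splits := 60)

theorem needs_of_mem (h : Cut V B u v x y) (huv : s(u, v) ∈ B) : Needs V B u v y := by
  have key : ∀ s t, s ∈ V → Cyc u s v → Cyc v t u → (∀ e f, s(e, f) ∈ B → Crosses s t e f →
      s(e, f) = s(u, v)) → Needs V B u v y := by
    intro s t hs hus hvt hp
    exact ⟨s, hs, hus, fun a b hab ha hb hne hc =>
      hne (hp a b hab (crosses_change_far hus h.cyc_right hvt ha hb hc))⟩
  obtain ⟨c, d, hcd, hc, hp⟩ := h.system.priv u v huv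
  rcases hc.comm with h1 | h1
  · exact key c d hcd.1 h1.1 h1.2 hp
  · exact key d c hcd.2.1 h1.1 h1.2 fun e f hef hce => hp e f hef hce.swap_left

theorem isChord_side (h : Cut V B u v x y) {W : Finset ℕ} {a b : ℕ} (hab : IsChord W a b)
    (ha : OnArc u v a) (hb : OnArc u v b) : IsChord (sideV W u v y) a b := by
  obtain ⟨haV, hbV, ⟨c, hc, hc'⟩, ⟨d, hd, hd'⟩⟩ := hab
  have hne := hc'.ne.2.2
  refine ⟨mem_sideV.2 (Or.inr ⟨haV, ha⟩), mem_sideV.2 (Or.inr ⟨hbV, hb⟩), ?_⟩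
  rcases cyc_or_cyc_of_onArc ha hb hne h.cyc_right with hy | hy
  · exact ⟨⟨y, mem_sideV.2 (Or.inl rfl), hy⟩, ⟨d, mem_sideV.2 (Or.inr ⟨hd,
      onArc_of_cyc_of_cyc hb ha h.cyc_right hy hd'⟩), hd'⟩⟩
  · exact ⟨⟨c, mem_sideV.2 (Or.inr ⟨hc, onArc_of_cyc_of_cyc ha hb h.cyc_right hy hc'⟩), hc'⟩,
      ⟨y, mem_sideV.2 (Or.inl rfl), hy⟩⟩

theorem isChord_far (h : Cut V B u v x y) {s : ℕ} (hs : s ∈ V) (hus : Cyc u s v) :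
    IsChord (sideV V u v y) s y := by
  refine ⟨mem_sideV.2 (Or.inr ⟨hs, Or.inr (Or.inr hus)⟩), mem_sideV.2 (Or.inl rfl),
    ⟨v, mem_sideV.2 (Or.inr ⟨h.right_mem, onArc_right⟩), ?_⟩,
    ⟨u, mem_sideV.2 (Or.inr ⟨h.left_mem, onArc_left⟩), ?_⟩⟩
  · have := h.cyc_right
    unfold Cyc at *; omega
  · have := h.cyc_right
    unfold Cyc at *; omega

theorem cyc_of_isChord_far (h : Cut V B u v x y) {s : ℕ} (hs : IsChord (sideV V u v y) s y) :
    s ∈ V ∧ Cyc u s v := by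
  obtain ⟨h1, -, ⟨c, hc, hc'⟩, ⟨d, hd, hd'⟩⟩ := hs
  have hy := h.cyc_right
  rcases mem_sideV.1 h1 with rfl | ⟨h2, h3⟩
  · exact absurd rfl hc'.ne.2.2
  refine ⟨h2, ?_⟩
  rcases mem_sideV.1 hc with rfl | ⟨-, hc⟩
  · exact absurd rfl hc'.ne.2.1
  rcases mem_sideV.1 hd with rfl | ⟨-, hd⟩
  · exact absurd rfl hd'.ne.1
  clear h
  unfold OnArc Cyc at *; grind (splits := 60)

theorem crosses_far {s : ℕ} (h : Cut V B u v x y) (hs : Cyc u s v) : Crosses s y u v :=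
  (crosses_of_cyc hs h.cyc_right).comm

/-- A side of a cut is a brace system, provided that the pair `{u, v}` is not added to both sides
without being a brace. -/
theorem braceSystem_side (h : Cut V B u v x y)
    (hK : Needs V B u v y → s(u, v) ∈ B ∨ ¬ Needs V B v u x) :
    BraceSystem (sideV V u v y) (sideB V B u v x y) := by
  have hxy : ∀ c a b, s(a, b) = s(x, y) → ¬ Crosses c y a b := by
    intro c a b heq hc
    exact (hc.congr_right heq).ne.2.2.2.2.1 rfl
  have hfar : ∀ c d a b, OnArc u v c → OnArc u v d → s(a, b) = s(u, v) → ¬ Crosses c d a b :=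
    fun c d a b hc hd heq hcr =>
      not_crosses_of_onArc hc hd onArc_right onArc_left (hcr.congr_right heq)
  refine ⟨?_, ?_, ?_, ?_⟩
  · have hsub : ({u, v, x, y} : Finset ℕ) ⊆ sideV V u v y := by
      intro a ha
      simp only [Finset.mem_insert, Finset.mem_singleton] at ha
      rcases ha with rfl | rfl | rfl | rfl
      · exact mem_sideV.2 (Or.inr ⟨h.left_mem, onArc_left⟩)
      · exact mem_sideV.2 (Or.inr ⟨h.right_mem, onArc_right⟩)
      · exact mem_sideV.2 (Or.inr ⟨h.mem_x, Or.inr (Or.inr h.cyc_left)⟩)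
      · exact mem_sideV.2 (Or.inl rfl)
    refine le_trans (le_of_eq ?_) (Finset.card_le_card hsub)
    have := h.crosses.ne
    rw [Finset.card_insert_of_notMem, Finset.card_insert_of_notMem, Finset.card_pair] <;>
      simp <;> tauto
  · intro a b hab
    rcases mem_sideB.1 hab with h1 | ⟨h1, h2, h3⟩ | ⟨-, h1⟩
    · have h2 := h.isChord_far h.mem_x h.cyc_left
      rcases Sym2.eq_iff.1 h1 with ⟨rfl, rfl⟩ | ⟨rfl, rfl⟩
      · exact h2
      · exact h2.symm
    · exact h.isChord_side (h.system.isChord a b h1) h2 h3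
    · have h2 := h.isChord_side h.isChord onArc_left onArc_right
      rcases Sym2.eq_iff.1 h1 with ⟨rfl, rfl⟩ | ⟨rfl, rfl⟩
      · exact h2
      · exact h2.symm
  · have hcov : ∀ s, IsChord (sideV V u v y) s y → ∃ c d, s(c, d) ∈ sideB V B u v x y ∧
        Crosses s y c d := by
      intro s hs
      obtain ⟨hs1, hs2⟩ := h.cyc_of_isChord_far hs
      by_cases hN : Needs V B u v y
      · exact ⟨u, v, mem_sideB.2 (Or.inr (Or.inr ⟨hN, rfl⟩)), h.crosses_far hs2⟩
      · have hN' := hN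
        unfold Needs at hN'
        push Not at hN'
        obtain ⟨a, b, hab, ha, hb, -, hc⟩ := hN' s hs1 hs2
        exact ⟨a, b, mem_sideB.2 (Or.inr (Or.inl ⟨hab, ha, hb⟩)), hc⟩
    intro a b hab
    rcases mem_sideV.1 hab.1 with rfl | ⟨-, ha⟩
    · obtain ⟨c, d, hcd, hc⟩ := hcov b hab.symm
      exact ⟨c, d, hcd, hc.swap_left⟩
    rcases mem_sideV.1 hab.2.1 with rfl | ⟨-, hb⟩
    · exact hcov a hab
    obtain ⟨e, f, hef, hc⟩ := h.system.cover a b (hab.mono h.sideV_subset)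
    refine ⟨e, f, ?_, hc⟩
    by_cases hne : s(e, f) = s(x, y)
    · exact mem_sideB.2 (Or.inl hne)
    rcases h.onArc_or_onArc hef hne with h1 | h1
    · exact mem_sideB.2 (Or.inr (Or.inl ⟨hef, h1⟩))
    · exact absurd hc (not_crosses_of_onArc ha hb h1.1 h1.2)
  · intro a b hab
    have huv : Needs V B u v y → s(a, b) = s(u, v) → ∃ c d, IsChord (sideV V u v y) c d ∧
        Crosses c d a b ∧ ∀ e f, s(e, f) ∈ sideB V B u v x y → Crosses c d e f →
        s(e, f) = s(a, b) := by
      rintro ⟨s, hs, hus, hN⟩ heq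
      refine ⟨s, y, h.isChord_far hs hus, (h.crosses_far hus).congr_right heq.symm,
        fun e f hef hc => ?_⟩
      rcases mem_sideB.1 hef with h1 | ⟨h1, h2, h3⟩ | ⟨-, h1⟩
      · exact absurd hc (hxy s e f h1)
      · by_contra h4
        exact hN e f h1 h2 h3 (fun h5 => h4 (h5.trans heq.symm)) hc
      · exact h1.trans heq.symm
    rcases mem_sideB.1 hab with h1 | ⟨h1, h2, h3⟩ | ⟨hN, h1⟩
    · refine ⟨u, v, h.isChord_side h.isChord onArc_left onArc_right,
        h.crosses.congr_right h1.symm, fun e f hef hc => ?_⟩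
      rcases mem_sideB.1 hef with h4 | ⟨h4, h5, h6⟩ | ⟨-, h4⟩
      · exact h4.trans h1.symm
      · exact absurd hc (fun hc => not_crosses_of_onArc h5 h6 onArc_right onArc_left hc.comm)
      · exact absurd rfl (hc.congr_right h4).ne.2.1
    · by_cases heq : s(a, b) = s(u, v)
      · exact huv (h.needs_of_mem (heq ▸ h1)) heq
      have hmix : ∀ c d, c ∈ V → d ∈ V → Cyc u c v → Cyc v d u → Crosses c d a b →
          (∀ e f, s(e, f) ∈ B → Crosses c d e f → s(e, f) = s(a, b)) →
          ∃ c d, IsChord (sideV V u v y) c d ∧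
          Crosses c d a b ∧ ∀ e f, s(e, f) ∈ sideB V B u v x y → Crosses c d e f →
          s(e, f) = s(a, b) := by
        intro c d hcV hdV hc hd hcr hp
        have hN : ¬ Needs V B u v y := by
          intro hN
          rcases hK hN with hB | hN2
          · exact heq (hp u v hB (crosses_of_cyc hc hd).comm).symm
          · unfold Needs at hN2
            push Not at hN2
            obtain ⟨e, f, hef, he, hf, hne, hcr'⟩ := hN2 d hdV hd
            have h4 := crosses_change_far hd h.cyc_left hc he hf hcr'
            have h5 := hp e f hef h4.swap_left
            have h6 := OnArc.of_eq h2 h3 h5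
            exact hne ((eq_of_onArc_of_onArc hcr'.ne.2.2.2.2.2 h6.1 h6.2 he hf).trans Sym2.eq_swap)
        refine ⟨c, y, h.isChord_far hcV hc, crosses_change_far hc hd h.cyc_right h2 h3 hcr,
          fun e f hef hce => ?_⟩
        rcases mem_sideB.1 hef with h4 | ⟨h4, h5, h6⟩ | ⟨h4, -⟩
        · exact absurd hce (hxy c e f h4)
        · exact hp e f h4 (crosses_change_far hc h.cyc_right hd h5 h6 hce)
        · exact absurd h4 hN
      obtain ⟨c, d, hcd, hc, hp⟩ := h.system.priv a b h1
      rcases cyc_or_cyc (a := c) h.ne with hc1 | hc1 <;>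
        rcases cyc_or_cyc (a := d) h.ne with hd1 | hd1
      · refine ⟨c, d, h.isChord_side hcd hc1 hd1, hc, fun e f hef hce => ?_⟩
        rcases mem_sideB.1 hef with h4 | ⟨h4, h5, h6⟩ | ⟨-, h4⟩
        · exact hp e f (h4 ▸ h.brace) hce
        · exact hp e f h4 hce
        · exact absurd hce (hfar c d e f hc1 hd1 h4)
      · rcases cyc_or_cyc (a := c) h.ne.symm with hc2 | hc2
        · exact absurd hc.comm (not_crosses_of_onArc h2 h3 hc2 (Or.inr (Or.inr hd1)))
        · exact hmix c d hcd.1 hcd.2.1 hc2 hd1 hc hp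
      · rcases cyc_or_cyc (a := d) h.ne.symm with hd2 | hd2
        · exact absurd hc.comm (not_crosses_of_onArc h2 h3 (Or.inr (Or.inr hc1)) hd2)
        · exact hmix d c hcd.2.1 hcd.1 hd2 hc1 hc.swap_left
            fun e f hef hce => hp e f hef hce.swap_left
      · exact absurd hc.comm
          (not_crosses_of_onArc h2 h3 (Or.inr (Or.inr hc1)) (Or.inr (Or.inr hd1)))
    · exact huv hN h1

end Cut

namespace Cut

variable {V : Finset ℕ} {B : Finset (Sym2 ℕ)} {u v x y : ℕ}

theorem not_crosses_self {c d a b : ℕ} (hc : OnArc u v c)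
    (hd : OnArc u v d) (heq : s(a, b) = s(u, v)) : ¬ Crosses c d a b := fun hcr =>
  not_crosses_of_onArc hc hd onArc_right onArc_left (hcr.congr_right heq)

theorem isNext_far (h : Cut V B u v x y) {s : ℕ} (hs : Cyc u s v) :
    ¬ IsNext (sideV V u v y) y s ∧ ¬ IsNext (sideV V u v y) s y := by
  have hy := h.cyc_right
  constructor
  · intro hn
    refine hn.2.2.2 u (mem_sideV.2 (Or.inr ⟨h.left_mem, onArc_left⟩)) ?_
    unfold Cyc at *; omega
  · intro hn
    refine hn.2.2.2 v (mem_sideV.2 (Or.inr ⟨h.right_mem, onArc_right⟩)) ?_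
    unfold Cyc at *; omega

/-- If a side with the pair `{u, v}` has as many braces as possible, then it has an inner vertex
whose neighbours are not joined by a brace: there are too few braces for all these pairs. -/
theorem exists_notMem_side (h : Cut V B u v x y) (hN : Needs V B u v y)
    (hcard : (sideB V B u v x y).card + 2 = (sideV V u v y).card)
    {w : ℕ} (hw : w ∈ V) (huw : Cyc u w v) (hwx : w ≠ x) :
    ∃ s p n, Cyc u s v ∧ s ∈ V ∧ IsNext (sideV V u v y) p s ∧ IsNext (sideV V u v y) s n ∧
      s(p, n) ∉ sideB V B u v x y := by
  classical
  by_contra hcon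
  push Not at hcon
  set S := V.filter fun s => Cyc u s v with hS
  have hmem : ∀ s ∈ S, s ∈ sideV V u v y := fun s hs =>
    mem_sideV.2 (Or.inr ⟨(Finset.mem_filter.1 hs).1, Or.inr (Or.inr (Finset.mem_filter.1 hs).2)⟩)
  have hyV : y ∈ sideV V u v y := mem_sideV.2 (Or.inl rfl)
  have hyS : ∀ s ∈ S, s ≠ y := by
    rintro s hs rfl
    exact not_cyc_of_cyc h.cyc_right (Finset.mem_filter.1 hs).2
  have hp : ∀ s, ∃ p, s ∈ S → IsNext (sideV V u v y) p s := by
    intro s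
    by_cases hs : s ∈ S
    · obtain ⟨p, hp⟩ := exists_isNext_left (hmem s hs) hyV (hyS s hs)
      exact ⟨p, fun _ => hp⟩
    · exact ⟨0, fun h => absurd h hs⟩
  have hn : ∀ s, ∃ n, s ∈ S → IsNext (sideV V u v y) s n := by
    intro s
    by_cases hs : s ∈ S
    · obtain ⟨p, hp⟩ := exists_isNext (hmem s hs) hyV (hyS s hs)
      exact ⟨p, fun _ => hp⟩
    · exact ⟨0, fun h => absurd h hs⟩
  choose p hp using hp
  choose n hn using hn
  have hpy : ∀ s ∈ S, p s ≠ y := by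
    intro s hs heq
    exact (h.isNext_far (Finset.mem_filter.1 hs).2).1 (heq ▸ hp s hs)
  have hny : ∀ s ∈ S, n s ≠ y := by
    intro s hs heq
    exact (h.isNext_far (Finset.mem_filter.1 hs).2).2 (heq ▸ hn s hs)
  have hcyc : ∀ s ∈ S, Cyc (n s) y (p s) := fun s hs =>
    (hp s hs).cyc' (hn s hs) hyV (hyS s hs).symm (hpy s hs).symm (hny s hs).symm
  have hinj : Set.InjOn (fun s => s(p s, n s)) S := by
    intro s hs s' hs' heq
    rcases Sym2.eq_iff.1 heq with ⟨h1, -⟩ | ⟨h1, h2⟩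
    · exact (hp s hs).unique (h1 ▸ hp s' hs')
    · have h3 := hcyc s hs
      rw [h1, h2] at h3
      exact absurd (hcyc s' hs') (not_cyc_of_cyc h3)
  have hsub : insert s(u, v) (insert s(x, y) (S.image fun s => s(p s, n s))) ⊆
      sideB V B u v x y := by
    intro e he
    simp only [Finset.mem_insert, Finset.mem_image] at he
    rcases he with rfl | rfl | ⟨s, hs, rfl⟩
    · exact mem_sideB.2 (Or.inr (Or.inr ⟨hN, rfl⟩))
    · exact mem_sideB.2 (Or.inl rfl)
    · exact hcon s (p s) (n s) (Finset.mem_filter.1 hs).2 (Finset.mem_filter.1 hs).1 (hp s hs)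
        (hn s hs)
  have hc1 : s(x, y) ∉ S.image fun s => s(p s, n s) := by
    intro hx
    obtain ⟨s, hs, heq⟩ := Finset.mem_image.1 hx
    rcases Sym2.eq_iff.1 heq with ⟨-, h1⟩ | ⟨h1, -⟩
    · exact hny s hs h1
    · exact hpy s hs h1
  have hc2 : s(u, v) ∉ insert s(x, y) (S.image fun s => s(p s, n s)) := by
    intro hx
    rcases Finset.mem_insert.1 hx with heq | hx
    · exact absurd rfl (h.crosses.congr_right heq.symm).ne.2.1
    · obtain ⟨s, hs, heq⟩ := Finset.mem_image.1 hx
      have h1 := (Finset.mem_filter.1 hs).2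
      have h4 := h.cyc_right
      have h5 := hcyc s hs
      rcases Sym2.eq_iff.1 heq with ⟨h2, h3⟩ | ⟨h2, h3⟩
      · -- the arc from `u` to `v` contains, besides `s`, one more vertex
        have key : ∀ w' ∈ S, w' = s := by
          intro w' hw'
          by_contra hne
          have h6 := (hp s hs).2.2.2 w' (hmem w' hw')
          have h7 := (hn s hs).2.2.2 w' (hmem w' hw')
          rw [h2] at h6
          rw [h3] at h7
          have h8 := (Finset.mem_filter.1 hw').2
          clear hcon hp hn hpy hny hcyc h
          unfold Cyc at *; omega
        have h6 := key w (Finset.mem_filter.2 ⟨hw, huw⟩)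
        have h7 := key x (Finset.mem_filter.2 ⟨h.mem_x, h.cyc_left⟩)
        exact hwx (h6.trans h7.symm)
      · rw [h2, h3] at h5
        exact not_cyc_of_cyc h4 h5
  have hle := Finset.card_le_card hsub
  rw [Finset.card_insert_of_notMem hc2, Finset.card_insert_of_notMem hc1,
    Finset.card_image_of_injOn hinj] at hle
  have hV : (sideV V u v y) ⊆ insert y (insert u (insert v S)) := by
    intro a ha
    simp only [Finset.mem_insert]
    rcases mem_sideV.1 ha with h1 | ⟨h1, h2 | h2 | h2⟩
    · exact Or.inl h1
    · exact Or.inr (Or.inl h2)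
    · exact Or.inr (Or.inr (Or.inl h2))
    · exact Or.inr (Or.inr (Or.inr (Finset.mem_filter.2 ⟨h1, h2⟩)))
  have h1 := Finset.card_le_card hV
  have h2 := Finset.card_insert_le y (insert u (insert v S))
  have h3 := Finset.card_insert_le u (insert v S)
  have h4 := Finset.card_insert_le v S
  omega

theorem exists_of_not_needs (h : Cut V B u v x y) (hN : ¬ Needs V B v u x) {c d : ℕ}
    (hd : d ∈ V) (hc' : Cyc u c v) (hd' : Cyc v d u) :
    ∃ e f, s(e, f) ∈ B ∧ OnArc v u e ∧ OnArc v u f ∧ s(e, f) ≠ s(u, v) ∧ Crosses c d e f := by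
  unfold Needs at hN
  push Not at hN
  obtain ⟨e, f, hef, he, hf, hne, hc⟩ := hN d hd hd'
  exact ⟨e, f, hef, he, hf, fun h1 => hne (h1.trans Sym2.eq_swap),
    (crosses_change_far hd' h.cyc_left hc' he hf hc).swap_left⟩

/-- A removable inner vertex of a side that contains the pair `{u, v}` is removable in the whole
polygon. -/
theorem removable_of_side (h : Cut V B u v x y) (hK : s(u, v) ∈ B ∨ ¬ Needs V B v u x)
    {s w : ℕ} (hus : Cyc u s v) (hw : w ∈ V) (huw : Cyc u w v) (hwx : w ≠ x)
    (hr : Removable (sideV V u v y) (sideB V B u v x y) s) : Removable V B s := by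
  have hsv := hus.ne
  have hsy : s ≠ y := by rintro rfl; exact not_cyc_of_cyc hus h.cyc_right
  have hsx : s ≠ x := by
    rintro rfl
    have hch : IsChord ((sideV V u v y).erase s) u v :=
      ⟨Finset.mem_erase.2 ⟨hsv.1, mem_sideV.2 (Or.inr ⟨h.left_mem, onArc_left⟩)⟩,
        Finset.mem_erase.2 ⟨hsv.2.1.symm, mem_sideV.2 (Or.inr ⟨h.right_mem, onArc_right⟩)⟩,
        ⟨w, Finset.mem_erase.2 ⟨hwx, mem_sideV.2 (Or.inr ⟨hw, Or.inr (Or.inr huw)⟩)⟩, huw⟩,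
        ⟨y, Finset.mem_erase.2 ⟨hsy.symm, mem_sideV.2 (Or.inl rfl)⟩, h.cyc_right⟩⟩
    obtain ⟨e, f, hef, hes, hfs, hc⟩ := hr u v hch
    rcases mem_sideB.1 hef with h1 | ⟨-, h1, h2⟩ | ⟨-, h1⟩
    · rcases Sym2.eq_iff.1 h1 with h2 | h2
      · exact hes h2.1
      · exact hfs h2.2
    · exact not_crosses_of_onArc h1 h2 onArc_right onArc_left hc.comm
    · exact absurd rfl (hc.congr_right h1).ne.2.1
  have hout : ∀ e, OnArc v u e → e ≠ s := by
    rintro e he rfl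
    exact not_cyc_of_onArc he hus
  have hxys : ∀ e f, s(e, f) = s(x, y) → e ≠ s ∧ f ≠ s := by
    intro e f hef
    rcases Sym2.eq_iff.1 hef with ⟨rfl, rfl⟩ | ⟨rfl, rfl⟩
    · exact ⟨hsx.symm, hsy.symm⟩
    · exact ⟨hsy.symm, hsx.symm⟩
  have hmix : ∀ c d, d ∈ V → Cyc u c v → Cyc v d u →
      ∃ e f, s(e, f) ∈ B ∧ e ≠ s ∧ f ≠ s ∧ Crosses c d e f := by
    intro c d hd hc' hd'
    rcases hK with hK | hK
    · exact ⟨u, v, hK, hsv.1, hsv.2.1.symm, (crosses_of_cyc hc' hd').comm⟩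
    · obtain ⟨e, f, hef, he, hf, -, hc⟩ := h.exists_of_not_needs hK hd hc' hd'
      exact ⟨e, f, hef, hout e he, hout f hf, hc⟩
  have hfar : ∀ c d, IsChord (V.erase s) c d → OnArc v u c → OnArc v u d →
      ∃ e f, s(e, f) ∈ B ∧ e ≠ s ∧ f ≠ s ∧ Crosses c d e f := by
    intro c d hcd hc hd
    obtain ⟨e, f, hef, hcr⟩ := h.system.cover c d (hcd.mono (Finset.erase_subset _ _))
    by_cases hne : s(e, f) = s(x, y)
    · exact ⟨e, f, hef, (hxys e f hne).1, (hxys e f hne).2, hcr⟩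
    rcases h.onArc_or_onArc hef hne with h1 | h1
    · exact absurd hcr (not_crosses_of_onArc hc hd h1.1 h1.2)
    · exact ⟨e, f, hef, hout e h1.1, hout f h1.2, hcr⟩
  intro c d hcd
  have hcV := Finset.mem_of_mem_erase hcd.1
  have hdV := Finset.mem_of_mem_erase hcd.2.1
  rcases cyc_or_cyc (a := c) h.ne with hc1 | hc1 <;>
    rcases cyc_or_cyc (a := d) h.ne with hd1 | hd1
  · have h1 : IsChord ((sideV V u v y).erase s) c d := by
      refine (h.isChord_side hcd hc1 hd1).mono fun a ha => ?_
      rcases mem_sideV.1 ha with rfl | ⟨h1, h2⟩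
      · exact Finset.mem_erase.2 ⟨hsy.symm, mem_sideV.2 (Or.inl rfl)⟩
      · rw [Finset.mem_erase] at h1
        exact Finset.mem_erase.2 ⟨h1.1, mem_sideV.2 (Or.inr ⟨h1.2, h2⟩)⟩
    obtain ⟨e, f, hef, hes, hfs, hc⟩ := hr c d h1
    refine ⟨e, f, ?_, hes, hfs, hc⟩
    rcases mem_sideB.1 hef with h1 | ⟨h1, -⟩ | ⟨-, h1⟩
    · exact h1 ▸ h.brace
    · exact h1
    · exact absurd hc (not_crosses_self hc1 hd1 h1)
  · rcases cyc_or_cyc (a := c) h.ne.symm with hc2 | hc2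
    · exact hfar c d hcd hc2 (Or.inr (Or.inr hd1))
    · exact hmix c d hdV hc2 hd1
  · rcases cyc_or_cyc (a := d) h.ne.symm with hd2 | hd2
    · exact hfar c d hcd (Or.inr (Or.inr hc1)) hd2
    · obtain ⟨e, f, hef, hes, hfs, hc⟩ := hmix d c hcV hd2 hc1
      exact ⟨e, f, hef, hes, hfs, hc.swap_left⟩
  · exact hfar c d hcd (Or.inr (Or.inr hc1)) (Or.inr (Or.inr hd1))

/-- If neither side of a cut needs the pair `{u, v}`, then the end `a` of this pair is not removable
in a side whose far vertex `y` is a neighbour of `a`. -/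
theorem not_removable_side (h : Cut V B u v x y) (hN1 : ¬ Needs V B u v y)
    (hN2 : ¬ Needs V B v u x) {a p n : ℕ} (ha : a = u ∨ a = v)
    (hp : IsNext (sideV V u v y) p a) (hn : IsNext (sideV V u v y) a n) (hpn : p = y ∨ n = y) :
    ¬ Removable (sideV V u v y) (sideB V B u v x y) a := by
  intro hr
  have hsys := h.braceSystem_side fun h1 => absurd h1 hN1
  have haO : OnArc u v a := by
    rcases ha with rfl | rfl
    · exact onArc_left
    · exact onArc_right
  have hny : ∀ c, OnArc u v c → c ≠ y := by
    rintro c hc rfl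
    exact not_cyc_of_onArc hc h.cyc_right
  have hax : a ≠ x := by
    rintro rfl
    have := h.cyc_left.ne
    rcases ha with h1 | h1
    · exact this.1 h1.symm
    · exact this.2.1 h1
  obtain ⟨w, haw⟩ : ∃ w, s(a, w) ∈ sideB V B u v x y := by
    obtain ⟨e, f, hef, hc⟩ := hsys.cover p n (isChord_of_isNext hsys.four_le hp hn)
    have hm := hsys.mem_of_mem hef
    rcases hp.eq_of_crosses hn hm.1 hm.2 hc with rfl | rfl
    · exact ⟨f, hef⟩
    · exact ⟨e, Sym2.eq_swap ▸ hef⟩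
  obtain ⟨hawB, hwO⟩ : s(a, w) ∈ B ∧ OnArc u v w := by
    rcases mem_sideB.1 haw with h1 | ⟨h1, -, h2⟩ | ⟨h1, -⟩
    · rcases Sym2.eq_iff.1 h1 with h2 | h2
      · exact absurd h2.1 hax
      · exact absurd h2.1 (hny a haO)
    · exact ⟨h1, h2⟩
    · exact absurd h1 hN1
  have hmix : ∀ c d, d ∈ V → Cyc u c v → Cyc v d u →
      ¬ ∀ e f, s(e, f) ∈ B → Crosses c d e f → s(e, f) = s(a, w) := by
    intro c d hd hc' hd' hpr
    obtain ⟨e, f, hef, he, hf, hne, hc⟩ := h.exists_of_not_needs hN2 hd hc' hd'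
    have h1 := OnArc.of_eq haO hwO (hpr e f hef hc)
    exact hne (eq_of_onArc_of_onArc hc.ne.2.2.2.2.2 h1.1 h1.2 he hf)
  obtain ⟨c, d, hcd, hc, hpr⟩ := h.system.priv a w hawB
  rcases cyc_or_cyc (a := c) h.ne with hc1 | hc1 <;>
    rcases cyc_or_cyc (a := d) h.ne with hd1 | hd1
  · have hne := hc.ne
    have h1 : IsChord ((sideV V u v y).erase a) c d := by
      refine isChord_erase hp hn (h.isChord_side hcd hc1 hd1) hne.2.1 hne.2.2.2.1 fun heq => ?_
      have h2 := hny c hc1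
      have h3 := hny d hd1
      rcases Sym2.eq_iff.1 heq with ⟨rfl, rfl⟩ | ⟨rfl, rfl⟩ <;> tauto
    obtain ⟨e, f, hef, hes, hfs, hc'⟩ := hr c d h1
    have hefB : s(e, f) ∈ B := by
      rcases mem_sideB.1 hef with h1 | ⟨h1, -⟩ | ⟨h1, -⟩
      · exact h1 ▸ h.brace
      · exact h1
      · exact absurd h1 hN1
    rcases Sym2.eq_iff.1 (hpr e f hefB hc') with h2 | h2
    · exact hes h2.1
    · exact hfs h2.2
  · rcases cyc_or_cyc (a := c) h.ne.symm with hc2 | hc2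
    · exact not_crosses_of_onArc haO hwO hc2 (Or.inr (Or.inr hd1)) hc.comm
    · exact hmix c d hcd.2.1 hc2 hd1 hpr
  · rcases cyc_or_cyc (a := d) h.ne.symm with hd2 | hd2
    · exact not_crosses_of_onArc haO hwO (Or.inr (Or.inr hc1)) hd2 hc.comm
    · exact hmix d c hcd.1 hd2 hc1 fun e f hef hce => hpr e f hef hce.swap_left
  · exact not_crosses_of_onArc haO hwO (Or.inr (Or.inr hc1)) (Or.inr (Or.inr hd1)) hc.comm

/-- If neither side of a cut needs the pair `{u, v}`, then some vertex of a side is not removable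
there although its two neighbours are not joined by a brace. -/
theorem exists_not_removable_side (h : Cut V B u v x y) (hN1 : ¬ Needs V B u v y)
    (hN2 : ¬ Needs V B v u x) {w : ℕ} (hw : w ∈ V) (huw : Cyc u w v) (hwx : w ≠ x) :
    ∃ a p n, IsNext (sideV V u v y) p a ∧ IsNext (sideV V u v y) a n ∧
      s(p, n) ∉ sideB V B u v x y ∧ ¬ Removable (sideV V u v y) (sideB V B u v x y) a := by
  have hy := h.cyc_right
  have huS : u ∈ sideV V u v y := mem_sideV.2 (Or.inr ⟨h.left_mem, onArc_left⟩)
  have hvS : v ∈ sideV V u v y := mem_sideV.2 (Or.inr ⟨h.right_mem, onArc_right⟩)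
  have hyS : y ∈ sideV V u v y := mem_sideV.2 (Or.inl rfl)
  have hwS : w ∈ sideV V u v y := mem_sideV.2 (Or.inr ⟨hw, Or.inr (Or.inr huw)⟩)
  have hxS : x ∈ sideV V u v y := mem_sideV.2 (Or.inr ⟨h.mem_x, Or.inr (Or.inr h.cyc_left)⟩)
  have hyu : IsNext (sideV V u v y) y u := by
    refine ⟨hyS, huS, hy.ne.2.1, fun c hc hcy => ?_⟩
    rcases mem_sideV.1 hc with rfl | ⟨-, hc⟩
    · exact hcy.ne.1 rfl
    · clear h; unfold OnArc Cyc at *; omega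
  have hvy : IsNext (sideV V u v y) v y := by
    refine ⟨hvS, hyS, hy.ne.1, fun c hc hcy => ?_⟩
    rcases mem_sideV.1 hc with rfl | ⟨-, hc⟩
    · exact hcy.ne.2.1 rfl
    · clear h; unfold OnArc Cyc at *; omega
  have hnot : ∀ n, n ≠ x → n ≠ y → s(y, n) ∉ sideB V B u v x y := by
    intro n hnx hny hmem
    rcases mem_sideB.1 hmem with h1 | ⟨-, h1, -⟩ | ⟨h1, -⟩
    · rcases Sym2.eq_iff.1 h1 with h2 | h2
      · exact hny h2.2
      · exact hnx h2.2
    · exact not_cyc_of_onArc h1 hy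
    · exact hN1 h1
  obtain ⟨n, hn⟩ := exists_isNext huS hvS h.ne
  by_cases hnx : n = x
  · subst hnx
    obtain ⟨p, hp⟩ := exists_isNext_left hvS huS h.ne.symm
    have hpx : p ≠ n := by
      rintro rfl
      have h1 := hn.2.2.2 w hwS
      have h2 := hp.2.2.2 w hwS
      have h3 := h.cyc_left
      clear h
      unfold Cyc at *; omega
    have hpy : p ≠ y := by
      rintro rfl
      have h2 := hp.2.2.2 w hwS
      clear h
      unfold Cyc at *; omega
    refine ⟨v, p, y, hp, hvy, ?_, h.not_removable_side hN1 hN2 (Or.inr rfl) hp hvy (Or.inr rfl)⟩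
    rw [Sym2.eq_swap]
    exact hnot p hpx hpy
  · have hny : n ≠ y := by
      rintro rfl
      have h2 := hn.2.2.2 w hwS
      clear h
      unfold Cyc at *; omega
    exact ⟨u, y, n, hyu, hn, hnot n hnx hny,
      h.not_removable_side hN1 hN2 (Or.inl rfl) hyu hn (Or.inl rfl)⟩

open Classical in
theorem card_sideV (h : Cut V B u v x y) :
    (sideV V u v y).card + (sideV V v u x).card = V.card + 4 := by
  have h1 : y ∉ V.filter (OnArc u v) := fun hy =>
    not_cyc_of_onArc (Finset.mem_filter.1 hy).2 h.cyc_right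
  have h2 : x ∉ V.filter (OnArc v u) := fun hy =>
    not_cyc_of_onArc (Finset.mem_filter.1 hy).2 h.cyc_left
  have h3 : V.filter (OnArc u v) ∪ V.filter (OnArc v u) = V := by
    rw [← Finset.filter_or, Finset.filter_eq_self]
    intro a _
    rcases cyc_or_cyc (a := a) h.ne with h4 | h4
    · exact Or.inl h4
    · exact Or.inr (Or.inr (Or.inr h4))
  have h4 : V.filter (OnArc u v) ∩ V.filter (OnArc v u) = {u, v} := by
    ext a
    simp only [Finset.mem_inter, Finset.mem_filter, Finset.mem_insert, Finset.mem_singleton]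
    constructor
    · rintro ⟨⟨-, h5⟩, -, h6⟩
      have := not_cyc_of_onArc h6
      unfold OnArc at h5
      tauto
    · rintro (rfl | rfl)
      · exact ⟨⟨h.left_mem, onArc_left⟩, h.left_mem, onArc_right⟩
      · exact ⟨⟨h.right_mem, onArc_right⟩, h.right_mem, onArc_left⟩
  have h5 := Finset.card_union_add_card_inter (V.filter (OnArc u v)) (V.filter (OnArc v u))
  rw [h3, h4, Finset.card_pair h.ne] at h5
  unfold sideV
  rw [Finset.card_insert_of_notMem h1, Finset.card_insert_of_notMem h2]
  omega

theorem card_innerB (h : Cut V B u v x y) :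
    (innerB B u v).card + (innerB B v u).card + 1 = B.card + (if s(u, v) ∈ B then 1 else 0) := by
  have h3 : innerB B u v ∪ innerB B v u = B.erase s(x, y) := by
    ext e
    induction e with | _ a b
    rw [Finset.mem_union, mem_innerB, mem_innerB, Finset.mem_erase]
    constructor
    · rintro (⟨h1, h2, h3⟩ | ⟨h1, h2, h3⟩)
      · exact ⟨fun h4 => not_crosses_of_onArc h2 h3 onArc_right onArc_left
          (h.crosses.congr_right h4.symm).comm, h1⟩
      · exact ⟨fun h4 => not_crosses_of_onArc onArc_left onArc_right h2 h3
          (h.crosses.congr_right h4.symm), h1⟩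
    · rintro ⟨h1, h2⟩
      rcases h.onArc_or_onArc h2 h1 with h3 | h3
      · exact Or.inl ⟨h2, h3⟩
      · exact Or.inr ⟨h2, h3⟩
  have h4 : innerB B u v ∩ innerB B v u = if s(u, v) ∈ B then {s(u, v)} else ∅ := by
    ext e
    induction e with | _ a b
    rw [Finset.mem_inter, mem_innerB, mem_innerB]
    constructor
    · rintro ⟨⟨h1, h2, h3⟩, -, h5, h6⟩
      have h7 := eq_of_onArc_of_onArc (h.system.isChord a b h1).ne h2 h3 h5 h6
      rw [← h7, if_pos h1]
      exact Finset.mem_singleton_self _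
    · split_ifs with huv
      · intro h1
        rw [Finset.mem_singleton] at h1
        have h2 := OnArc.of_eq (u := u) (v := v) onArc_left onArc_right h1
        have h3 := OnArc.of_eq (u := v) (v := u) onArc_right onArc_left h1
        exact ⟨⟨h1 ▸ huv, h2⟩, h1 ▸ huv, h3⟩
      · simp
  have h5 := Finset.card_union_add_card_inter (innerB B u v) (innerB B v u)
  rw [h3, h4, Finset.card_erase_of_mem h.brace] at h5
  have h6 : 0 < B.card := Finset.card_pos.2 ⟨_, h.brace⟩
  split_ifs at h5 ⊢ <;> simp at h5 <;> omega

theorem card_sideB (h : Cut V B u v x y) (hN : Needs V B u v y → s(u, v) ∈ B) :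
    (sideB V B u v x y).card = (innerB B u v).card + 1 := by
  have h1 : s(x, y) ∉ innerB B u v := by
    rw [mem_innerB]
    rintro ⟨-, -, hy⟩
    exact not_cyc_of_onArc hy h.cyc_right
  unfold sideB
  split_ifs with hN'
  · rw [Finset.insert_eq_of_mem (mem_innerB.2 ⟨hN hN', onArc_left, onArc_right⟩),
      Finset.card_insert_of_notMem h1]
  · rw [Finset.card_insert_of_notMem h1]

theorem card_sideB' (h : Cut V B u v x y) (hN : Needs V B u v y) (huv : s(u, v) ∉ B) :
    (sideB V B u v x y).card = (innerB B u v).card + 2 := by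
  have h1 : s(u, v) ∉ innerB B u v := by
    rw [mem_innerB]
    exact fun h => huv h.1
  have h2 : s(x, y) ∉ insert s(u, v) (innerB B u v) := by
    rw [Finset.mem_insert, mem_innerB]
    rintro (h2 | ⟨-, -, hy⟩)
    · exact absurd rfl (h.crosses.congr_right h2).ne.2.1
    · exact not_cyc_of_onArc hy h.cyc_right
  unfold sideB
  rw [if_pos hN, Finset.card_insert_of_notMem h2, Finset.card_insert_of_notMem h1]

end Cut

/-! ### Existence of a removable vertex -/

/-- A brace system with at least `|V| - 2` braces has a vertex with two braces, by counting ends of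
braces. -/
theorem BraceSystem.exists_two_braces {V : Finset ℕ} {B : Finset (Sym2 ℕ)} (h : BraceSystem V B)
    (hV : 5 ≤ V.card) (hB : V.card ≤ B.card + 2) :
    ∃ x y y', s(x, y) ∈ B ∧ s(x, y') ∈ B ∧ y ≠ y' := by
  classical
  by_contra hcon
  push Not at hcon
  have h1 := Finset.sum_card_bipartiteAbove_eq_sum_card_bipartiteBelow (s := B) (t := V)
    fun e a => a ∈ e
  have h2 : B.card * 2 ≤ ∑ e ∈ B, (Finset.bipartiteAbove (fun e a => a ∈ e) V e).card := by
    rw [← smul_eq_mul]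
    refine Finset.card_nsmul_le_sum _ _ _ fun e he => ?_
    induction e with | _ a b
    have hc := h.isChord a b he
    rw [← Finset.card_pair hc.ne]
    refine Finset.card_le_card fun c hc' => ?_
    simp only [Finset.mem_insert, Finset.mem_singleton] at hc'
    rw [Finset.mem_bipartiteAbove]
    rcases hc' with rfl | rfl
    · exact ⟨hc.1, Sym2.mem_mk_left _ _⟩
    · exact ⟨hc.2.1, Sym2.mem_mk_right _ _⟩
  have h3 : ∑ a ∈ V, (Finset.bipartiteBelow (fun e a => a ∈ e) B a).card ≤ V.card * 1 := by
    rw [← smul_eq_mul]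
    refine Finset.sum_le_card_nsmul _ _ _ fun a _ => Finset.card_le_one.2 fun e he f hf => ?_
    rw [Finset.mem_bipartiteBelow] at he hf
    obtain ⟨b, rfl⟩ := Sym2.mem_iff_exists.1 he.2
    obtain ⟨c, rfl⟩ := Sym2.mem_iff_exists.1 hf.2
    rw [hcon a b c he.1 hf.1]
  omega

theorem crosses_far_of_crosses {u v s y e f : ℕ} (hs : Cyc u s v) (hy : Cyc v y u)
    (he : OnArc u v e) (hf : OnArc u v f) (hc : Crosses s v e f) : Crosses s y e f := by
  unfold Crosses OnArc Cyc at *; grind (splits := 60)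

theorem crosses_far_of_crosses' {u v s y e f : ℕ} (hs : Cyc u s v) (hy : Cyc v y u)
    (he : OnArc u v e) (hf : OnArc u v f) (hc : Crosses u s e f) : Crosses s y e f := by
  unfold Crosses OnArc Cyc at *; grind (splits := 60)

namespace Cut

variable {V : Finset ℕ} {B : Finset (Sym2 ℕ)} {u v x y : ℕ}

theorem exists_ne (h : Cut V B u v x y) {z : ℕ} (hz : s(x, z) ∈ B) (hzy : z ≠ y) :
    ∃ w ∈ V, Cyc u w v ∧ w ≠ x := by
  by_contra hcon
  push Not at hcon
  have hx := h.cyc_left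
  have hu : IsNext V u x := by
    refine ⟨h.left_mem, h.mem_x, hx.ne.1, fun c hc hcx => ?_⟩
    refine hcx.ne.2.1 (hcon c hc ?_)
    unfold Cyc at *; omega
  have hv : IsNext V x v := by
    refine ⟨h.mem_x, h.right_mem, hx.ne.2.1, fun c hc hcx => ?_⟩
    refine hcx.ne.1 (hcon c hc ?_).symm
    unfold Cyc at *; omega
  have h1 := h.unique x z hz (crosses_of_isChord hu hv (h.system.isChord x z hz))
  rcases Sym2.eq_iff.1 h1 with h2 | h2
  · exact hzy h2.2
  · exact h.crosses.ne.2.2.2.2.2 h2.1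

/-- If the end `y` is the only vertex on its side of a cut, then every brace at `y` crosses the
cut. -/
theorem eq_of_singleton (h : Cut V B u v x y) (hy : ∀ w ∈ V, Cyc v w u → w = y) {z : ℕ}
    (hz : s(y, z) ∈ B) : z = x := by
  by_contra hzx
  obtain ⟨w, hw, hw', hwy⟩ := h.symm.exists_ne hz hzx
  exact hwy (hy w hw hw')

open Classical in
/-- If the arc of a cut that contains `x` has no more vertices than for any other cut of the same
brace, then `{u, v}` is not needed on both sides, unless it is a brace. -/
theorem not_needs_of_minimal (h : Cut V B u v x y) (huv : s(u, v) ∉ B)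
    (hmin : ∀ u' v', Cut V B u' v' x y →
      (V.filter fun a => Cyc u a v).card ≤ (V.filter fun a => Cyc u' a v').card) :
    ¬ (Needs V B u v y ∧ Needs V B v u x) := by
  rintro ⟨⟨s, hs, hus, hN⟩, t, ht, hvt, hN2⟩
  have hlt : ∀ u' v', Cut V B u' v' x y → (∀ a, Cyc u' a v' → Cyc u a v) → ¬ Cyc u' s v' →
      False := by
    intro u' v' hc hsub hs'
    refine absurd (hmin u' v' hc) (not_le.2 (Finset.card_lt_card ?_))
    refine Finset.ssubset_iff_subset_ne.2 ⟨fun a ha => ?_, fun heq => hs' ?_⟩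
    · rw [Finset.mem_filter] at ha ⊢
      exact ⟨ha.1, hsub a ha.2⟩
    · have : s ∈ V.filter fun a => Cyc u a v := Finset.mem_filter.2 ⟨hs, hus⟩
      rw [← heq] at this
      exact (Finset.mem_filter.1 this).2
  have hne : ∀ e f, s(e, f) ∈ B → s(e, f) ≠ s(u, v) := fun e f hef h1 => huv (h1 ▸ hef)
  have hx := h.cyc_left
  have hy := h.cyc_right
  by_cases hsx : s = x
  · subst hsx
    obtain ⟨e, f, hef, hc⟩ := h.system.cover s t
      (isChord_of_crosses hs ht h.left_mem h.right_mem (crosses_of_cyc hus hvt).comm)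
    by_cases hne' : s(e, f) = s(s, y)
    · exact absurd rfl (hc.congr_right hne').ne.2.1
    rcases h.onArc_or_onArc hef hne' with h1 | h1
    · exact hN e f hef h1.1 h1.2 (hne e f hef) (crosses_change_far hus hvt h.cyc_right h1.1 h1.2 hc)
    · exact hN2 e f hef h1.1 h1.2 (fun h2 => hne e f hef (h2.trans Sym2.eq_swap)) hc.swap_left
  · have hcyc : Cyc s x v ∨ Cyc u x s := by
      clear h hmin hlt; unfold Cyc at *; omega
    have huniq : ∀ e f, s(e, f) ∈ B → (Crosses s v e f ∨ Crosses u s e f) →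
        s(e, f) = s(x, y) := by
      intro e f hef hc
      by_contra hne'
      rcases h.onArc_or_onArc hef hne' with h1 | h1
      · refine hN e f hef h1.1 h1.2 (hne e f hef) ?_
        rcases hc with hc | hc
        · exact crosses_far_of_crosses hus hy h1.1 h1.2 hc
        · exact crosses_far_of_crosses' hus hy h1.1 h1.2 hc
      · rcases hc with hc | hc
        · exact not_crosses_of_onArc (Or.inr (Or.inr hus)) onArc_right h1.1 h1.2 hc
        · exact not_crosses_of_onArc onArc_left (Or.inr (Or.inr hus)) h1.1 h1.2 hc
    rcases hcyc with h1 | h1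
    · refine hlt s v ⟨h.system, hs, h.right_mem, h1, ?_, h.brace,
        fun a b hab hc => huniq a b hab (Or.inl hc)⟩ (fun a ha => ?_) fun h2 => h2.ne.1 rfl
      · clear h hmin hlt; unfold Cyc at *; omega
      · clear h hmin hlt; unfold Cyc at *; omega
    · refine hlt u s ⟨h.system, h.left_mem, hs, h1, ?_, h.brace,
        fun a b hab hc => huniq a b hab (Or.inr hc)⟩ (fun a ha => ?_) fun h2 => h2.ne.2.1 rfl
      · clear h hmin hlt; unfold Cyc at *; omega
      · clear h hmin hlt; unfold Cyc at *; omega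

end Cut

/-- A brace system with at least `|V| - 2` braces has a removable vertex, provided that smaller
brace systems `(V', B')` have at most `|V'| - 2` braces and that, in the case of equality, every
vertex whose neighbours are not joined by a brace is removable. -/
theorem BraceSystem.exists_removable {V : Finset ℕ} {B : Finset (Sym2 ℕ)} (h : BraceSystem V B)
    (hV : 5 ≤ V.card) (hB : V.card ≤ B.card + 2)
    (ih₁ : ∀ V' B', V'.card < V.card → BraceSystem V' B' → B'.card + 2 ≤ V'.card)
    (ih₂ : ∀ V' B', V'.card < V.card → BraceSystem V' B' → B'.card + 2 = V'.card →
      ∀ u x v, IsNext V' u x → IsNext V' x v → s(u, v) ∉ B' → Removable V' B' x) :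
    ∃ x ∈ V, Removable V B x := by
  classical
  obtain ⟨x, y, y', hxy, hxy', hyy'⟩ := h.exists_two_braces hV hB
  have hcut : ∀ c d, IsChord V c d → Crosses c d x y →
      (∀ e f, s(e, f) ∈ B → Crosses c d e f → s(e, f) = s(x, y)) →
      Cut V B c d x y ∨ Cut V B d c x y := by
    intro c d hcd hc hp
    rcases hc with h1 | h1
    · exact Or.inl ⟨h, hcd.1, hcd.2.1, h1.1, h1.2, hxy, hp⟩
    · exact Or.inr ⟨h, hcd.2.1, hcd.1, h1.2, h1.1, hxy, fun a b hab hcr => hp a b hab hcr.swap_left⟩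
  obtain ⟨u, v, hC, hmin⟩ : ∃ u v, Cut V B u v x y ∧ ∀ u' v', Cut V B u' v' x y →
      (V.filter fun a => Cyc u a v).card ≤ (V.filter fun a => Cyc u' a v').card := by
    have hex : ∃ k u v, Cut V B u v x y ∧ (V.filter fun a => Cyc u a v).card = k := by
      obtain ⟨c, d, hcd, hc, hp⟩ := h.priv x y hxy
      rcases hcut c d hcd hc hp with h1 | h1
      · exact ⟨_, c, d, h1, rfl⟩
      · exact ⟨_, d, c, h1, rfl⟩
    obtain ⟨u, v, hC, hk⟩ := Nat.find_spec hex
    exact ⟨u, v, hC, fun u' v' h' => hk ▸ Nat.find_min' hex ⟨u', v', h', rfl⟩⟩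
  obtain ⟨w, hw, huw, hwx⟩ := hC.exists_ne hxy' hyy'.symm
  have harcs : ∀ {u v}, Cut V B u v x y → V.card =
      (V.filter fun a => Cyc u a v).card + (V.filter fun a => Cyc v a u).card + 2 := by
    intro u v hC
    have h1 : V = (V.filter fun a => Cyc u a v) ∪ (V.filter fun a => Cyc v a u) ∪ {u, v} := by
      ext a
      simp only [Finset.mem_union, Finset.mem_filter, Finset.mem_insert, Finset.mem_singleton]
      constructor
      · intro ha
        rcases cyc_or_cyc (a := a) hC.ne with h1 | h1
        · unfold OnArc at h1; tauto
        · tauto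
      · rintro ((h1 | h1) | rfl | rfl)
        · exact h1.1
        · exact h1.1
        · exact hC.left_mem
        · exact hC.right_mem
    have h2 := congrArg Finset.card h1
    rw [Finset.card_union_of_disjoint, Finset.card_union_of_disjoint, Finset.card_pair hC.ne] at h2
    · exact h2
    · refine Finset.disjoint_left.2 fun a ha hb => ?_
      exact not_cyc_of_cyc (Finset.mem_filter.1 ha).2 (Finset.mem_filter.1 hb).2
    · refine Finset.disjoint_left.2 fun a ha hb => ?_
      simp only [Finset.mem_union, Finset.mem_filter, Finset.mem_insert,
        Finset.mem_singleton] at ha hb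
      rcases ha with ha | ha <;> rcases hb with rfl | rfl
      · exact ha.2.ne.1 rfl
      · exact ha.2.ne.2.1 rfl
      · exact ha.2.ne.2.1 rfl
      · exact ha.2.ne.1 rfl
  by_cases hy : ∀ t ∈ V, Cyc v t u → t = y
  · -- every private chord of `{x, y}` separates `y` from all other vertices
    refine ⟨y, hC.mem_y, fun c d hcd => ?_⟩
    by_contra hcon
    push Not at hcon
    have hall : ∀ e f, s(e, f) ∈ B → Crosses c d e f → s(e, f) = s(x, y) := by
      intro e f hef hc
      by_cases hey : e = y
      · subst hey
        rw [hC.eq_of_singleton hy hef, Sym2.eq_swap]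
      · have hfy : f = y := by
          by_contra hfy
          exact hcon e f hef hey hfy hc
        subst hfy
        rw [Sym2.eq_swap] at hef
        rw [hC.eq_of_singleton hy hef]
    have hcd' := hcd.mono (Finset.erase_subset y V)
    obtain ⟨e, f, hef, hc⟩ := h.cover c d hcd'
    have h1 : ∀ c d, Cut V B c d x y → ¬ IsChord (V.erase y) c d := by
      intro c d hC' hcd
      obtain ⟨t, ht, ht'⟩ := hcd.2.2.2
      rw [Finset.mem_erase] at ht
      have h2 : (V.filter fun a => Cyc v a u).card ≤ 1 := Finset.card_le_one.2 fun a ha b hb => by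
        rw [Finset.mem_filter] at ha hb
        rw [hy a ha.1 ha.2, hy b hb.1 hb.2]
      have h3 : 1 < (V.filter fun a => Cyc d a c).card := Finset.one_lt_card.2
        ⟨t, Finset.mem_filter.2 ⟨ht.2, ht'⟩, y, Finset.mem_filter.2 ⟨hC'.mem_y, hC'.cyc_right⟩,
          ht.1⟩
      have h4 := hmin c d hC'
      have h5 := harcs hC
      have h6 := harcs hC'
      omega
    rcases hcut c d hcd' (hc.congr_right (hall e f hef hc)) hall with h2 | h2
    · exact h1 c d h2 hcd
    · exact h1 d c h2 hcd.symm
  push Not at hy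
  obtain ⟨t, ht, hvt, hty⟩ := hy
  have hcards := hC.card_sideV
  have harc := harcs hC
  -- both sides of the cut have fewer vertices
  have hlt : ∀ {u v x y t}, Cut V B u v x y → t ∈ V → Cyc v t u → t ≠ y →
      (sideV V u v y).card < V.card := by
    intro u v x y t hC ht hvt hty
    refine Finset.card_lt_card (Finset.ssubset_iff_subset_ne.2 ⟨hC.sideV_subset, fun heq => ?_⟩)
    rw [← heq] at ht
    rcases mem_sideV.1 ht with h1 | h1
    · exact hty h1
    · exact not_cyc_of_onArc h1.2 hvt
  have hlt1 := hlt hC ht hvt hty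
  have hlt2 := hlt hC.symm hw huw hwx
  have hinner := hC.card_innerB
  -- a side that contains `{u, v}` and has the maximal number of braces
  have hneed : ∀ {u v x y t w}, Cut V B u v x y → t ∈ V → Cyc v t u → t ≠ y → w ∈ V → Cyc u w v →
      w ≠ x → Needs V B u v y → (s(u, v) ∈ B ∨ ¬ Needs V B v u x) →
      (sideB V B u v x y).card + 2 = (sideV V u v y).card → ∃ x ∈ V, Removable V B x := by
    intro u v x y t w hC ht hvt hty hw huw hwx hN hK hcard
    obtain ⟨s, p, n, hus, hs, hp, hn, hpn⟩ := hC.exists_notMem_side hN hcard hw huw hwx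
    exact ⟨s, hs, hC.removable_of_side hK hus hw huw hwx (ih₂ _ _ (hlt hC ht hvt hty)
      (hC.braceSystem_side fun _ => hK) hcard p s n hp hn hpn)⟩
  by_cases huv : s(u, v) ∈ B
  · have hvu : s(v, u) ∈ B := Sym2.eq_swap ▸ huv
    have hb1 := ih₁ _ _ hlt1 (hC.braceSystem_side fun _ => Or.inl huv)
    have hb2 := ih₁ _ _ hlt2 (hC.symm.braceSystem_side fun _ => Or.inl hvu)
    have hc1 := hC.card_sideB fun _ => huv
    have hc2 := hC.symm.card_sideB fun _ => hvu
    rw [if_pos huv] at hinner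
    exact hneed hC ht hvt hty hw huw hwx (hC.needs_of_mem huv) (Or.inl huv) (by omega)
  · have hvu : s(v, u) ∉ B := Sym2.eq_swap ▸ huv
    rw [if_neg huv] at hinner
    have hnb := hC.not_needs_of_minimal huv hmin
    by_cases hN1 : Needs V B u v y
    · have hN2 : ¬ Needs V B v u x := fun hN2 => hnb ⟨hN1, hN2⟩
      have hb1 := ih₁ _ _ hlt1 (hC.braceSystem_side fun _ => Or.inr hN2)
      have hb2 := ih₁ _ _ hlt2 (hC.symm.braceSystem_side fun h1 => absurd h1 hN2)
      have hc1 := hC.card_sideB' hN1 huv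
      have hc2 := hC.symm.card_sideB fun h1 => absurd h1 hN2
      exact hneed hC ht hvt hty hw huw hwx hN1 (Or.inr hN2) (by omega)
    · have hb1 := ih₁ _ _ hlt1 (hC.braceSystem_side fun h1 => absurd h1 hN1)
      have hc1 := hC.card_sideB fun h1 => absurd h1 hN1
      have hb2 := ih₁ _ _ hlt2 (hC.symm.braceSystem_side fun _ => Or.inr hN1)
      by_cases hN2 : Needs V B v u x
      · have hc2 := hC.symm.card_sideB' hN2 hvu
        exact hneed hC.symm hw huw hwx ht hvt hty hN2 (Or.inr hN1) (by omega)
      · have hc2 := hC.symm.card_sideB fun h1 => absurd h1 hN2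
        -- a side with the maximal number of braces has a vertex that `ih₂` would make removable
        exfalso
        rcases (by omega : (sideB V B u v x y).card + 2 = (sideV V u v y).card ∨
          (sideB V B v u y x).card + 2 = (sideV V v u x).card) with hcard | hcard
        · obtain ⟨a, p, n, hp, hn, hpn, hr⟩ := hC.exists_not_removable_side hN1 hN2 hw huw hwx
          exact hr (ih₂ _ _ hlt1 (hC.braceSystem_side fun h1 => absurd h1 hN1) hcard p a n hp hn
            hpn)
        · obtain ⟨a, p, n, hp, hn, hpn, hr⟩ := hC.symm.exists_not_removable_side hN2 hN1 ht hvt hty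
          exact hr (ih₂ _ _ hlt2 (hC.symm.braceSystem_side fun h1 => absurd h1 hN2) hcard p a n hp
            hn hpn)

/-! ### Stresses with weak signs on a convex polygon -/

/-- The determinant of two vectors of the plane. -/
def cr (v w : ℝ × ℝ) : ℝ := v.1 * w.2 - v.2 * w.1

/-- Twice the signed area of the triangle `a b c`. -/
def orient (a b c : ℝ × ℝ) : ℝ := cr (b - a) (c - a)

/-- The points `p a`, `a ∈ V`, are in strictly convex position, counterclockwise in the cyclic order
of `V`. -/
def IsConvex (V : Finset ℕ) (p : ℕ → ℝ × ℝ) : Prop :=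
  ∀ a ∈ V, ∀ b ∈ V, ∀ c ∈ V, Cyc a b c → 0 < orient (p a) (p b) (p c)

/-- `ω` is an equilibrium stress at the points `p a`, `a ∈ V`. -/
def IsStress (V : Finset ℕ) (p : ℕ → ℝ × ℝ) (ω : Sym2 ℕ → ℝ) : Prop :=
  ∀ i ∈ V, ∑ j ∈ V, ω s(i, j) • (p j - p i) = 0

/-- `ω` is nonnegative on the sides of the polygon `V` and nonpositive on its chords. -/
def IsWeaklySigned (V : Finset ℕ) (ω : Sym2 ℕ → ℝ) : Prop :=
  (∀ a b, IsNext V a b → 0 ≤ ω s(a, b)) ∧ ∀ a b, IsChord V a b → ω s(a, b) ≤ 0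

theorem cr_add (g v w : ℝ × ℝ) : cr g (v + w) = cr g v + cr g w := by
  simp [cr]; ring

theorem cr_smul (g v : ℝ × ℝ) (c : ℝ) : cr g (c • v) = c * cr g v := by
  simp [cr]; ring

theorem cr_zero (g : ℝ × ℝ) : cr g 0 = 0 := by simp [cr]

theorem cr_sum {ι : Type*} (g : ℝ × ℝ) (s : Finset ι) (f : ι → ℝ × ℝ) :
    cr g (∑ i ∈ s, f i) = ∑ i ∈ s, cr g (f i) := by
  classical
  induction s using Finset.induction_on with
  | empty => simp [cr_zero]
  | insert a s ha ih => rw [Finset.sum_insert ha, Finset.sum_insert ha, cr_add, ih]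

theorem orient_rotate (a b c : ℝ × ℝ) : orient a b c = orient b c a := by
  simp [orient, cr]; ring

theorem orient_swap (a b c : ℝ × ℝ) : orient a b c = - orient a c b := by
  simp [orient, cr]; ring

theorem IsStress.sum_cr {V : Finset ℕ} {p : ℕ → ℝ × ℝ} {ω : Sym2 ℕ → ℝ} (h : IsStress V p ω)
    {i : ℕ} (hi : i ∈ V) (g : ℝ × ℝ) : ∑ j ∈ V, ω s(i, j) * cr g (p j - p i) = 0 := by
  have h1 := congrArg (cr g) (h i hi)
  rw [cr_sum, cr_zero] at h1
  simpa only [cr_smul] using h1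

/-- A property that is passed on to the successor holds everywhere once it holds somewhere. -/
theorem forall_of_isNext {V : Finset ℕ} {P : ℕ → Prop} (hP : ∀ a b, IsNext V a b → P a → P b)
    {a : ℕ} (ha : a ∈ V) (hPa : P a) : ∀ b ∈ V, P b := by
  obtain ⟨r, hr⟩ := exists_rank V a ha
  have key : ∀ n, ∀ b ∈ V, r b = n → P b := by
    intro n
    induction n using Nat.strong_induction_on with
    | _ n ih =>
      intro b hb hbn
      by_cases hba : b = a
      · exact hba ▸ hPa
      obtain ⟨c, hc⟩ := exists_isNext_left hb ha hba
      refine hP c b hc ?_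
      by_cases hca : c = a
      · exact hca ▸ hPa
      · refine ih (r c) ?_ c hc.1 rfl
        rw [← hbn, hr c hc.1 b hb hca hba]
        have h1 := hc.2.2.2 a ha
        have h2 := hc.2.2.1
        clear hc ih hP hr
        unfold Cyc at *; omega
  exact fun b hb => key _ b hb rfl

/-- If a weakly signed stress vanishes on the side that enters the vertex `i`, then it vanishes on
all edges at `i`. -/
theorem eq_zero_of_side {V : Finset ℕ} {p : ℕ → ℝ × ℝ} {ω : Sym2 ℕ → ℝ} (hV : 3 ≤ V.card)
    (hp : IsConvex V p) (hω : IsStress V p ω) (hs : IsWeaklySigned V ω) {h i : ℕ}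
    (hi : IsNext V h i) (h0 : ω s(h, i) = 0) : ∀ j ∈ V, j ≠ i → ω s(i, j) = 0 := by
  obtain ⟨k, hk⟩ := exists_isNext hi.2.1 hi.1 hi.2.2.1.symm
  obtain ⟨w, hw, hw'⟩ : ∃ w ∈ V, w ∉ ({h, i} : Finset ℕ) :=
    Finset.exists_mem_notMem_of_card_lt_card (lt_of_le_of_lt Finset.card_le_two hV)
  simp only [Finset.mem_insert, Finset.mem_singleton, not_or] at hw'
  have hik := hi.cyc hk hw hw'.2 hw'.1
  have hpos : ∀ j ∈ V, j ≠ i → j ≠ k → 0 < cr (p k - p i) (p j - p i) := by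
    intro j hj hji hjk
    refine hp i hi.2.1 k hk.2.1 j hj ?_
    have h1 := hk.2.2.2 j hj
    have h2 := hk.2.2.1
    clear hi hk hik
    unfold Cyc at *; omega
  have hterm : ∀ j ∈ V, ω s(i, j) * cr (p k - p i) (p j - p i) ≤ 0 := by
    intro j hj
    by_cases hji : j = i
    · subst hji; simp [cr]
    by_cases hjk : j = k
    · subst hjk; simp [cr]; ring_nf; exact le_refl _
    by_cases hjh : j = h
    · subst hjh; rw [Sym2.eq_swap, h0, zero_mul]
    · have hch : IsChord V i j := by
        rcases isNext_or_isNext_or_isChord hi.2.1 hj (Ne.symm hji) with h1 | h1 | h1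
        · exact absurd (h1.unique hk) hjk
        · exact absurd (h1.unique_left hi) hjh
        · exact h1
      exact mul_nonpos_of_nonpos_of_nonneg (hs.2 i j hch) (hpos j hj hji hjk).le
  have hall := (Finset.sum_eq_zero_iff_of_nonpos hterm).1 (hω.sum_cr hi.2.1 (p k - p i))
  have hne : ∀ j ∈ V, j ≠ i → j ≠ k → ω s(i, j) = 0 := by
    intro j hj hji hjk
    rcases mul_eq_zero.1 (hall j hj) with h1 | h1
    · exact h1
    · exact absurd h1 (hpos j hj hji hjk).ne'
  intro j hj hji
  by_cases hjk : j = k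
  · subst hjk
    have h1 := hω i hi.2.1
    rw [Finset.sum_eq_single j] at h1
    · rcases smul_eq_zero.1 h1 with h2 | h2
      · exact h2
      · have h3 := hpos h hi.1 hi.2.2.1 hik.ne.2.2
        rw [h2] at h3
        simp [cr] at h3
    · intro b hb hbj
      by_cases hbi : b = i
      · subst hbi; simp
      · rw [hne b hb hbi hbj, zero_smul]
    · exact fun h => absurd hk.2.1 h
  · exact hne j hj hji hjk

/-- A weakly signed nonzero stress of a strictly convex polygon is positive on all sides. -/
theorem IsWeaklySigned.side_pos {V : Finset ℕ} {p : ℕ → ℝ × ℝ} {ω : Sym2 ℕ → ℝ}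
    (hs : IsWeaklySigned V ω) (hV : 3 ≤ V.card)
    (hp : IsConvex V p) (hω : IsStress V p ω) (hne : ∃ a ∈ V, ∃ b ∈ V, a ≠ b ∧ ω s(a, b) ≠ 0)
    {a b : ℕ} (hab : IsNext V a b) : 0 < ω s(a, b) := by
  refine lt_of_le_of_ne (hs.1 a b hab) fun h0 => ?_
  obtain ⟨c, hc, d, hd, hcd, hcd'⟩ := hne
  have hall := forall_of_isNext (P := fun i => ∀ j ∈ V, j ≠ i → ω s(i, j) = 0)
    (fun i k hik hi => eq_zero_of_side hV hp hω hs hik (hi k hik.2.1 hik.2.2.1.symm))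
    hab.2.1 (eq_zero_of_side hV hp hω hs hab h0.symm)
  exact hcd' (hall c hc d hd hcd.symm)

/-- Moments about `b` of the forces on a set `T` of vertices that is joined by edges only to `a` and
`b` outside `T`. -/
theorem IsStress.moment {V T : Finset ℕ} {p : ℕ → ℝ × ℝ} {ω : Sym2 ℕ → ℝ} (h : IsStress V p ω)
    {a b : ℕ} (ha : a ∈ V) (hT : T ⊆ V) (haT : a ∉ T)
    (h0 : ∀ i ∈ T, ∀ j ∈ V, j ∉ T → j ≠ a → j ≠ b → ω s(i, j) = 0) :
    cr (p b - p a) (∑ i ∈ T, ω s(a, i) • (p i - p a)) = 0 := by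
  have h1 : ∑ i ∈ T, ∑ j ∈ V, ω s(i, j) * cr (p i - p b) (p j - p b) = 0 := by
    refine Finset.sum_eq_zero fun i hi => ?_
    rw [← h.sum_cr (hT hi) (p i - p b)]
    refine Finset.sum_congr rfl fun j _ => ?_
    congr 1
    simp [cr]; ring
  have h2 : ∑ i ∈ T, ∑ j ∈ T, ω s(i, j) * cr (p i - p b) (p j - p b) = 0 := by
    have h3 : ∑ i ∈ T, ∑ j ∈ T, ω s(i, j) * cr (p i - p b) (p j - p b) =
        - ∑ i ∈ T, ∑ j ∈ T, ω s(i, j) * cr (p i - p b) (p j - p b) := by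
      conv_lhs => rw [Finset.sum_comm]
      rw [← Finset.sum_neg_distrib]
      refine Finset.sum_congr rfl fun i _ => ?_
      rw [← Finset.sum_neg_distrib]
      refine Finset.sum_congr rfl fun j _ => ?_
      rw [Sym2.eq_swap]
      simp only [cr]; ring
    linarith
  have h3 : ∑ i ∈ T, ∑ j ∈ V, ω s(i, j) * cr (p i - p b) (p j - p b) =
      ∑ i ∈ T, ∑ j ∈ T, ω s(i, j) * cr (p i - p b) (p j - p b) +
        ∑ i ∈ T, cr (p b - p a) (ω s(a, i) • (p i - p a)) := by
    rw [← Finset.sum_add_distrib]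
    refine Finset.sum_congr rfl fun i hi => ?_
    rw [← Finset.sum_sdiff hT, add_comm]
    congr 1
    rw [Finset.sum_eq_single a]
    · rw [cr_smul, Sym2.eq_swap (a := i)]
      simp only [cr, Prod.fst_sub, Prod.snd_sub]; ring
    · intro j hj hja
      rw [Finset.mem_sdiff] at hj
      by_cases hjb : j = b
      · subst hjb; simp [cr]
      · rw [h0 i hi j hj.1 hj.2 hja hjb, zero_mul]
    · exact fun h => absurd (Finset.mem_sdiff.2 ⟨ha, haT⟩) h
  rw [cr_sum]
  linarith

/-- A positive multiple of `q e` together with nonpositive multiples of vectors on one side of it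
can only add up to a negative multiple of a vector `w` on this side. The factor `σ` decides which
side. -/
theorem exists_neg_smul {S : Finset ℕ} {c : ℕ → ℝ} {q : ℕ → ℝ × ℝ} {w : ℝ × ℝ} {σ : ℝ} {e : ℕ}
    (he : e ∈ S) (hce : 0 < c e) (hc : ∀ i ∈ S, i ≠ e → c i ≤ 0 ∧ 0 < σ * cr (q e) (q i))
    (hw : 0 < σ * cr (q e) w) (hcr : cr w (∑ i ∈ S, c i • q i) = 0) :
    ∃ k : ℝ, k < 0 ∧ ∑ i ∈ S, c i • q i = k • w := by
  set F := ∑ i ∈ S, c i • q i with hF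
  have hw0 : w ≠ 0 := by rintro rfl; simp [cr] at hw
  obtain ⟨k, hk⟩ : ∃ k : ℝ, F = k • w := by
    have hn : w.1 * w.1 + w.2 * w.2 ≠ 0 := by
      intro h0
      refine hw0 (Prod.ext ?_ ?_)
      · simp only [Prod.fst_zero]; nlinarith
      · simp only [Prod.snd_zero]; nlinarith
    refine ⟨(w.1 * F.1 + w.2 * F.2) / (w.1 * w.1 + w.2 * w.2), ?_⟩
    unfold cr at hcr
    refine Prod.ext ?_ ?_
    · simp only [Prod.smul_fst, smul_eq_mul]
      rw [div_mul_eq_mul_div, eq_div_iff hn]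
      linear_combination (- w.2) * hcr
    · simp only [Prod.smul_snd, smul_eq_mul]
      rw [div_mul_eq_mul_div, eq_div_iff hn]
      linear_combination w.1 * hcr
  refine ⟨k, ?_, hk⟩
  by_contra hk0
  push Not at hk0
  have h1 : σ * cr (q e) F = ∑ i ∈ S, c i * (σ * cr (q e) (q i)) := by
    rw [hF, cr_sum, Finset.mul_sum]
    refine Finset.sum_congr rfl fun i _ => ?_
    rw [cr_smul]; ring
  have hterm : ∀ i ∈ S, c i * (σ * cr (q e) (q i)) ≤ 0 := by
    intro i hi
    by_cases hie : i = e
    · subst hie; simp only [cr]; ring_nf; exact le_refl _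
    · exact mul_nonpos_of_nonpos_of_nonneg (hc i hi hie).1 (hc i hi hie).2.le
  have h2 : 0 ≤ σ * cr (q e) F := by
    rw [hk, cr_smul]
    have := mul_nonneg hk0 hw.le
    linarith
  have h3 : ∑ i ∈ S, c i * (σ * cr (q e) (q i)) = 0 :=
    le_antisymm (Finset.sum_nonpos hterm) (h1 ▸ h2)
  have h4 := (Finset.sum_eq_zero_iff_of_nonpos hterm).1 h3
  have h5 : F = c e • q e := by
    rw [hF]
    refine Finset.sum_eq_single_of_mem e he fun i hi hie => ?_
    rcases mul_eq_zero.1 (h4 i hi) with h6 | h6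
    · rw [h6, zero_smul]
    · exact absurd h6 (hc i hi hie).2.ne'
  have h6 : c e * cr w (q e) = 0 := by rw [← cr_smul, ← h5, hcr]
  have h7 : cr w (q e) = - cr (q e) w := by simp only [cr]; ring
  rcases mul_eq_zero.1 h6 with h8 | h8
  · exact hce.ne' h8
  · rw [h7, neg_eq_zero] at h8
    rw [h8, mul_zero] at hw
    exact lt_irrefl _ hw

/-- Every chord `{a, b}` of a strictly convex polygon is crossed by the support of each nonzero
weakly signed stress. Otherwise each of the two sides of the chord acts on `a` with a force that
pulls `a` away from `b`, and `ω` on `{a, b}`, being nonpositive, cannot balance them. -/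
theorem IsWeaklySigned.exists_crosses {V : Finset ℕ} {p : ℕ → ℝ × ℝ} {ω : Sym2 ℕ → ℝ}
    (hs : IsWeaklySigned V ω) (hV : 3 ≤ V.card) (hp : IsConvex V p) (hω : IsStress V p ω)
    (hne : ∃ a ∈ V, ∃ b ∈ V, a ≠ b ∧ ω s(a, b) ≠ 0) {a b : ℕ} (hab : IsChord V a b) :
    ∃ c ∈ V, ∃ d ∈ V, Crosses a b c d ∧ ω s(c, d) ≠ 0 := by
  classical
  by_contra hcon
  push Not at hcon
  obtain ⟨k, hk⟩ := exists_isNext hab.1 hab.2.1 hab.ne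
  obtain ⟨h, hh⟩ := exists_isNext_left hab.1 hab.2.1 hab.ne
  set S := V.filter fun c => Cyc a c b with hS
  set T := V.filter fun c => Cyc b c a with hT
  have hkb : k ≠ b := by rintro rfl; exact hk.not_isChord hab
  have hhb : h ≠ b := by rintro rfl; exact hh.not_isChord hab.symm
  have hkS : k ∈ S := by
    refine Finset.mem_filter.2 ⟨hk.2.1, ?_⟩
    have h1 := hk.2.2.2 b hab.2.1
    have h2 := hk.2.2.1
    have h3 := hab.ne
    clear hk hh hab
    unfold Cyc at *; omega
  have hhT : h ∈ T := by
    refine Finset.mem_filter.2 ⟨hh.1, ?_⟩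
    have h1 := hh.2.2.2 b hab.2.1
    have h2 := hh.2.2.1
    have h3 := hab.ne
    clear hk hh hab
    unfold Cyc at *; omega
  have hcover : ∀ c ∈ V, c ≠ a → c ≠ b → c ∈ S ∨ c ∈ T := by
    intro c hc hca hcb
    rcases cyc_total hca.symm hcb hab.ne with h1 | h1
    · exact Or.inl (Finset.mem_filter.2 ⟨hc, h1⟩)
    · exact Or.inr (Finset.mem_filter.2 ⟨hc, h1⟩)
  have haS : a ∉ S := fun h => (Finset.mem_filter.1 h).2.ne.1 rfl
  have hbS : b ∉ S := fun h => (Finset.mem_filter.1 h).2.ne.2.1 rfl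
  have haT : a ∉ T := fun h => (Finset.mem_filter.1 h).2.ne.2.1 rfl
  have hbT : b ∉ T := fun h => (Finset.mem_filter.1 h).2.ne.1 rfl
  have hdis : Disjoint S T := Finset.disjoint_left.2 fun c h1 h2 =>
    not_cyc_of_cyc (Finset.mem_filter.1 h1).2 (Finset.mem_filter.1 h2).2
  have hmS := hω.moment (b := b) hab.1 (Finset.filter_subset _ V) haS fun i hi j hj hjS hja hjb =>
    hcon i (Finset.mem_filter.1 hi).1 j hj (crosses_of_cyc (Finset.mem_filter.1 hi).2
      (Finset.mem_filter.1 ((hcover j hj hja hjb).resolve_left hjS)).2)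
  have hmT := hω.moment (b := b) hab.1 (Finset.filter_subset _ V) haT fun i hi j hj hjT hja hjb =>
    hcon i (Finset.mem_filter.1 hi).1 j hj (Crosses.swap_left (crosses_of_cyc
      (Finset.mem_filter.1 hi).2
      (Finset.mem_filter.1 ((hcover j hj hja hjb).resolve_right hjT)).2))
  have hpos := fun {a b} (hab : IsNext V a b) => hs.side_pos hV hp hω hne hab
  obtain ⟨m, hm, hmF⟩ := exists_neg_smul (S := S) (c := fun i => ω s(a, i))
    (q := fun i => p i - p a) (w := p b - p a) (σ := 1) hkS (hpos hk) (by
      intro i hi hik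
      have hi' := Finset.mem_filter.1 hi
      have h1 := hk.2.2.2 i hi'.1
      have h2 := hh.2.2.2 i hi'.1
      have h3 := Finset.mem_filter.1 hhT
      have h4 := (Finset.mem_filter.1 hkS).2
      constructor
      · refine hs.2 a i ?_
        rcases isNext_or_isNext_or_isChord hab.1 hi'.1 hi'.2.ne.1 with h5 | h5 | h5
        · exact absurd (h5.unique hk) hik
        · exact absurd (h5.unique_left hh ▸ h3.2) (not_cyc_of_cyc hi'.2)
        · exact h5
      · rw [one_mul]
        refine hp a hab.1 k hk.2.1 i hi'.1 ?_
        have h5 := hi'.2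
        clear_value S T
        clear hk hh hab hi
        unfold Cyc at *; omega) (by
      rw [one_mul]
      exact hp a hab.1 k hk.2.1 b hab.2.1 (Finset.mem_filter.1 hkS).2) hmS
  obtain ⟨n, hn, hnF⟩ := exists_neg_smul (S := T) (c := fun i => ω s(a, i))
    (q := fun i => p i - p a) (w := p b - p a) (σ := -1) hhT
    (by rw [Sym2.eq_swap]; exact hpos hh) (by
      intro i hi hih
      have hi' := Finset.mem_filter.1 hi
      have h2 := hh.2.2.2 i hi'.1
      have h3 := (Finset.mem_filter.1 hhT).2
      have h4 := (Finset.mem_filter.1 hkS).2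
      constructor
      · refine hs.2 a i ?_
        rcases isNext_or_isNext_or_isChord hab.1 hi'.1 hi'.2.ne.2.1.symm with h5 | h5 | h5
        · exact absurd hi'.2 (not_cyc_of_cyc (h5.unique hk ▸ h4))
        · exact absurd (h5.unique_left hh) hih
        · exact h5
      · have h6 : 0 < orient (p a) (p i) (p h) := by
          refine hp a hab.1 i hi'.1 h hh.1 ?_
          have h5 := hi'.2
          clear_value S T
          clear hk hh hab hi
          unfold Cyc at *; omega
        rw [orient_swap] at h6
        rw [neg_one_mul]
        exact h6) (by
      have h6 := hp a hab.1 b hab.2.1 h hh.1 (Finset.mem_filter.1 hhT).2.rotate.rotate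
      rw [orient_swap] at h6
      rw [neg_one_mul]
      exact h6) hmT
  have hVeq : V = insert a (insert b (S ∪ T)) := by
    ext c
    simp only [Finset.mem_insert, Finset.mem_union]
    constructor
    · intro hc
      by_cases hca : c = a
      · exact Or.inl hca
      by_cases hcb : c = b
      · exact Or.inr (Or.inl hcb)
      · exact Or.inr (Or.inr (hcover c hc hca hcb))
    · rintro (rfl | rfl | h1 | h1)
      · exact hab.1
      · exact hab.2.1
      · exact (Finset.mem_filter.1 h1).1
      · exact (Finset.mem_filter.1 h1).1
  have hsum := hω a hab.1
  rw [hVeq, Finset.sum_insert, Finset.sum_insert, Finset.sum_union hdis, hmF, hnF, sub_self,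
    smul_zero, zero_add, ← add_smul, ← add_smul] at hsum
  · rcases smul_eq_zero.1 hsum with h1 | h1
    · have := hs.2 a b hab
      linarith
    · have h6 := hp a hab.1 b hab.2.1 h hh.1 (Finset.mem_filter.1 hhT).2.rotate.rotate
      unfold orient at h6
      rw [h1] at h6
      simp [cr] at h6
  · rw [Finset.mem_union]; tauto
  · rw [Finset.mem_insert, Finset.mem_union]
    have := hab.ne
    tauto

/-! ### Positivity along a path of linear spaces -/

/-- Suppose that each nonzero member of the linear space `N` that has weakly the prescribed signs on
`J` has them strictly. If `N` has a member with these strict signs, then every nonzero member of `N`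
has them up to a global sign: otherwise the line through the two members would leave the open cone
of strict signs at a nonzero point of its closure. -/
theorem pos_or_neg_of_forall {ι : Type*} (N : Submodule ℝ (ι → ℝ)) (J : Finset ι) (ε : ι → ℝ)
    (hN : ∀ ω ∈ N, ω ≠ 0 → (∀ j ∈ J, 0 ≤ ε j * ω j) → ∀ j ∈ J, 0 < ε j * ω j)
    {ω σ : ι → ℝ} (hω : ω ∈ N) (hpos : ∀ j ∈ J, 0 < ε j * ω j) (hσ : σ ∈ N) (hσ0 : σ ≠ 0) :
    (∀ j ∈ J, 0 < ε j * σ j) ∨ ∀ j ∈ J, 0 < ε j * (-σ) j := by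
  classical
  by_cases hall : ∀ j ∈ J, 0 ≤ ε j * σ j
  · exact Or.inl (hN σ hσ hσ0 hall)
  push Not at hall
  obtain ⟨i, hi, hiσ⟩ := hall
  obtain ⟨k, hk, hmin⟩ := Finset.exists_min_image (J.filter fun j => ε j * σ j < 0)
    (fun j => ε j * ω j / -(ε j * σ j)) ⟨i, Finset.mem_filter.2 ⟨hi, hiσ⟩⟩
  rw [Finset.mem_filter] at hk
  set t := ε k * ω k / -(ε k * σ k) with ht
  have htpos : 0 < t := div_pos (hpos k hk.1) (by linarith [hk.2])
  have hτN : ω + t • σ ∈ N := N.add_mem hω (N.smul_mem t hσ)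
  have hweak : ∀ j ∈ J, 0 ≤ ε j * (ω + t • σ) j := by
    intro j hj
    have h1 : ε j * (ω + t • σ) j = ε j * ω j + t * (ε j * σ j) := by
      simp only [Pi.add_apply, Pi.smul_apply, smul_eq_mul]; ring
    rw [h1]
    by_cases hjσ : ε j * σ j < 0
    · have h2 := hmin j (Finset.mem_filter.2 ⟨hj, hjσ⟩)
      rw [le_div_iff₀ (by linarith)] at h2
      linarith
    · have := mul_nonneg htpos.le (not_lt.1 hjσ)
      have := hpos j hj
      linarith
  have hk0 : ε k * (ω + t • σ) k = 0 := by
    have h1 : ε k * (ω + t • σ) k = ε k * ω k + t * (ε k * σ k) := by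
      simp only [Pi.add_apply, Pi.smul_apply, smul_eq_mul]; ring
    have h2 : t * -(ε k * σ k) = ε k * ω k := div_mul_cancel₀ _ (by linarith [hk.2])
    rw [h1]; linarith
  have hτ0 : ω + t • σ = 0 := by
    by_contra hne
    exact (hN _ hτN hne hweak k hk.1).ne' hk0
  refine Or.inr fun j hj => ?_
  have h1 := congrFun hτ0 j
  simp only [Pi.add_apply, Pi.smul_apply, smul_eq_mul, Pi.zero_apply] at h1
  have h2 := hpos j hj
  have h3 : ε j * ω j = t * (ε j * (-σ) j) := by
    simp only [Pi.neg_apply]; linear_combination ε j * h1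
  rw [h3] at h2
  exact (mul_pos_iff_of_pos_left htpos).1 h2

theorem isCompact_unit_signed {ι : Type*} [Fintype ι] {N : ℝ → Submodule ℝ (ι → ℝ)}
    (hN : IsClosed {x : ℝ × (ι → ℝ) | x.2 ∈ N x.1}) {A : Set (ι → ℝ)} (hA : IsClosed A) :
    IsCompact {x : ℝ × (ι → ℝ) | (x.1 ∈ Set.Icc 0 1 ∧ ‖x.2‖ = 1) ∧ x.2 ∈ N x.1 ∧ x.2 ∈ A} := by
  have h1 : IsCompact (Set.Icc (0 : ℝ) 1 ×ˢ Metric.sphere (0 : ι → ℝ) 1) :=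
    isCompact_Icc.prod (isCompact_sphere _ _)
  refine h1.of_isClosed_subset ?_ ?_
  · refine IsClosed.inter ?_ (hN.inter (hA.preimage continuous_snd))
    exact (isClosed_Icc.preimage continuous_fst).inter
      (isClosed_singleton.preimage (continuous_norm.comp continuous_snd))
  · rintro x ⟨⟨h2, h3⟩, -⟩
    exact ⟨h2, by simpa using h3⟩

theorem exists_unit_of_ne_zero {ι : Type*} [Fintype ι] {ω : ι → ℝ} (h : ω ≠ 0) :
    ∃ c : ℝ, 0 < c ∧ ‖c • ω‖ = 1 :=
  ⟨‖ω‖⁻¹, inv_pos.2 (norm_pos_iff.2 h), by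
    rw [norm_smul, norm_inv, norm_norm, inv_mul_cancel₀ (norm_ne_zero_iff.2 h)]⟩

theorem isClosed_weakly_signed {ι : Type*} (J : Finset ι) (ε : ι → ℝ) :
    IsClosed {ω : ι → ℝ | ∀ j ∈ J, 0 ≤ ε j * ω j} := by
  simp only [Set.ofPred_forall]
  exact isClosed_iInter fun j => isClosed_iInter fun _ =>
    isClosed_le continuous_const (continuous_const.mul (continuous_apply j))

theorem isOpen_strictly_signed {ι : Type*} (J : Finset ι) (ε : ι → ℝ) :
    IsOpen {ω : ι → ℝ | ∀ j ∈ J, 0 < ε j * ω j} := by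
  simp only [Set.ofPred_forall]
  exact isOpen_biInter_finset fun j _ =>
    isOpen_lt continuous_const (continuous_const.mul (continuous_apply j))

/-- Weakly signed nonzero members of the spaces `N s`, `0 < s ≤ 1`, have a weakly signed nonzero
limit in `N 0`. -/
theorem exists_weakly_signed_limit {ι : Type*} [Fintype ι] {N : ℝ → Submodule ℝ (ι → ℝ)}
    (hN : IsClosed {x : ℝ × (ι → ℝ) | x.2 ∈ N x.1}) (J : Finset ι) (ε : ι → ℝ)
    (h : ∀ s ∈ Set.Ioc (0 : ℝ) 1, ∃ ω ∈ N s, ω ≠ 0 ∧ ∀ j ∈ J, 0 ≤ ε j * ω j) :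
    ∃ ω ∈ N 0, ω ≠ 0 ∧ ∀ j ∈ J, 0 ≤ ε j * ω j := by
  have hK := (isCompact_unit_signed hN (isClosed_weakly_signed J ε)).image continuous_fst
  have hsub : Set.Ioc (0 : ℝ) 1 ⊆ Prod.fst '' {x : ℝ × (ι → ℝ) |
      (x.1 ∈ Set.Icc 0 1 ∧ ‖x.2‖ = 1) ∧ x.2 ∈ N x.1 ∧
        x.2 ∈ {ω : ι → ℝ | ∀ j ∈ J, 0 ≤ ε j * ω j}} := by
    intro s hs
    obtain ⟨ω, hω, h0, hpos⟩ := h s hs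
    obtain ⟨c, hc, hc1⟩ := exists_unit_of_ne_zero h0
    refine ⟨(s, c • ω), ⟨⟨⟨hs.1.le, hs.2⟩, hc1⟩, (N s).smul_mem c hω, fun j hj => ?_⟩, rfl⟩
    have h1 : ε j * (c • ω) j = c * (ε j * ω j) := by
      simp only [Pi.smul_apply, smul_eq_mul]; ring
    rw [h1]
    exact mul_nonneg hc.le (hpos j hj)
  have h0 := closure_minimal hsub hK.isClosed
  rw [closure_Ioc zero_ne_one] at h0
  obtain ⟨⟨s, ω⟩, ⟨⟨-, h1⟩, h2, h3⟩, h4⟩ := h0 ⟨le_refl _, zero_le_one⟩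
  simp only at h1 h2 h4
  subst h4
  exact ⟨ω, h2, fun h => by simp [h] at h1, h3⟩

/-- Suppose that the spaces `N s`, `0 ≤ s ≤ 1`, are nonzero and depend continuously on `s`, and that
each nonzero member with weakly the prescribed signs has them strictly. If such a member exists at
`s = 0`, then one exists at `s = 1`: the parameters where one exists and those where none exists
both form closed sets. -/
theorem exists_strictly_signed_of_path {ι : Type*} [Fintype ι] {N : ℝ → Submodule ℝ (ι → ℝ)}
    (hN : IsClosed {x : ℝ × (ι → ℝ) | x.2 ∈ N x.1})
    (hne : ∀ s ∈ Set.Icc (0 : ℝ) 1, ∃ ω ∈ N s, ω ≠ 0) (J : Finset ι) (ε : ι → ℝ)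
    (hJ : ∀ s ∈ Set.Icc (0 : ℝ) 1, ∀ ω ∈ N s, ω ≠ 0 → (∀ j ∈ J, 0 ≤ ε j * ω j) →
      ∀ j ∈ J, 0 < ε j * ω j)
    (h0 : ∃ ω ∈ N 0, ω ≠ 0 ∧ ∀ j ∈ J, 0 ≤ ε j * ω j) :
    ∃ ω ∈ N 1, ω ≠ 0 ∧ ∀ j ∈ J, 0 < ε j * ω j := by
  set A := {ω : ι → ℝ | ∀ j ∈ J, 0 ≤ ε j * ω j} with hA
  set A' := {ω : ι → ℝ | ∀ j ∈ J, 0 < ε j * ω j} with hA'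
  have hopen := isOpen_strictly_signed J ε
  have hA'c : IsClosed (A'ᶜ ∩ (Neg.neg ⁻¹' A')ᶜ) :=
    hopen.isClosed_compl.inter (hopen.preimage continuous_neg).isClosed_compl
  have hC := ((isCompact_unit_signed hN (isClosed_weakly_signed J ε)).image
    continuous_fst).isClosed
  have hD := ((isCompact_unit_signed hN hA'c).image continuous_fst).isClosed
  set C := Prod.fst '' {x : ℝ × (ι → ℝ) | (x.1 ∈ Set.Icc 0 1 ∧ ‖x.2‖ = 1) ∧ x.2 ∈ N x.1 ∧
    x.2 ∈ A} with hCdef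
  set D := Prod.fst '' {x : ℝ × (ι → ℝ) | (x.1 ∈ Set.Icc 0 1 ∧ ‖x.2‖ = 1) ∧ x.2 ∈ N x.1 ∧
    x.2 ∈ A'ᶜ ∩ (Neg.neg ⁻¹' A')ᶜ} with hDdef
  have hmemC : ∀ s ∈ Set.Icc (0 : ℝ) 1, ∀ ω ∈ N s, ω ≠ 0 → ω ∈ A → s ∈ C := by
    intro s hs ω hω hω0 hωA
    obtain ⟨c, hc, hc1⟩ := exists_unit_of_ne_zero hω0
    refine ⟨(s, c • ω), ⟨⟨hs, hc1⟩, (N s).smul_mem c hω, fun j hj => ?_⟩, rfl⟩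
    have h1 : ε j * (c • ω) j = c * (ε j * ω j) := by
      simp only [Pi.smul_apply, smul_eq_mul]; ring
    rw [h1]
    exact mul_nonneg hc.le (hωA j hj)
  have hexC : ∀ s ∈ C, s ∈ Set.Icc (0 : ℝ) 1 ∧ ∃ ω ∈ N s, ω ≠ 0 ∧ ω ∈ A' := by
    rintro _ ⟨⟨s, ω⟩, ⟨⟨h1, h2⟩, h3, h4⟩, rfl⟩
    have h5 : ω ≠ 0 := by rintro rfl; simp at h2
    exact ⟨h1, ω, h3, h5, hJ s h1 ω h3 h5 h4⟩
  have hcover : Set.Icc (0 : ℝ) 1 ⊆ C ∪ D := by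
    intro s hs
    obtain ⟨ω, hω, hω0⟩ := hne s hs
    obtain ⟨c, hc, hc1⟩ := exists_unit_of_ne_zero hω0
    have hcω : c • ω ≠ 0 := smul_ne_zero hc.ne' hω0
    by_cases h1 : c • ω ∈ A'
    · exact Or.inl (hmemC s hs _ ((N s).smul_mem c hω) hcω fun j hj => (h1 j hj).le)
    by_cases h2 : -(c • ω) ∈ A'
    · exact Or.inl (hmemC s hs _ ((N s).neg_mem ((N s).smul_mem c hω)) (neg_ne_zero.2 hcω)
        fun j hj => (h2 j hj).le)
    · exact Or.inr ⟨(s, c • ω), ⟨⟨hs, hc1⟩, (N s).smul_mem c hω, h1, h2⟩, rfl⟩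
  have hdisj : ∀ s ∈ C, s ∉ D := by
    rintro s hsC ⟨⟨s', σ⟩, ⟨⟨h1, h2⟩, h3, h4, h5⟩, h6⟩
    simp only at h1 h2 h3 h4 h5 h6
    subst h6
    obtain ⟨-, ω, hω, -, hωA⟩ := hexC s' hsC
    have h6 : σ ≠ 0 := by rintro rfl; simp at h2
    rcases pos_or_neg_of_forall (N s') J ε (hJ s' h1) hω hωA h3 h6 with h7 | h7
    · exact h4 h7
    · exact h5 h7
  have h1C : (1 : ℝ) ∈ C := by
    by_contra h1C
    have h1 : (1 : ℝ) ∈ Set.Icc (0 : ℝ) 1 := ⟨zero_le_one, le_refl _⟩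
    have h0' : (0 : ℝ) ∈ Set.Icc (0 : ℝ) 1 := ⟨le_refl _, zero_le_one⟩
    obtain ⟨ω, hω, hω0, hωA⟩ := h0
    obtain ⟨s, -, hs1, hs2⟩ := isPreconnected_closed_iff.1 isPreconnected_Icc C D hC hD hcover
      ⟨0, h0', hmemC 0 h0' ω hω hω0 hωA⟩ ⟨1, h1, (hcover h1).resolve_left h1C⟩
    exact hdisj s hs1 hs2
  exact (hexC 1 h1C).2

/-! ### The stress space of a braced polygon -/

open Classical in
/-- The successor of `a` in the cyclic order of `V`, and `a` itself if there is none. -/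
noncomputable def next (V : Finset ℕ) (a : ℕ) : ℕ :=
  if h : ∃ b, IsNext V a b then h.choose else a

open Classical in
/-- The sides of the polygon with vertex set `V`. -/
noncomputable def sides (V : Finset ℕ) : Finset (Sym2 ℕ) := V.image fun a => s(a, next V a)

open Classical in
/-- The edges of the polygon `V` braced by `B`. -/
noncomputable def edges (V : Finset ℕ) (B : Finset (Sym2 ℕ)) : Finset (Sym2 ℕ) := sides V ∪ B

open Classical in
/-- Extension of a function on the edge set `E` by zero. -/
noncomputable def extend (E : Finset (Sym2 ℕ)) (ω : E → ℝ) (e : Sym2 ℕ) : ℝ :=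
  if h : e ∈ E then ω ⟨e, h⟩ else 0

/-- A stress of the polygon `V` braced by `B` that is positive on the sides and negative on the
braces. -/
structure IsProper (V : Finset ℕ) (B : Finset (Sym2 ℕ)) (p : ℕ → ℝ × ℝ) (ω : Sym2 ℕ → ℝ) :
    Prop where
  isStress : IsStress V p ω
  eq_zero : ∀ e, e ∉ edges V B → ω e = 0
  pos : ∀ e ∈ sides V, 0 < ω e
  neg : ∀ e ∈ B, ω e < 0

theorem isNext_next {V : Finset ℕ} {a b : ℕ} (ha : a ∈ V) (hb : b ∈ V) (hab : a ≠ b) :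
    IsNext V a (next V a) := by
  have h := exists_isNext ha hb hab
  unfold next
  rw [dif_pos h]
  exact h.choose_spec

theorem IsNext.eq_next {V : Finset ℕ} {a b : ℕ} (h : IsNext V a b) : b = next V a :=
  h.unique (isNext_next h.1 h.2.1 h.2.2.1)

theorem mem_sides {V : Finset ℕ} (hV : 3 ≤ V.card) {a b : ℕ} :
    s(a, b) ∈ sides V ↔ IsNext V a b ∨ IsNext V b a := by
  unfold sides
  rw [Finset.mem_image]
  constructor
  · rintro ⟨c, hc, heq⟩
    obtain ⟨d, hd, hdc⟩ := Finset.exists_mem_ne (by omega : 1 < V.card) c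
    have h1 := isNext_next hc hd hdc.symm
    rcases Sym2.eq_iff.1 heq with ⟨rfl, h2⟩ | ⟨rfl, h2⟩
    · exact Or.inl (h2 ▸ h1)
    · exact Or.inr (h2 ▸ h1)
  · rintro (h | h)
    · exact ⟨a, h.1, by rw [← h.eq_next]⟩
    · exact ⟨b, h.1, by rw [← h.eq_next, Sym2.eq_swap]⟩

theorem IsNext.not_symm {V : Finset ℕ} (hV : 3 ≤ V.card) {a b : ℕ} (h : IsNext V a b) :
    ¬ IsNext V b a := by
  intro h'
  obtain ⟨w, hw, hw'⟩ : ∃ w ∈ V, w ∉ ({a, b} : Finset ℕ) :=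
    Finset.exists_mem_notMem_of_card_lt_card (lt_of_le_of_lt Finset.card_le_two hV)
  simp only [Finset.mem_insert, Finset.mem_singleton, not_or] at hw'
  exact (h.cyc h' hw hw'.2 hw'.1).ne.2.2 rfl

theorem card_sides {V : Finset ℕ} (hV : 3 ≤ V.card) : (sides V).card = V.card := by
  refine Finset.card_image_of_injOn fun a ha b hb heq => ?_
  have key : ∀ a ∈ V, IsNext V a (next V a) := fun a ha => by
    obtain ⟨d, hd, hda⟩ := Finset.exists_mem_ne (by omega : 1 < V.card) a
    exact isNext_next ha hd hda.symm
  rcases Sym2.eq_iff.1 heq with ⟨h1, -⟩ | ⟨h1, h2⟩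
  · exact h1
  · have h3 := key b hb
    rw [← h1] at h3
    exact absurd (h2 ▸ key a ha) (h3.not_symm hV)

theorem not_isChord_of_mem_sides {V : Finset ℕ} (hV : 3 ≤ V.card) {a b : ℕ}
    (h : s(a, b) ∈ sides V) : ¬ IsChord V a b := by
  rcases (mem_sides hV).1 h with h1 | h1
  · exact h1.not_isChord
  · exact fun h2 => h1.not_isChord h2.symm

theorem BraceSystem.notMem_sides {V : Finset ℕ} {B : Finset (Sym2 ℕ)} (h : BraceSystem V B)
    {e : Sym2 ℕ} (he : e ∈ B) : e ∉ sides V := by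
  induction e with | _ a b
  have := h.four_le
  exact fun h1 => not_isChord_of_mem_sides (by omega) h1 (h.isChord a b he)

theorem mem_edges {V : Finset ℕ} {B : Finset (Sym2 ℕ)} {e : Sym2 ℕ} :
    e ∈ edges V B ↔ e ∈ sides V ∨ e ∈ B := by
  unfold edges; exact Finset.mem_union

theorem BraceSystem.card_edges {V : Finset ℕ} {B : Finset (Sym2 ℕ)} (h : BraceSystem V B) :
    (edges V B).card = V.card + B.card := by
  have h4 := h.four_le
  unfold edges
  rw [Finset.card_union_of_disjoint, card_sides (by omega)]
  exact Finset.disjoint_right.2 fun e he => h.notMem_sides he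

theorem BraceSystem.mem_of_mem_edges {V : Finset ℕ} {B : Finset (Sym2 ℕ)} (h : BraceSystem V B)
    {a b : ℕ} (hab : s(a, b) ∈ edges V B) : a ∈ V ∧ b ∈ V ∧ a ≠ b := by
  have h4 := h.four_le
  rcases mem_edges.1 hab with h1 | h1
  · rcases (mem_sides (by omega)).1 h1 with h2 | h2
    · exact ⟨h2.1, h2.2.1, h2.2.2.1⟩
    · exact ⟨h2.2.1, h2.1, h2.2.2.1.symm⟩
  · have h2 := h.isChord a b h1
    exact ⟨h2.1, h2.2.1, h2.ne⟩

/-- A weakly signed nonzero stress of a strictly convex polygon with a brace system is proper: each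
brace is the only one that can cross its private chord. -/
theorem BraceSystem.isProper {V : Finset ℕ} {B : Finset (Sym2 ℕ)} (h : BraceSystem V B)
    {p : ℕ → ℝ × ℝ} (hp : IsConvex V p) {ω : Sym2 ℕ → ℝ} (hω : IsStress V p ω)
    (h0 : ∀ e, e ∉ edges V B → ω e = 0) (hpos : ∀ e ∈ sides V, 0 ≤ ω e) (hneg : ∀ e ∈ B, ω e ≤ 0)
    (hne : ∃ e, ω e ≠ 0) : IsProper V B p ω := by
  have h4 := h.four_le
  have hV : 3 ≤ V.card := by omega
  have hs : IsWeaklySigned V ω := by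
    constructor
    · exact fun a b hab => hpos _ ((mem_sides hV).2 (Or.inl hab))
    · intro a b hab
      by_cases hB : s(a, b) ∈ B
      · exact hneg _ hB
      · refine (h0 _ fun h1 => ?_).le
        rcases mem_edges.1 h1 with h2 | h2
        · exact not_isChord_of_mem_sides hV h2 hab
        · exact hB h2
  have hne' : ∃ a ∈ V, ∃ b ∈ V, a ≠ b ∧ ω s(a, b) ≠ 0 := by
    obtain ⟨e, he⟩ := hne
    induction e with | _ a b
    have hab : s(a, b) ∈ edges V B := by
      by_contra h1
      exact he (h0 _ h1)
    obtain ⟨ha, hb, hab⟩ := h.mem_of_mem_edges hab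
    exact ⟨a, ha, b, hb, hab, he⟩
  refine ⟨hω, h0, fun e he => ?_, fun e he => lt_of_le_of_ne (hneg e he) ?_⟩
  · induction e with | _ a b
    rcases (mem_sides hV).1 he with h1 | h1
    · exact hs.side_pos hV hp hω hne' h1
    · rw [Sym2.eq_swap]
      exact hs.side_pos hV hp hω hne' h1
  · induction e with | _ a b
    obtain ⟨c, d, hcd, -, hp'⟩ := h.priv a b he
    obtain ⟨e, he', f, hf, hc, hef⟩ := hs.exists_crosses hV hp hω hne' hcd
    have hefB : s(e, f) ∈ B := by
      by_contra hB
      refine hef (h0 _ fun h1 => ?_)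
      rcases mem_edges.1 h1 with h2 | h2
      · exact not_isChord_of_mem_sides hV h2 (isChord_of_crosses he' hf hcd.1 hcd.2.1 hc.comm)
      · exact hB h2
    rwa [← hp' e f hefB hc]

theorem extend_apply {E : Finset (Sym2 ℕ)} (ω : E → ℝ) {e : Sym2 ℕ} (h : e ∈ E) :
    extend E ω e = ω ⟨e, h⟩ := dif_pos h

theorem extend_eq_zero {E : Finset (Sym2 ℕ)} (ω : E → ℝ) {e : Sym2 ℕ} (h : e ∉ E) :
    extend E ω e = 0 := dif_neg h

theorem extend_restrict {E : Finset (Sym2 ℕ)} {ω : Sym2 ℕ → ℝ} (h : ∀ e, e ∉ E → ω e = 0) :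
    extend E (fun e => ω e) = ω := by
  funext e
  by_cases he : e ∈ E
  · rw [extend_apply _ he]
  · rw [extend_eq_zero _ he, h e he]

theorem extend_add {E : Finset (Sym2 ℕ)} (ω σ : E → ℝ) (e : Sym2 ℕ) :
    extend E (ω + σ) e = extend E ω e + extend E σ e := by
  by_cases he : e ∈ E
  · simp [extend_apply _ he]
  · simp [extend_eq_zero _ he]

theorem extend_smul {E : Finset (Sym2 ℕ)} (c : ℝ) (ω : E → ℝ) (e : Sym2 ℕ) :
    extend E (c • ω) e = c * extend E ω e := by
  by_cases he : e ∈ E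
  · simp [extend_apply _ he]
  · simp [extend_eq_zero _ he]

theorem exists_extend_ne_zero {E : Finset (Sym2 ℕ)} {ω : E → ℝ} (h : ω ≠ 0) :
    ∃ e, extend E ω e ≠ 0 := by
  obtain ⟨e, he⟩ := Function.ne_iff.1 h
  exact ⟨e, by rwa [extend_apply ω e.2]⟩

/-- The linear map that sends a function on the edges `E` to the force that it exerts on the
vertex `i`. -/
noncomputable def force (V : Finset ℕ) (p : ℕ → ℝ × ℝ) (E : Finset (Sym2 ℕ)) (i : ℕ) :
    (E → ℝ) →ₗ[ℝ] ℝ × ℝ where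
  toFun ω := ∑ j ∈ V, extend E ω s(i, j) • (p j - p i)
  map_add' ω σ := by
    simp only [extend_add, add_smul, Finset.sum_add_distrib]
  map_smul' c ω := by
    simp only [extend_smul, mul_smul, Finset.smul_sum, RingHom.id_apply]

/-- The linear space of the stresses at `p` that are supported on the edges `E`. -/
noncomputable def stressSpace (V : Finset ℕ) (E : Finset (Sym2 ℕ)) (p : ℕ → ℝ × ℝ) :
    Submodule ℝ (E → ℝ) := ⨅ i ∈ V, LinearMap.ker (force V p E i)

theorem mem_stressSpace {V : Finset ℕ} {E : Finset (Sym2 ℕ)} {p : ℕ → ℝ × ℝ} {ω : E → ℝ} :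
    ω ∈ stressSpace V E p ↔ IsStress V p (extend E ω) := by
  simp [stressSpace, Submodule.mem_iInf, IsStress, force]

theorem isClosed_stressSpace (V : Finset ℕ) (E : Finset (Sym2 ℕ)) {P : ℝ → ℕ → ℝ × ℝ}
    (hP : ∀ i, Continuous fun s => P s i) :
    IsClosed {x : ℝ × (E → ℝ) | x.2 ∈ stressSpace V E (P x.1)} := by
  simp only [mem_stressSpace, IsStress, Set.ofPred_forall]
  refine isClosed_iInter fun i => isClosed_iInter fun _ => isClosed_eq ?_ continuous_const
  refine continuous_finsetSum _ fun j _ => ?_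
  have hPf : Continuous fun x : ℝ × (E → ℝ) => extend E x.2 s(i, j) := by
    by_cases he : s(i, j) ∈ E
    · simp only [extend_apply _ he]
      exact (continuous_apply _).comp continuous_snd
    · simp only [extend_eq_zero _ he]
      exact continuous_const
  exact hPf.smul (((hP j).comp continuous_fst).sub ((hP i).comp continuous_fst))

theorem sum_antisymm {V : Finset ℕ} {ω : Sym2 ℕ → ℝ} {f : ℕ → ℕ → ℝ}
    (hf : ∀ i j, f i j = - f j i) : ∑ i ∈ V, ∑ j ∈ V, ω s(i, j) * f i j = 0 := by
  have h3 : ∑ i ∈ V, ∑ j ∈ V, ω s(i, j) * f i j = - ∑ i ∈ V, ∑ j ∈ V, ω s(i, j) * f i j := by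
    conv_lhs => rw [Finset.sum_comm]
    rw [← Finset.sum_neg_distrib]
    refine Finset.sum_congr rfl fun i _ => ?_
    rw [← Finset.sum_neg_distrib]
    refine Finset.sum_congr rfl fun j _ => ?_
    rw [Sym2.eq_swap, hf j i]
    ring
  linarith

/-- On `|V|` points, not all equal, any `2 |V| - 2` edges carry a nonzero stress: the forces that
they exert have zero resultant and zero moment, so it is enough to balance all but three of their
components. -/
theorem exists_stress_ne_zero {V : Finset ℕ} {E : Finset (Sym2 ℕ)} {p : ℕ → ℝ × ℝ}
    (hcard : 2 * V.card ≤ E.card + 2) {a b : ℕ} (ha : a ∈ V) (hb : b ∈ V) (hab : p a ≠ p b) :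
    ∃ ω ∈ stressSpace V E p, ω ≠ 0 := by
  classical
  have hab' : a ≠ b := by rintro rfl; exact hab rfl
  set w := p b - p a with hw
  set W := (V.erase a).erase b with hW
  let dot : ℝ × ℝ →ₗ[ℝ] ℝ := w.1 • LinearMap.fst ℝ ℝ ℝ + w.2 • LinearMap.snd ℝ ℝ ℝ
  let L : (E → ℝ) →ₗ[ℝ] (W → ℝ × ℝ) × ℝ :=
    (LinearMap.pi fun i : W => force V p E i).prod (dot ∘ₗ force V p E b)
  have hWcard : W.card + 2 = V.card := by
    have h1 := Finset.card_erase_add_one ha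
    have h2 := Finset.card_erase_add_one (Finset.mem_erase.2 ⟨hab'.symm, hb⟩)
    rw [← hW] at h2
    omega
  have hker : LinearMap.ker L ≠ ⊥ := by
    refine LinearMap.ker_ne_bot_of_finrank_lt ?_
    rw [Module.finrank_prod, Module.finrank_pi_fintype, Module.finrank_pi]
    simp only [Module.finrank_prod, Module.finrank_self, Finset.sum_const, smul_eq_mul,
      Finset.card_univ, Fintype.card_coe]
    omega
  obtain ⟨ω, hω, hω0⟩ := Submodule.exists_mem_ne_zero_of_ne_bot hker
  refine ⟨ω, ?_, hω0⟩
  have hL : L ω = 0 := hω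
  have hLW : ∀ i ∈ W, force V p E i ω = 0 := fun i hi =>
    congrFun (congrArg Prod.fst hL) ⟨i, hi⟩
  have hLb : dot (force V p E b ω) = 0 := congrArg Prod.snd hL
  have hsum : ∀ f : ℕ → ℝ × ℝ, (∀ i ∈ W, f i = 0) → ∑ i ∈ V, f i = f a + f b := by
    intro f hf
    rw [← Finset.add_sum_erase V f ha, ← Finset.add_sum_erase (V.erase a) f
      (Finset.mem_erase.2 ⟨hab'.symm, hb⟩), Finset.sum_eq_zero hf, add_zero]
  have hsum' : ∀ f : ℕ → ℝ, (∀ i ∈ W, f i = 0) → ∑ i ∈ V, f i = f a + f b := by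
    intro f hf
    rw [← Finset.add_sum_erase V f ha, ← Finset.add_sum_erase (V.erase a) f
      (Finset.mem_erase.2 ⟨hab'.symm, hb⟩), Finset.sum_eq_zero hf, add_zero]
  -- the resultant force and the moment about `p a` vanish
  have htot : force V p E a ω + force V p E b ω = 0 := by
    rw [← hsum (fun i => force V p E i ω) hLW]
    refine Prod.ext ?_ ?_
    · rw [Prod.fst_sum]
      simp only [force, LinearMap.coe_mk, AddHom.coe_mk, Prod.fst_sum, Prod.smul_fst, smul_eq_mul,
        Prod.fst_sub]
      exact sum_antisymm (f := fun i j => (p j).1 - (p i).1) fun i j => by ring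
    · rw [Prod.snd_sum]
      simp only [force, LinearMap.coe_mk, AddHom.coe_mk, Prod.snd_sum, Prod.smul_snd, smul_eq_mul,
        Prod.snd_sub]
      exact sum_antisymm (f := fun i j => (p j).2 - (p i).2) fun i j => by ring
  have hmom : cr w (force V p E b ω) = 0 := by
    have h1 := hsum' (fun i => cr (p i - p a) (force V p E i ω)) fun i hi => by
      rw [hLW i hi, cr_zero]
    have h2 : ∑ i ∈ V, cr (p i - p a) (force V p E i ω) = 0 := by
      simp only [force, LinearMap.coe_mk, AddHom.coe_mk, cr_sum, cr_smul]
      refine sum_antisymm (f := fun i j => cr (p i - p a) (p j - p i)) fun i j => ?_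
      simp only [cr, Prod.fst_sub, Prod.snd_sub]; ring
    rw [h2, sub_self] at h1
    have h3 : cr (0 : ℝ × ℝ) (force V p E a ω) = 0 := by simp [cr]
    rw [h3, zero_add] at h1
    exact h1.symm
  have hdot : w.1 * (force V p E b ω).1 + w.2 * (force V p E b ω).2 = 0 := by
    simpa [dot] using hLb
  have hFb : force V p E b ω = 0 := by
    have hn : w.1 * w.1 + w.2 * w.2 ≠ 0 := by
      intro h0
      refine hab (sub_eq_zero.1 (?_ : w = 0)).symm
      refine Prod.ext ?_ ?_
      · simp only [Prod.fst_zero]; nlinarith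
      · simp only [Prod.snd_zero]; nlinarith
    unfold cr at hmom
    refine Prod.ext ?_ ?_
    · refine (mul_eq_zero.1 (?_ : (w.1 * w.1 + w.2 * w.2) * _ = 0)).resolve_left hn
      linear_combination w.1 * hdot - w.2 * hmom
    · refine (mul_eq_zero.1 (?_ : (w.1 * w.1 + w.2 * w.2) * _ = 0)).resolve_left hn
      linear_combination w.2 * hdot + w.1 * hmom
  have hFa : force V p E a ω = 0 := by rwa [hFb, add_zero] at htot
  rw [mem_stressSpace]
  intro i hi
  change force V p E i ω = 0
  by_cases hia : i = a
  · rw [hia, hFa]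
  by_cases hib : i = b
  · rw [hib, hFb]
  exact hLW i (Finset.mem_erase.2 ⟨hib, Finset.mem_erase.2 ⟨hia, hi⟩⟩)

/-- Subdividing the side `{u, v}` of the polygon `V \ {x}` by its midpoint `p x` turns a stress `σ`
into a stress `ω` that takes the value `2 σ` on the two halves; part of `σ` on `{u, v}` may be
kept. -/
theorem isStress_subdivide {V : Finset ℕ} {p : ℕ → ℝ × ℝ} {u x v : ℕ} (hu : u ∈ V) (hv : v ∈ V)
    (hx : x ∈ V) (hux : u ≠ x) (hvx : v ≠ x) (huv : u ≠ v)
    (hmid : p x = (1 / 2 : ℝ) • (p u + p v)) {ω σ : Sym2 ℕ → ℝ} {c : ℝ}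
    (hωu : ω s(u, x) = c) (hωv : ω s(v, x) = c)
    (hω0 : ∀ j ∈ V, j ≠ x → j ≠ u → j ≠ v → ω s(j, x) = 0)
    (hσ : ∀ i ∈ V, ∀ j ∈ V, i ≠ x → j ≠ x → s(i, j) ≠ s(u, v) → σ s(i, j) = ω s(i, j))
    (hσuv : σ s(u, v) = ω s(u, v) + c / 2) :
    IsStress V p ω ↔ IsStress (V.erase x) p σ := by
  have hend : ∀ i k, i ∈ V → k ∈ V → i ≠ x → k ≠ x → i ≠ k → s(i, k) = s(u, v) → ω s(i, x) = c →
      p x = (1 / 2 : ℝ) • (p i + p k) →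
      ∑ j ∈ V.erase x, σ s(i, j) • (p j - p i) = ∑ j ∈ V, ω s(i, j) • (p j - p i) := by
    intro i k hi hk hix hkx hik hikuv hωi hm
    rw [← Finset.add_sum_erase V _ hx, hωi, ← sub_eq_iff_eq_add, ← Finset.sum_sub_distrib,
      Finset.sum_eq_single k]
    · have h1 : σ s(i, k) = ω s(i, k) + c / 2 := by rw [hikuv, hσuv]
      rw [h1, hm, ← sub_smul, add_sub_cancel_left]
      refine Prod.ext ?_ ?_
      · simp; ring
      · simp; ring
    · intro j hj hjk
      rw [Finset.mem_erase] at hj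
      by_cases hji : j = i
      · subst hji; simp
      rw [hσ i hi j hj.2 hix hj.1, sub_self]
      rw [← hikuv]
      intro h1
      rcases Sym2.eq_iff.1 h1 with ⟨-, h2⟩ | ⟨-, h2⟩
      · exact hjk h2
      · exact hji h2
    · exact fun h => absurd (Finset.mem_erase.2 ⟨hkx, hk⟩) h
  have hsum : ∀ i ∈ V.erase x, ∑ j ∈ V.erase x, σ s(i, j) • (p j - p i) =
      ∑ j ∈ V, ω s(i, j) • (p j - p i) := by
    intro i hi
    rw [Finset.mem_erase] at hi
    by_cases hiu : i = u
    · exact hend i v hi.2 hv hi.1 hvx (hiu ▸ huv) (by rw [hiu]) (hiu ▸ hωu) (hiu ▸ hmid)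
    by_cases hiv : i = v
    · exact hend i u hi.2 hu hi.1 hux (hiv ▸ huv.symm) (by rw [hiv, Sym2.eq_swap]) (hiv ▸ hωv)
        (by rw [hiv, add_comm]; exact hmid)
    rw [← Finset.add_sum_erase V _ hx, hω0 i hi.2 hi.1 hiu hiv, zero_smul, zero_add]
    refine Finset.sum_congr rfl fun j hj => ?_
    rw [Finset.mem_erase] at hj
    rw [hσ i hi.2 j hj.2 hi.1 hj.1]
    intro h1
    rcases Sym2.eq_iff.1 h1 with ⟨h2, -⟩ | ⟨h2, -⟩
    · exact hiu h2
    · exact hiv h2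
  have hatx : ∑ j ∈ V, ω s(x, j) • (p j - p x) = 0 := by
    rw [← Finset.add_sum_erase V _ hu, ← Finset.add_sum_erase (V.erase u) _
      (Finset.mem_erase.2 ⟨huv.symm, hv⟩), Finset.sum_eq_zero, Sym2.eq_swap, hωu,
      Sym2.eq_swap (a := x), hωv, hmid]
    · refine Prod.ext ?_ ?_
      · simp; ring
      · simp; ring
    · intro j hj
      simp only [Finset.mem_erase] at hj
      by_cases hjx : j = x
      · subst hjx; simp
      · rw [Sym2.eq_swap, hω0 j hj.2.2 hjx hj.2.1 hj.1, zero_smul]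
  constructor
  · intro h i hi
    rw [hsum i hi]
    exact h i (Finset.mem_of_mem_erase hi)
  · intro h i hi
    by_cases hix : i = x
    · rw [hix, hatx]
    · rw [← hsum i (Finset.mem_erase.2 ⟨hix, hi⟩)]
      exact h i (Finset.mem_erase.2 ⟨hix, hi⟩)

/-! ### Sliding a vertex to the midpoint of its neighbours -/

/-- The configuration `p` with the vertex `x` moved to the point that divides the segment from the
midpoint of `p u` and `p v` to `p x` in the ratio `s : 1 - s`. -/
noncomputable def slide (p : ℕ → ℝ × ℝ) (u x v : ℕ) (s : ℝ) : ℕ → ℝ × ℝ :=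
  Function.update p x ((1 - s) • (1 / 2 : ℝ) • (p u + p v) + s • p x)

theorem slide_of_ne (p : ℕ → ℝ × ℝ) (u x v : ℕ) (s : ℝ) {i : ℕ} (hi : i ≠ x) :
    slide p u x v s i = p i := Function.update_of_ne hi _ _

theorem slide_self (p : ℕ → ℝ × ℝ) (u x v : ℕ) (s : ℝ) :
    slide p u x v s x = (1 - s) • (1 / 2 : ℝ) • (p u + p v) + s • p x :=
  Function.update_self _ _ _

theorem slide_one (p : ℕ → ℝ × ℝ) (u x v : ℕ) : slide p u x v 1 = p := by
  unfold slide
  rw [sub_self, zero_smul, zero_add, one_smul, Function.update_eq_self]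

theorem slide_zero_self (p : ℕ → ℝ × ℝ) {u x v : ℕ} (hu : u ≠ x) (hv : v ≠ x) :
    slide p u x v 0 x = (1 / 2 : ℝ) • (slide p u x v 0 u + slide p u x v 0 v) := by
  rw [slide_self, slide_of_ne _ _ _ _ _ hu, slide_of_ne _ _ _ _ _ hv]
  simp

theorem continuous_slide (p : ℕ → ℝ × ℝ) (u x v i : ℕ) :
    Continuous fun s => slide p u x v s i := by
  by_cases hi : i = x
  · subst hi
    simp only [slide_self]
    fun_prop
  · simp only [slide_of_ne p u x v _ hi]
    exact continuous_const

theorem IsConvex.slide_erase {V : Finset ℕ} {p : ℕ → ℝ × ℝ} (hp : IsConvex V p) (u x v : ℕ)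
    (s : ℝ) : IsConvex (V.erase x) (slide p u x v s) := by
  intro a ha b hb c hc h
  rw [Finset.mem_erase] at ha hb hc
  rw [slide_of_ne _ _ _ _ _ ha.1, slide_of_ne _ _ _ _ _ hb.1, slide_of_ne _ _ _ _ _ hc.1]
  exact hp a ha.2 b hb.2 c hc.2 h

theorem orient_slide (p : ℕ → ℝ × ℝ) (u x v : ℕ) (s : ℝ) (b c : ℝ × ℝ) :
    orient (slide p u x v s x) b c =
      (1 - s) * (1 / 2) * (orient (p u) b c + orient (p v) b c) + s * orient (p x) b c := by
  rw [slide_self]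
  simp only [orient, cr, Prod.fst_sub, Prod.snd_sub, Prod.fst_add, Prod.snd_add, Prod.smul_fst,
    Prod.smul_snd, smul_eq_mul]
  ring

theorem orient_self_left (a b : ℝ × ℝ) : orient a a b = 0 := by simp [orient, cr]

theorem orient_self_right (a b : ℝ × ℝ) : orient a b a = 0 := by simp [orient, cr]

/-- The polygon stays strictly convex until the vertex reaches the midpoint. -/
theorem IsConvex.slide_of_pos {V : Finset ℕ} {p : ℕ → ℝ × ℝ} (hp : IsConvex V p) {u x v : ℕ}
    (hu : IsNext V u x) (hv : IsNext V x v) {s : ℝ} (hs : s ∈ Set.Ioc (0 : ℝ) 1) :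
    IsConvex V (slide p u x v s) := by
  have key : ∀ b ∈ V, ∀ c ∈ V, Cyc x b c → 0 < orient (slide p u x v s x) (p b) (p c) := by
    intro b hb c hc h
    have hub : 0 ≤ orient (p u) (p b) (p c) := by
      by_cases hcu : c = u
      · rw [hcu, orient_self_right]
      · refine (hp u hu.1 b hb c hc ?_).le
        have h1 := hu.2.2.2 c hc
        have h2 := hu.2.2.1
        have h3 := hu.2.2.2 b hb
        clear hu hv
        unfold Cyc at *; omega
    have hvb : 0 ≤ orient (p v) (p b) (p c) := by
      by_cases hbv : b = v
      · rw [hbv, orient_self_left]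
      · refine (hp v hv.2.1 b hb c hc ?_).le
        have h1 := hv.2.2.2 b hb
        have h2 := hv.2.2.1
        have h3 := hv.2.2.2 c hc
        clear hu hv
        unfold Cyc at *; omega
    have hx := hp x hu.2.1 b hb c hc h
    rw [orient_slide]
    have h1 := mul_pos hs.1 hx
    have h2 : 0 ≤ (1 - s) * (1 / 2) * (orient (p u) (p b) (p c) + orient (p v) (p b) (p c)) :=
      mul_nonneg (mul_nonneg (by linarith [hs.2]) (by norm_num)) (add_nonneg hub hvb)
    linarith
  intro a ha b hb c hc h
  have hne := h.ne
  by_cases hax : a = x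
  · subst hax
    rw [slide_of_ne _ _ _ _ _ hne.1.symm, slide_of_ne _ _ _ _ _ hne.2.2.symm]
    exact key b hb c hc h
  by_cases hbx : b = x
  · subst hbx
    rw [orient_rotate, slide_of_ne _ _ _ _ _ hne.2.1.symm, slide_of_ne _ _ _ _ _ hne.1]
    exact key c hc a ha h.rotate
  by_cases hcx : c = x
  · subst hcx
    rw [← orient_rotate, slide_of_ne _ _ _ _ _ hne.2.2, slide_of_ne _ _ _ _ _ hne.2.1]
    exact key a ha b hb h.rotate.rotate
  rw [slide_of_ne _ _ _ _ _ hax, slide_of_ne _ _ _ _ _ hbx, slide_of_ne _ _ _ _ _ hcx]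
  exact hp a ha b hb c hc h

/-- The points `(i, i²)` of a parabola. -/
def parabola (i : ℕ) : ℝ × ℝ := (i, (i : ℝ) ^ 2)

theorem isConvex_parabola (V : Finset ℕ) : IsConvex V parabola := by
  intro a _ b _ c _ h
  have h1 : orient (parabola a) (parabola b) (parabola c) =
      ((b : ℝ) - a) * (c - b) * (c - a) := by
    simp [orient, cr, parabola]; ring
  rw [h1]
  have h2 : ∀ {i j : ℕ}, i < j → (0 : ℝ) < j - i := fun hij =>
    sub_pos.2 (Nat.cast_lt.2 hij)
  rcases h with ⟨h3, h4⟩ | ⟨h3, h4⟩ | ⟨h3, h4⟩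
  · exact mul_pos (mul_pos (h2 h3) (h2 h4)) (h2 (h3.trans h4))
  · have := mul_pos (mul_pos (h2 (h3.trans h4)) (h2 h3)) (h2 h4)
    linarith
  · have := mul_pos (mul_pos (h2 h4) (h2 (h3.trans h4))) (h2 h3)
    linarith

/-! ### Collapsing a straight vertex -/

/-- A stress `ω` of `V` at a configuration where `x` is the midpoint of its neighbours `u` and `v`
becomes a stress of `V \ {x}` when the halves of the side `{u, v}` are merged. -/
noncomputable def collapse (u x v : ℕ) (ω : Sym2 ℕ → ℝ) (e : Sym2 ℕ) : ℝ :=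
  open Classical in if e = s(u, v) then ω s(u, x) / 2 else if x ∈ e then 0 else ω e

theorem collapse_side (u x v : ℕ) (ω : Sym2 ℕ → ℝ) :
    collapse u x v ω s(u, v) = ω s(u, x) / 2 := if_pos rfl

theorem collapse_of_mem {u x v : ℕ} (ω : Sym2 ℕ → ℝ) {e : Sym2 ℕ} (he : e ≠ s(u, v)) (hx : x ∈ e) :
    collapse u x v ω e = 0 := by
  unfold collapse; rw [if_neg he, if_pos hx]

theorem collapse_of_notMem {u x v : ℕ} (ω : Sym2 ℕ → ℝ) {e : Sym2 ℕ} (he : e ≠ s(u, v))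
    (hx : x ∉ e) : collapse u x v ω e = ω e := by
  unfold collapse; rw [if_neg he, if_neg hx]

/-- At a configuration where `x` is the midpoint of its neighbours, a stress that is nonpositive on
the chords at `x` vanishes on them, since they all pull to the same side of the line through the
neighbours. -/
theorem IsStress.eq_zero_of_midpoint {V : Finset ℕ} (hV : 4 ≤ V.card) {p : ℕ → ℝ × ℝ} {u x v : ℕ}
    (hu : IsNext V u x) (hv : IsNext V x v) (hp : IsConvex (V.erase x) p)
    (hmid : p x = (1 / 2 : ℝ) • (p u + p v)) {ω : Sym2 ℕ → ℝ} (hω : IsStress V p ω)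
    (hsign : ∀ j, IsChord V x j → ω s(x, j) ≤ 0) :
    (∀ j ∈ V, j ≠ x → j ≠ u → j ≠ v → ω s(j, x) = 0) ∧ ω s(v, x) = ω s(u, x) := by
  have huv := (isChord_of_isNext hV hu hv).ne
  have hcr : ∀ j, cr (p v - p u) (p j - p x) = orient (p u) (p v) (p j) := by
    intro j
    rw [hmid]
    simp [orient, cr]; ring
  have hpos : ∀ j ∈ V, j ≠ x → j ≠ u → j ≠ v → 0 < orient (p u) (p v) (p j) := by
    intro j hj hjx hju hjv
    refine hp u (Finset.mem_erase.2 ⟨hu.2.2.1, hu.1⟩) v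
      (Finset.mem_erase.2 ⟨hv.2.2.1.symm, hv.2.1⟩) j (Finset.mem_erase.2 ⟨hjx, hj⟩) ?_
    exact (hu.cyc' hv hj hjx hju hjv).rotate.rotate
  have hterm : ∀ j ∈ V, ω s(x, j) * cr (p v - p u) (p j - p x) ≤ 0 := by
    intro j hj
    by_cases hjx : j = x
    · subst hjx; simp [cr]
    rw [hcr]
    by_cases hju : j = u
    · rw [hju, orient_self_right, mul_zero]
    by_cases hjv : j = v
    · rw [hjv, orient_swap, orient_rotate, orient_rotate]; simp [orient, cr]
    · refine mul_nonpos_of_nonpos_of_nonneg (hsign j ?_) (hpos j hj hjx hju hjv).le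
      rcases isNext_or_isNext_or_isChord hu.2.1 hj (Ne.symm hjx) with h1 | h1 | h1
      · exact absurd (h1.unique hv) hjv
      · exact absurd (h1.unique_left hu) hju
      · exact h1
  have hall := (Finset.sum_eq_zero_iff_of_nonpos hterm).1 (hω.sum_cr hu.2.1 (p v - p u))
  have h0 : ∀ j ∈ V, j ≠ x → j ≠ u → j ≠ v → ω s(j, x) = 0 := by
    intro j hj hjx hju hjv
    have h1 := hall j hj
    rw [hcr] at h1
    rw [Sym2.eq_swap]
    exact (mul_eq_zero.1 h1).resolve_right (hpos j hj hjx hju hjv).ne'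
  refine ⟨h0, ?_⟩
  have h1 := hω x hu.2.1
  rw [← Finset.add_sum_erase V _ hu.1, ← Finset.add_sum_erase (V.erase u) _
    (Finset.mem_erase.2 ⟨huv.symm, hv.2.1⟩), Finset.sum_eq_zero, Sym2.eq_swap,
    Sym2.eq_swap (a := x), hmid] at h1
  · have h2 : (ω s(u, x) - ω s(v, x)) • (p u - p v) = 0 := by
      rw [← smul_zero (2 : ℝ), ← h1]
      refine Prod.ext ?_ ?_
      · simp; ring
      · simp; ring
    rcases smul_eq_zero.1 h2 with h3 | h3
    · linarith
    · exfalso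
      obtain ⟨w, hw, hw'⟩ : ∃ w ∈ V, w ∉ ({x, u, v} : Finset ℕ) :=
        Finset.exists_mem_notMem_of_card_lt_card (lt_of_le_of_lt Finset.card_le_three hV)
      simp only [Finset.mem_insert, Finset.mem_singleton, not_or] at hw'
      have h4 := hpos w hw hw'.1 hw'.2.1 hw'.2.2
      rw [sub_eq_zero.1 h3, orient_self_left] at h4
      exact lt_irrefl _ h4
  · intro j hj
    simp only [Finset.mem_erase] at hj
    by_cases hjx : j = x
    · subst hjx; simp
    · rw [Sym2.eq_swap, h0 j hj.2.2 hjx hj.2.1 hj.1, zero_smul]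

theorem IsStress.collapse {V : Finset ℕ} (hV : 4 ≤ V.card) {p : ℕ → ℝ × ℝ} {u x v : ℕ}
    (hu : IsNext V u x) (hv : IsNext V x v) (hp : IsConvex (V.erase x) p)
    (hmid : p x = (1 / 2 : ℝ) • (p u + p v)) {ω : Sym2 ℕ → ℝ} (hω : IsStress V p ω)
    (hsign : ∀ j, IsChord V x j → ω s(x, j) ≤ 0) (huv : ω s(u, v) = 0) :
    IsStress (V.erase x) p (collapse u x v ω) := by
  obtain ⟨h1, h2⟩ := hω.eq_zero_of_midpoint hV hu hv hp hmid hsign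
  refine (isStress_subdivide hu.1 hv.2.1 hu.2.1 hu.2.2.1 hv.2.2.1.symm
    (isChord_of_isNext hV hu hv).ne hmid rfl h2 h1 ?_ ?_).1 hω
  · intro i _ j _ hix hjx hij
    refine collapse_of_notMem ω hij ?_
    rw [Sym2.mem_iff]
    tauto
  · rw [collapse_side, huv, zero_add]

theorem mem_sides_erase {V : Finset ℕ} (hV : 4 ≤ V.card) {u x v : ℕ} (hu : IsNext V u x)
    (hv : IsNext V x v) {e : Sym2 ℕ} :
    e ∈ sides (V.erase x) ↔ e = s(u, v) ∨ (e ∈ sides V ∧ x ∉ e) := by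
  have hcard := Finset.card_erase_of_mem hu.2.1
  have herase : ∀ a b, IsNext V a b → a ≠ x → b ≠ x → IsNext (V.erase x) a b :=
    fun a b h ha hb => ⟨Finset.mem_erase.2 ⟨ha, h.1⟩, Finset.mem_erase.2 ⟨hb, h.2.1⟩, h.2.2.1,
      fun c hc => h.2.2.2 c (Finset.mem_of_mem_erase hc)⟩
  have huv : IsNext (V.erase x) u v := by
    refine ⟨Finset.mem_erase.2 ⟨hu.2.2.1, hu.1⟩, Finset.mem_erase.2 ⟨hv.2.2.1.symm, hv.2.1⟩,
      (isChord_of_isNext hV hu hv).ne, fun c hc h => ?_⟩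
    rw [Finset.mem_erase] at hc
    exact not_cyc_of_cyc h (hu.cyc' hv hc.2 hc.1 h.ne.1.symm h.ne.2.1)
  have hback : ∀ a b, IsNext (V.erase x) a b → s(a, b) = s(u, v) ∨
      (IsNext V a b ∧ a ≠ x ∧ b ≠ x) := by
    intro a b h
    have ha := Finset.mem_erase.1 h.1
    have hb := Finset.mem_erase.1 h.2.1
    by_cases hau : a = u
    · subst hau
      rw [h.unique huv]
      exact Or.inl rfl
    obtain ⟨c, hc⟩ := exists_isNext ha.2 hb.2 h.2.2.1
    have hcx : c ≠ x := by
      rintro rfl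
      exact hau (hc.unique_left hu)
    rw [h.unique (herase a c hc ha.1 hcx)]
    exact Or.inr ⟨hc, ha.1, hcx⟩
  induction e with | _ a b
  rw [mem_sides (by omega), mem_sides (by omega), Sym2.mem_iff]
  constructor
  · rintro (h | h)
    · rcases hback a b h with h1 | h1
      · exact Or.inl h1
      · exact Or.inr ⟨Or.inl h1.1, by tauto⟩
    · rcases hback b a h with h1 | h1
      · rw [Sym2.eq_swap]; exact Or.inl h1
      · exact Or.inr ⟨Or.inr h1.1, by tauto⟩
  · rintro (h | ⟨h | h, h1⟩)
    · rcases Sym2.eq_iff.1 h with ⟨rfl, rfl⟩ | ⟨rfl, rfl⟩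
      · exact Or.inl huv
      · exact Or.inr huv
    · exact Or.inl (herase a b h (by tauto) (by tauto))
    · exact Or.inr (herase b a h (by tauto) (by tauto))

open Classical in
/-- The sign that a proper stress has on `e`. -/
noncomputable def sgn (V : Finset ℕ) (e : Sym2 ℕ) : ℝ := if e ∈ sides V then 1 else -1

theorem sgn_mul_of_mem {V : Finset ℕ} {e : Sym2 ℕ} (he : e ∈ sides V) (t : ℝ) :
    sgn V e * t = t := by
  unfold sgn; rw [if_pos he, one_mul]

theorem sgn_mul_of_notMem {V : Finset ℕ} {e : Sym2 ℕ} (he : e ∉ sides V) (t : ℝ) :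
    sgn V e * t = -t := by
  unfold sgn; rw [if_neg he, neg_one_mul]

theorem IsProper.sgn_mul_pos {V : Finset ℕ} {B : Finset (Sym2 ℕ)} {p : ℕ → ℝ × ℝ}
    {ω : Sym2 ℕ → ℝ} (h : IsProper V B p ω) {e : Sym2 ℕ} (he : e ∈ edges V B) :
    0 < sgn V e * ω e := by
  by_cases h1 : e ∈ sides V
  · rw [sgn_mul_of_mem h1]; exact h.pos e h1
  · rw [sgn_mul_of_notMem h1]
    have := h.neg e ((mem_edges.1 he).resolve_left h1)
    linarith

theorem sgn_mul_nonneg {V : Finset ℕ} {B : Finset (Sym2 ℕ)} (h : BraceSystem V B)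
    {ω : Sym2 ℕ → ℝ} (hω : ∀ e ∈ edges V B, 0 ≤ sgn V e * ω e) :
    (∀ e ∈ sides V, 0 ≤ ω e) ∧ ∀ e ∈ B, ω e ≤ 0 := by
  constructor
  · intro e he
    have := hω e (mem_edges.2 (Or.inl he))
    rwa [sgn_mul_of_mem he] at this
  · intro e he
    have := hω e (mem_edges.2 (Or.inr he))
    rw [sgn_mul_of_notMem (h.notMem_sides he)] at this
    linarith

theorem BraceSystem.exists_side {V : Finset ℕ} {B : Finset (Sym2 ℕ)} (h : BraceSystem V B) :
    ∃ e, e ∈ sides V := by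
  have h4 := h.four_le
  have : 0 < (sides V).card := by rw [card_sides (by omega)]; omega
  exact Finset.card_pos.1 this

/-- If `x` is the midpoint of its neighbours `u` and `v` and `{u, v}` is no brace, then collapsing
`x` turns a nonzero weakly signed stress of `V` into a nonzero weakly signed stress of `V \ {x}`. -/
theorem BraceSystem.collapse_signs {V : Finset ℕ} {B : Finset (Sym2 ℕ)} (h : BraceSystem V B)
    {p : ℕ → ℝ × ℝ} {u x v : ℕ} (hu : IsNext V u x) (hv : IsNext V x v)
    (hp : IsConvex (V.erase x) p) (hmid : p x = (1 / 2 : ℝ) • (p u + p v)) (huv : s(u, v) ∉ B)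
    {ω : Sym2 ℕ → ℝ} (hω : IsStress V p ω) (h0 : ∀ e, e ∉ edges V B → ω e = 0)
    (hpos : ∀ e ∈ sides V, 0 ≤ ω e) (hneg : ∀ e ∈ B, ω e ≤ 0) (hne : ∃ e, ω e ≠ 0) :
    IsStress (V.erase x) p (collapse u x v ω) ∧
      (∀ e, e ∉ sides (V.erase x) → (e ∈ B → x ∈ e) → collapse u x v ω e = 0) ∧
      (∀ e ∈ sides (V.erase x), 0 ≤ collapse u x v ω e) ∧
      (∀ e ∈ B, x ∉ e → collapse u x v ω e = ω e) ∧ (∃ e, collapse u x v ω e ≠ 0) ∧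
      ω s(v, x) = ω s(u, x) := by
  have h4 := h.four_le
  have huv' := isChord_of_isNext h4 hu hv
  have huvs : s(u, v) ∉ sides V := fun h1 => not_isChord_of_mem_sides (by omega) h1 huv'
  have huv0 : ω s(u, v) = 0 := by
    refine h0 _ fun h1 => ?_
    rcases mem_edges.1 h1 with h2 | h2
    · exact huvs h2
    · exact huv h2
  have hux : s(u, x) ∈ sides V := (mem_sides (by omega)).2 (Or.inl hu)
  have hsign : ∀ j, IsChord V x j → ω s(x, j) ≤ 0 := by
    intro j hj
    by_cases hB : s(x, j) ∈ B
    · exact hneg _ hB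
    · refine (h0 _ fun h1 => ?_).le
      rcases mem_edges.1 h1 with h2 | h2
      · exact not_isChord_of_mem_sides (by omega) h2 hj
      · exact hB h2
  obtain ⟨hx0, hvx⟩ := hω.eq_zero_of_midpoint h4 hu hv hp hmid hsign
  refine ⟨hω.collapse h4 hu hv hp hmid hsign huv0, ?_, ?_, ?_, ?_, hvx⟩
  · intro e hes heB
    rw [mem_sides_erase h4 hu hv] at hes
    push Not at hes
    by_cases hxe : x ∈ e
    · exact collapse_of_mem ω hes.1 hxe
    · rw [collapse_of_notMem ω hes.1 hxe]
      refine h0 e fun h1 => hxe ?_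
      rcases mem_edges.1 h1 with h2 | h2
      · exact hes.2 h2
      · exact heB h2
  · intro e he
    rcases (mem_sides_erase h4 hu hv).1 he with rfl | ⟨h1, h2⟩
    · rw [collapse_side]
      have := hpos _ hux
      linarith
    · rw [collapse_of_notMem ω (by rintro rfl; exact huvs h1) h2]
      exact hpos e h1
  · exact fun e he hxe => collapse_of_notMem ω (by rintro rfl; exact huv he) hxe
  · obtain ⟨e, he⟩ := hne
    by_cases hux0 : ω s(u, x) = 0
    · refine ⟨e, ?_⟩
      have hxe : x ∉ e := by
        intro hxe
        obtain ⟨j, rfl⟩ := hxe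
        have hj : j ∈ V ∧ x ≠ j := by
          by_contra hcon
          refine he (h0 _ fun h1 => hcon ?_)
          exact (h.mem_of_mem_edges h1).2
        rw [Sym2.eq_swap] at he
        by_cases hju : j = u
        · exact he (hju ▸ hux0)
        by_cases hjv : j = v
        · exact he (hjv ▸ hvx.trans hux0)
        · exact he (hx0 j hj.1 hj.2.symm hju hjv)
      rwa [collapse_of_notMem ω (by rintro rfl; exact he huv0) hxe]
    · refine ⟨s(u, v), ?_⟩
      rw [collapse_side]
      exact div_ne_zero hux0 two_ne_zero

/-- If every strictly convex realisation has a proper stress, then every vertex whose neighbours are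
not joined by a brace is removable: the stresses have a limit as the vertex is slid to the midpoint
of its neighbours, and the support of this limit crosses each chord of the other vertices. -/
theorem BraceSystem.removable {V : Finset ℕ} {B : Finset (Sym2 ℕ)} (h : BraceSystem V B)
    (hex : ∀ p, IsConvex V p → ∃ ω, IsProper V B p ω) {u x v : ℕ} (hu : IsNext V u x)
    (hv : IsNext V x v) (huv : s(u, v) ∉ B) : Removable V B x := by
  have h4 := h.four_le
  have hcard := Finset.card_erase_of_mem hu.2.1
  set P := slide parabola u x v with hP
  have hp0 : IsConvex (V.erase x) (P 0) := (isConvex_parabola V).slide_erase u x v 0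
  have hmid : P 0 x = (1 / 2 : ℝ) • (P 0 u + P 0 v) :=
    slide_zero_self parabola hu.2.2.1 hv.2.2.1.symm
  obtain ⟨ω, hω, hω0, hsgn⟩ := exists_weakly_signed_limit
    (N := fun s => stressSpace V (edges V B) (P s))
    (isClosed_stressSpace V (edges V B) (continuous_slide parabola u x v))
    Finset.univ (fun e : edges V B => sgn V e) fun s hs => by
      obtain ⟨ω, hω⟩ := hex _ ((isConvex_parabola V).slide_of_pos hu hv hs)
      have hr := extend_restrict hω.eq_zero
      refine ⟨fun e => ω e, mem_stressSpace.2 (hr.symm ▸ hω.isStress), ?_, fun e _ =>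
        (hω.sgn_mul_pos e.2).le⟩
      obtain ⟨e, he⟩ := h.exists_side
      exact Function.ne_iff.2 ⟨⟨e, mem_edges.2 (Or.inl he)⟩, (hω.pos e he).ne'⟩
  rw [mem_stressSpace] at hω
  have hsgn' : ∀ e ∈ edges V B, 0 ≤ sgn V e * extend (edges V B) ω e := by
    intro e he
    rw [extend_apply ω he]
    exact hsgn ⟨e, he⟩ (Finset.mem_univ _)
  obtain ⟨hpos, hneg⟩ := sgn_mul_nonneg h hsgn'
  obtain ⟨h1, h2, h3, h5, ⟨e, he⟩, -⟩ := h.collapse_signs hu hv hp0 hmid huv hω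
    (fun e => extend_eq_zero ω) hpos hneg (exists_extend_ne_zero hω0)
  set ρ := collapse u x v (extend (edges V B) ω) with hρ
  have hB : ∀ a b, IsChord (V.erase x) a b → ρ s(a, b) ≠ 0 → s(a, b) ∈ B ∧ a ≠ x ∧ b ≠ x := by
    intro a b hab h6
    by_contra hcon
    refine h6 (h2 _ (fun h7 => not_isChord_of_mem_sides (by omega) h7 hab) fun h7 => ?_)
    exact absurd ⟨h7, (Finset.mem_erase.1 hab.1).1, (Finset.mem_erase.1 hab.2.1).1⟩ hcon
  have hs : IsWeaklySigned (V.erase x) ρ := by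
    constructor
    · exact fun a b hab => h3 _ ((mem_sides (by omega)).2 (Or.inl hab))
    · intro a b hab
      by_cases h6 : ρ s(a, b) = 0
      · exact h6.le
      · obtain ⟨h7, h8, h9⟩ := hB a b hab h6
        rw [h5 _ h7 (by rw [Sym2.mem_iff]; tauto)]
        exact hneg _ h7
  have hne : ∃ a ∈ V.erase x, ∃ b ∈ V.erase x, a ≠ b ∧ ρ s(a, b) ≠ 0 := by
    induction e with | _ a b
    by_cases h6 : s(a, b) ∈ sides (V.erase x)
    · rcases (mem_sides (by omega)).1 h6 with h7 | h7
      · exact ⟨a, h7.1, b, h7.2.1, h7.2.2.1, he⟩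
      · exact ⟨a, h7.2.1, b, h7.1, h7.2.2.1.symm, he⟩
    · have h7 : s(a, b) ∈ B ∧ ¬ x ∈ s(a, b) := by
        by_contra hcon
        exact he (h2 _ h6 fun h8 => by tauto)
      have h8 := h.isChord a b h7.1
      rw [Sym2.mem_iff] at h7
      exact ⟨a, Finset.mem_erase.2 ⟨by tauto, h8.1⟩, b, Finset.mem_erase.2 ⟨by tauto, h8.2.1⟩,
        h8.ne, he⟩
  intro c d hcd
  obtain ⟨e, he, f, hf, hc, hef⟩ := hs.exists_crosses (by omega) hp0 h1 hne hcd
  obtain ⟨h6, h7, h8⟩ := hB e f (isChord_of_crosses he hf hcd.1 hcd.2.1 hc.comm) hef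
  exact ⟨e, f, h6, h7, h8, hc⟩

/-! ### Restoring a vertex -/

/-- While the vertex `x` is slid outwards from the midpoint of its neighbours, equilibrium at `x`
makes the stress of its only brace nonpositive if the stresses of the two sides at `x` are
nonnegative. -/
theorem nonpos_of_unique_brace {V : Finset ℕ} {p : ℕ → ℝ × ℝ} (hp : IsConvex V p) {u x v y : ℕ}
    (hu : IsNext V u x) (hv : IsNext V x v) (hy : IsChord V x y) {s : ℝ} (hs : 0 ≤ s)
    {ω : Sym2 ℕ → ℝ} (hω : IsStress V (slide p u x v s) ω)
    (h0 : ∀ j ∈ V, j ≠ x → j ≠ u → j ≠ v → j ≠ y → ω s(x, j) = 0) (hωu : 0 ≤ ω s(u, x))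
    (hωv : 0 ≤ ω s(x, v)) : ω s(x, y) ≤ 0 := by
  by_contra hcon
  push Not at hcon
  have hyx := hy.ne.symm
  have hyu : y ≠ u := by rintro rfl; exact hu.not_isChord hy.symm
  have hyv : y ≠ v := by rintro rfl; exact hv.not_isChord hy
  have hcr : ∀ b, cr (p v - p u) (b - slide p u x v s x) =
      orient (p u) (p v) b + s * orient (p u) (p x) (p v) := by
    intro b
    rw [slide_self]
    simp [orient, cr]; ring
  have h1 := hp u hu.1 x hu.2.1 v hv.2.1 (hu.cyc hv hy.2.1 hyx hyu)
  have h2 := hp u hu.1 v hv.2.1 y hy.2.1 (hu.cyc' hv hy.2.1 hyx hyu hyv).rotate.rotate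
  have h3 := mul_nonneg hs h1.le
  have hsum := hω.sum_cr hu.2.1 (p v - p u)
  refine hsum.not_gt (Finset.sum_pos' (fun j hj => ?_) ⟨y, hy.2.1, ?_⟩)
  · by_cases hjx : j = x
    · subst hjx; simp [cr]
    rw [slide_of_ne _ _ _ _ _ hjx, hcr]
    by_cases hju : j = u
    · rw [hju, orient_self_right, zero_add, Sym2.eq_swap]
      exact mul_nonneg hωu h3
    by_cases hjv : j = v
    · rw [hjv, ← orient_rotate, ← orient_rotate, orient_self_left, zero_add]
      exact mul_nonneg hωv h3
    by_cases hjy : j = y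
    · rw [hjy]
      exact mul_nonneg hcon.le (by linarith)
    · rw [h0 j hj hjx hju hjv hjy, zero_mul]
  · rw [slide_of_ne _ _ _ _ _ hyx, hcr]
    exact mul_pos hcon (by linarith)

open Classical in
/-- The function on the edges of `V` that comes from a stress `σ` of `V \ {x}` when the side
`{u, v}` is subdivided by `x`. -/
noncomputable def subdivide (u x v : ℕ) (σ : Sym2 ℕ → ℝ) (e : Sym2 ℕ) : ℝ :=
  if e = s(u, x) ∨ e = s(v, x) then 2 * σ s(u, v) else if e = s(u, v) then 0 else σ e

theorem subdivide_left (u x v : ℕ) (σ : Sym2 ℕ → ℝ) :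
    subdivide u x v σ s(u, x) = 2 * σ s(u, v) := if_pos (Or.inl rfl)

theorem subdivide_right (u x v : ℕ) (σ : Sym2 ℕ → ℝ) :
    subdivide u x v σ s(v, x) = 2 * σ s(u, v) := if_pos (Or.inr rfl)

theorem subdivide_side {u x v : ℕ} (σ : Sym2 ℕ → ℝ) (hu : u ≠ x) (hv : v ≠ x) :
    subdivide u x v σ s(u, v) = 0 := by
  unfold subdivide
  rw [if_neg, if_pos rfl]
  simp only [Sym2.eq_iff]
  tauto

theorem subdivide_of_ne {u x v : ℕ} (σ : Sym2 ℕ → ℝ) {e : Sym2 ℕ} (hu : e ≠ s(u, x))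
    (hv : e ≠ s(v, x)) (huv : e ≠ s(u, v)) : subdivide u x v σ e = σ e := by
  unfold subdivide
  rw [if_neg (by tauto), if_neg huv]

/-- A proper stress of `V \ {x}` becomes, with `x` at the midpoint of its neighbours, a stress of
`V` that has the signs of a proper stress except that it vanishes on the brace at `x`. -/
theorem IsProper.subdivide {V : Finset ℕ} {B : Finset (Sym2 ℕ)} (h : BraceSystem V B)
    {p : ℕ → ℝ × ℝ} {u x v y : ℕ} (hu : IsNext V u x) (hv : IsNext V x v)
    (hmid : p x = (1 / 2 : ℝ) • (p u + p v)) (huv : s(u, v) ∉ B)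
    (hy : ∀ z, s(x, z) ∈ B → z = y) {σ : Sym2 ℕ → ℝ}
    (hσ : IsProper (V.erase x) (B.erase s(x, y)) p σ) :
    IsStress V p (subdivide u x v σ) ∧ (∀ e, e ∉ edges V B → subdivide u x v σ e = 0) ∧
      ∀ e ∈ edges V B, e ≠ s(x, y) → 0 < sgn V e * subdivide u x v σ e := by
  have h4 := h.four_le
  have hcard := Finset.card_erase_of_mem hu.2.1
  have huv' := isChord_of_isNext h4 hu hv
  have huvs : s(u, v) ∉ sides V := fun h1 => not_isChord_of_mem_sides (by omega) h1 huv'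
  have hside : ∀ e, e ∈ sides V → x ∈ e → e = s(u, x) ∨ e = s(v, x) := by
    rintro e he ⟨j, rfl⟩
    rcases (mem_sides (by omega)).1 he with h1 | h1
    · right; rw [h1.unique hv, Sym2.eq_swap]
    · left; rw [h1.unique_left hu, Sym2.eq_swap]
  have hσx : ∀ e, x ∈ e → σ e = 0 := by
    intro e hxe
    refine hσ.eq_zero e fun h1 => ?_
    rcases mem_edges.1 h1 with h2 | h2
    · rcases (mem_sides_erase h4 hu hv).1 h2 with rfl | h3
      · rw [Sym2.mem_iff] at hxe
        rcases hxe with rfl | rfl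
        · exact hu.2.2.1 rfl
        · exact hv.2.2.1 rfl
      · exact h3.2 hxe
    · obtain ⟨z, rfl⟩ := hxe
      rw [Finset.mem_erase] at h2
      exact h2.1 (by rw [hy z h2.2])
  have hσuv : 0 < σ s(u, v) := hσ.pos _ ((mem_sides_erase h4 hu hv).2 (Or.inl rfl))
  refine ⟨?_, ?_, ?_⟩
  · refine (isStress_subdivide hu.1 hv.2.1 hu.2.1 hu.2.2.1 hv.2.2.1.symm huv'.ne hmid
      (subdivide_left u x v σ) (subdivide_right u x v σ) ?_ ?_ ?_).2 hσ.isStress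
    · intro j _ hjx hju hjv
      rw [subdivide_of_ne]
      · exact hσx _ (Sym2.mem_mk_right j x)
      · intro h1; rcases Sym2.eq_iff.1 h1 with h2 | h2 <;> tauto
      · intro h1; rcases Sym2.eq_iff.1 h1 with h2 | h2 <;> tauto
      · intro h1
        have := hu.2.2.1
        have := hv.2.2.1
        rcases Sym2.eq_iff.1 h1 with h2 | h2 <;> tauto
    · intro i _ j _ hix hjx hij
      rw [subdivide_of_ne σ _ _ hij]
      · intro h1; rcases Sym2.eq_iff.1 h1 with h2 | h2 <;> tauto
      · intro h1; rcases Sym2.eq_iff.1 h1 with h2 | h2 <;> tauto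
    · rw [subdivide_side σ hu.2.2.1 hv.2.2.1.symm]; ring
  · intro e he
    by_cases heuv : e = s(u, v)
    · rw [heuv, subdivide_side σ hu.2.2.1 hv.2.2.1.symm]
    rw [subdivide_of_ne σ _ _ heuv]
    · refine hσ.eq_zero e fun h1 => he ?_
      rcases mem_edges.1 h1 with h2 | h2
      · exact mem_edges.2 (Or.inl (((mem_sides_erase h4 hu hv).1 h2).resolve_left heuv).1)
      · exact mem_edges.2 (Or.inr (Finset.mem_of_mem_erase h2))
    · rintro rfl
      exact he (mem_edges.2 (Or.inl ((mem_sides (by omega)).2 (Or.inl hu))))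
    · rintro rfl
      exact he (mem_edges.2 (Or.inl ((mem_sides (by omega)).2 (Or.inr hv))))
  · intro e he hexy
    by_cases hes : e ∈ sides V
    · rw [sgn_mul_of_mem hes]
      by_cases hxe : x ∈ e
      · rcases hside e hes hxe with rfl | rfl
        · rw [subdivide_left]; linarith
        · rw [subdivide_right]; linarith
      · rw [subdivide_of_ne]
        · exact hσ.pos e ((mem_sides_erase h4 hu hv).2 (Or.inr ⟨hes, hxe⟩))
        · rintro rfl; exact hxe (Sym2.mem_mk_right u x)
        · rintro rfl; exact hxe (Sym2.mem_mk_right v x)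
        · rintro rfl; exact huvs hes
    · rw [sgn_mul_of_notMem hes]
      have heB := (mem_edges.1 he).resolve_left hes
      have := hσ.neg e (Finset.mem_erase.2 ⟨hexy, heB⟩)
      rw [subdivide_of_ne]
      · linarith
      · rintro rfl; exact hes ((mem_sides (by omega)).2 (Or.inl hu))
      · rintro rfl; exact hes ((mem_sides (by omega)).2 (Or.inr hv))
      · rintro rfl; exact huv heB

/-- If `x` is incident with just one brace, then the proper stresses of `V \ {x}` give rise to
proper stresses of `V`. -/
theorem BraceSystem.exists_isProper_of_erase {V : Finset ℕ} {B : Finset (Sym2 ℕ)}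
    (h : BraceSystem V B) (hB : V.card ≤ B.card + 2) {u x v y : ℕ} (hu : IsNext V u x)
    (hv : IsNext V x v) (hxy : s(x, y) ∈ B) (hy : ∀ z, s(x, z) ∈ B → z = y) (huv : s(u, v) ∉ B)
    (h' : BraceSystem (V.erase x) (B.erase s(x, y)))
    (hex : ∀ p, IsConvex (V.erase x) p → ∃ σ, IsProper (V.erase x) (B.erase s(x, y)) p σ)
    {p : ℕ → ℝ × ℝ} (hp : IsConvex V p) : ∃ ω, IsProper V B p ω := by
  classical
  have h4 := h.four_le
  have hyc := h.isChord x y hxy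
  have hyx := hyc.ne.symm
  have hyu : y ≠ u := by rintro rfl; exact hu.not_isChord hyc.symm
  have huvs : s(u, v) ∉ sides V := fun h1 =>
    not_isChord_of_mem_sides (by omega) h1 (isChord_of_isNext h4 hu hv)
  have hux : s(u, x) ∈ sides V := (mem_sides (by omega)).2 (Or.inl hu)
  have hxv : s(x, v) ∈ sides V := (mem_sides (by omega)).2 (Or.inl hv)
  have hpuv : p u ≠ p v := by
    intro h1
    have h2 := hp u hu.1 x hu.2.1 v hv.2.1 (hu.cyc hv hyc.2.1 hyx hyu)
    rw [h1, orient_self_right] at h2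
    exact lt_irrefl _ h2
  set P := slide p u x v with hP
  have hmid : P 0 x = (1 / 2 : ℝ) • (P 0 u + P 0 v) :=
    slide_zero_self p hu.2.2.1 hv.2.2.1.symm
  set J : Finset (edges V B) := Finset.univ.filter fun e => (e : Sym2 ℕ) ≠ s(x, y) with hJ
  -- the sign on the brace at `x` is a consequence of the other signs
  have hweak : ∀ s ∈ Set.Icc (0 : ℝ) 1, ∀ ω ∈ stressSpace V (edges V B) (P s),
      (∀ e ∈ J, 0 ≤ sgn V e * ω e) →
      ∀ e ∈ edges V B, 0 ≤ sgn V e * extend (edges V B) ω e := by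
    intro s hs ω hω hωJ e he
    rw [mem_stressSpace] at hω
    have hne : ∀ e ∈ edges V B, e ≠ s(x, y) → 0 ≤ sgn V e * extend (edges V B) ω e := by
      intro e he hexy
      rw [extend_apply ω he]
      exact hωJ ⟨e, he⟩ (Finset.mem_filter.2 ⟨Finset.mem_univ _, hexy⟩)
    have hside : ∀ e ∈ sides V, 0 ≤ extend (edges V B) ω e := by
      intro e he
      have := hne e (mem_edges.2 (Or.inl he)) (by rintro rfl; exact h.notMem_sides hxy he)
      rwa [sgn_mul_of_mem he] at this
    by_cases hexy : e = s(x, y)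
    · subst hexy
      rw [sgn_mul_of_notMem (h.notMem_sides hxy), le_neg, neg_zero]
      refine nonpos_of_unique_brace hp hu hv hyc hs.1 hω ?_ (hside _ hux) (hside _ hxv)
      intro j hj hjx hju hjv hjy
      refine extend_eq_zero ω fun h1 => ?_
      rcases mem_edges.1 h1 with h2 | h2
      · rcases (mem_sides (by omega)).1 h2 with h3 | h3
        · exact hjv (h3.unique hv)
        · exact hju (h3.unique_left hu)
      · exact hjy (hy j h2)
    · exact hne e he hexy
  obtain ⟨ω, hω, hω0, hωJ⟩ := exists_strictly_signed_of_path
    (N := fun s => stressSpace V (edges V B) (P s))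
    (isClosed_stressSpace V (edges V B) (continuous_slide p u x v)) (fun s _ => by
      refine exists_stress_ne_zero (by rw [h.card_edges]; omega) hu.1 hv.2.1 ?_
      rwa [hP, slide_of_ne _ _ _ _ _ hu.2.2.1, slide_of_ne _ _ _ _ _ hv.2.2.1.symm])
    J (fun e : edges V B => sgn V e) (fun s hs ω hω hω0 hωJ => by
      have hsgn := hweak s hs ω hω hωJ
      rw [mem_stressSpace] at hω
      obtain ⟨hpos, hneg⟩ := sgn_mul_nonneg h hsgn
      intro e he
      rw [← extend_apply ω e.2]
      rcases hs.1.eq_or_lt with rfl | hs0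
      · have hp0 : IsConvex (V.erase x) (P 0) := hp.slide_erase u x v 0
        obtain ⟨h1, h2, h3, h5, h6, h7⟩ := h.collapse_signs hu hv hp0 hmid huv hω
          (fun e => extend_eq_zero ω) hpos hneg (exists_extend_ne_zero hω0)
        have hBx : ∀ e ∈ B, e ≠ s(x, y) → x ∉ e := by
          rintro e he hexy ⟨z, rfl⟩
          exact hexy (by rw [hy z he])
        have hpr := h'.isProper hp0 h1 (fun e he => by
          rw [mem_edges] at he
          push Not at he
          refine h2 e he.1 fun heB => ?_
          by_contra hxe
          exact he.2 (Finset.mem_erase.2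
            ⟨by rintro rfl; exact hxe (Sym2.mem_mk_left x y), heB⟩)) h3 (fun e he => by
          rw [Finset.mem_erase] at he
          rw [h5 e he.2 (hBx e he.2 he.1)]
          exact hneg e he.2) h6
        have hexy := (Finset.mem_filter.1 he).2
        obtain ⟨e, heE⟩ := e
        simp only at hexy ⊢
        by_cases hes : e ∈ sides V
        · rw [sgn_mul_of_mem hes]
          by_cases hxe : x ∈ e
          · have h8 := hpr.pos _ ((mem_sides_erase h4 hu hv).2 (Or.inl rfl))
            rw [collapse_side] at h8
            obtain ⟨j, rfl⟩ := hxe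
            rcases (mem_sides (by omega)).1 hes with h9 | h9
            · rw [h9.unique hv, Sym2.eq_swap, h7]; linarith
            · rw [h9.unique_left hu, Sym2.eq_swap]; linarith
          · have h8 := hpr.pos _ ((mem_sides_erase h4 hu hv).2 (Or.inr ⟨hes, hxe⟩))
            rwa [collapse_of_notMem _ (by rintro rfl; exact huvs hes) hxe] at h8
        · have heB := (mem_edges.1 heE).resolve_left hes
          have h8 := hpr.neg e (Finset.mem_erase.2 ⟨hexy, heB⟩)
          rw [h5 e heB (hBx e heB hexy)] at h8
          rw [sgn_mul_of_notMem hes]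
          linarith
      · have hps : IsConvex V (P s) := hp.slide_of_pos hu hv ⟨hs0, hs.2⟩
        exact (h.isProper hps hω (fun e => extend_eq_zero ω) hpos hneg
          (exists_extend_ne_zero hω0)).sgn_mul_pos e.2) (by
      obtain ⟨σ, hσ⟩ := hex (P 0) (hp.slide_erase u x v 0)
      obtain ⟨h1, h2, h3⟩ := hσ.subdivide h hu hv hmid huv hy
      refine ⟨fun e => subdivide u x v σ e, ?_, ?_, fun e he =>
        (h3 e e.2 (Finset.mem_filter.1 he).2).le⟩
      · rw [mem_stressSpace, extend_restrict h2]
        exact h1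
      · intro h5
        have h6 := mem_edges.2 (Or.inl hux : s(u, x) ∈ sides V ∨ s(u, x) ∈ B)
        have h7 := h3 _ h6 (by intro h8; rw [h8] at hux; exact h.notMem_sides hxy hux)
        have h8 := congrFun h5 ⟨s(u, x), h6⟩
        simp only [Pi.zero_apply] at h8
        rw [h8, mul_zero] at h7
        exact lt_irrefl _ h7)
  have hsgn := hweak 1 ⟨zero_le_one, le_refl _⟩ ω hω fun e he => (hωJ e he).le
  obtain ⟨hpos, hneg⟩ := sgn_mul_nonneg h hsgn
  rw [mem_stressSpace, hP, slide_one] at hω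
  exact ⟨_, h.isProper hp hω (fun e => extend_eq_zero ω) hpos hneg (exists_extend_ne_zero hω0)⟩

/-! ### Proper stresses of all realisations -/

theorem exists_eq_insert_of_card_eq_four {V : Finset ℕ} (hV : V.card = 4) :
    ∃ a b c d, a < b ∧ b < c ∧ c < d ∧ V = {a, b, c, d} := by
  have hmono := (V.orderEmbOfFin hV).strictMono
  refine ⟨V.orderEmbOfFin hV 0, V.orderEmbOfFin hV 1, V.orderEmbOfFin hV 2, V.orderEmbOfFin hV 3,
    hmono (by decide), hmono (by decide), hmono (by decide), ?_⟩
  ext i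
  have h1 : i ∈ V ↔ i ∈ Set.range (V.orderEmbOfFin hV) := by
    rw [Finset.range_orderEmbOfFin]; rfl
  rw [h1, Set.mem_range, Fin.exists_fin_succ, Fin.exists_fin_succ, Fin.exists_fin_succ,
    Fin.exists_fin_succ]
  simp [eq_comm]

theorem IsChord.eq_or_eq_of_four {a b c d i j : ℕ} (hab : a < b) (hbc : b < c) (hcd : c < d)
    (h : IsChord {a, b, c, d} i j) : s(i, j) = s(a, c) ∨ s(i, j) = s(b, d) := by
  obtain ⟨hi, hj, ⟨k, hk, hk'⟩, ⟨l, hl, hl'⟩⟩ := h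
  simp only [Finset.mem_insert, Finset.mem_singleton] at hi hj hk hl
  unfold Cyc at hk' hl'
  rcases hi with rfl | rfl | rfl | rfl <;> rcases hj with rfl | rfl | rfl | rfl <;>
    first
    | exact Or.inl rfl
    | exact Or.inr rfl
    | exact Or.inl Sym2.eq_swap
    | exact Or.inr Sym2.eq_swap
    | (exfalso; clear hl hl'; rcases hk with rfl | rfl | rfl | rfl <;> omega)
    | (exfalso; clear hk hk'; rcases hl with rfl | rfl | rfl | rfl <;> omega)

theorem IsNext.eq_of_four {a b c d i j : ℕ} (hab : a < b) (hbc : b < c) (hcd : c < d)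
    (h : IsNext {a, b, c, d} i j) :
    (i = a ∧ j = b) ∨ (i = b ∧ j = c) ∨ (i = c ∧ j = d) ∨ (i = d ∧ j = a) := by
  obtain ⟨hi, hj, hij, hn⟩ := h
  simp only [Finset.mem_insert, Finset.mem_singleton, forall_eq_or_imp, forall_eq] at hi hj hn
  obtain ⟨h1, h2, h3, h4⟩ := hn
  unfold Cyc at h1 h2 h3 h4
  rcases hi with rfl | rfl | rfl | rfl <;> rcases hj with rfl | rfl | rfl | rfl <;>
    first
    | exact Or.inl ⟨rfl, rfl⟩
    | exact Or.inr (Or.inl ⟨rfl, rfl⟩)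
    | exact Or.inr (Or.inr (Or.inl ⟨rfl, rfl⟩))
    | exact Or.inr (Or.inr (Or.inr ⟨rfl, rfl⟩))
    | (exfalso; omega)

/-- The braces of a quadrilateral are its two diagonals. -/
theorem BraceSystem.eq_of_card_eq_four {a b c d : ℕ} (hab : a < b) (hbc : b < c) (hcd : c < d)
    {B : Finset (Sym2 ℕ)} (h : BraceSystem {a, b, c, d} B) : B = {s(a, c), s(b, d)} := by
  have hsub : ∀ e ∈ B, e = s(a, c) ∨ e = s(b, d) := by
    intro e he
    induction e with | _ i j
    exact (h.isChord i j he).eq_or_eq_of_four hab hbc hcd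
  have hac : IsChord {a, b, c, d} a c := by
    refine ⟨by simp, by simp, ⟨b, by simp, ?_⟩, ⟨d, by simp, ?_⟩⟩ <;> (unfold Cyc; omega)
  have hbd : IsChord {a, b, c, d} b d := by
    refine ⟨by simp, by simp, ⟨c, by simp, ?_⟩, ⟨a, by simp, ?_⟩⟩ <;> (unfold Cyc; omega)
  have hself : ∀ i j, ¬ Crosses i j i j := fun i j hc => by
    unfold Crosses Cyc at hc; omega
  ext e
  rw [Finset.mem_insert, Finset.mem_singleton]
  refine ⟨hsub e, ?_⟩
  rintro (rfl | rfl)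
  · obtain ⟨i, j, hij, hc⟩ := h.cover b d hbd
    rcases hsub _ hij with h1 | h1
    · rwa [← h1]
    · exact absurd (hc.congr_right h1) (hself b d)
  · obtain ⟨i, j, hij, hc⟩ := h.cover a c hac
    rcases hsub _ hij with h1 | h1
    · exact absurd (hc.congr_right h1) (hself a c)
    · rwa [← h1]

/-- The stress `-λ i * λ j` of a quadrilateral, with `λ` the affine dependence of its vertices, is
proper. -/
theorem BraceSystem.exists_isProper_of_card_eq_four {V : Finset ℕ} {B : Finset (Sym2 ℕ)}
    (h : BraceSystem V B) (hV : V.card = 4) {p : ℕ → ℝ × ℝ} (hp : IsConvex V p) :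
    ∃ ω, IsProper V B p ω := by
  obtain ⟨a, b, c, d, hab, hbc, hcd, rfl⟩ := exists_eq_insert_of_card_eq_four hV
  have hB := h.eq_of_card_eq_four hab hbc hcd
  have hpos : ∀ i ∈ ({a, b, c, d} : Finset ℕ), ∀ j ∈ ({a, b, c, d} : Finset ℕ),
      ∀ k ∈ ({a, b, c, d} : Finset ℕ), i < j → j < k → 0 < orient (p i) (p j) (p k) :=
    fun i hi j hj k hk h1 h2 => hp i hi j hj k hk (Or.inl ⟨h1, h2⟩)
  have h1 := hpos b (by simp) c (by simp) d (by simp) hbc hcd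
  have h2 := hpos a (by simp) c (by simp) d (by simp) (hab.trans hbc) hcd
  have h3 := hpos a (by simp) b (by simp) d (by simp) hab (hbc.trans hcd)
  have h4 := hpos a (by simp) b (by simp) c (by simp) hab hbc
  obtain ⟨l, hla, hlb, hlc, hld⟩ : ∃ l : ℕ → ℝ, l a = orient (p b) (p c) (p d) ∧
      l b = -orient (p a) (p c) (p d) ∧ l c = orient (p a) (p b) (p d) ∧
      l d = -orient (p a) (p b) (p c) := by
    refine ⟨fun i => if i = a then orient (p b) (p c) (p d) else
      if i = b then -orient (p a) (p c) (p d) else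
      if i = c then orient (p a) (p b) (p d) else -orient (p a) (p b) (p c), if_pos rfl, ?_⟩
    have := hab.ne'
    have := hbc.ne'
    have := hcd.ne'
    have := (hab.trans hbc).ne'
    have := (hbc.trans hcd).ne'
    have := ((hab.trans hbc).trans hcd).ne'
    simp [*]
  let μ : Sym2 ℕ → ℝ := Sym2.lift ⟨fun i j => -(l i * l j), fun i j => by ring⟩
  have hμ : ∀ i j, μ s(i, j) = -(l i * l j) := fun i j => rfl
  have hedge : ∀ i ∈ ({a, b, c, d} : Finset ℕ), ∀ j ∈ ({a, b, c, d} : Finset ℕ), i ≠ j →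
      s(i, j) ∈ edges {a, b, c, d} B := by
    intro i hi j hj hij
    rw [mem_edges, mem_sides (by omega), hB]
    rcases isNext_or_isNext_or_isChord hi hj hij with h5 | h5 | h5
    · exact Or.inl (Or.inl h5)
    · exact Or.inl (Or.inr h5)
    · right
      rw [Finset.mem_insert, Finset.mem_singleton]
      exact h5.eq_or_eq_of_four hab hbc hcd
  refine ⟨extend (edges {a, b, c, d} B) fun e => μ e, ?_, fun e => extend_eq_zero _, ?_, ?_⟩
  · intro i hi
    have h5 : ∀ j ∈ ({a, b, c, d} : Finset ℕ),
        extend (edges {a, b, c, d} B) (fun e => μ e) s(i, j) • (p j - p i) =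
          (-(l i * l j)) • (p j - p i) := by
      intro j hj
      by_cases hij : i = j
      · subst hij; simp
      · rw [extend_apply _ (hedge i hi j hj hij), hμ]
    rw [Finset.sum_congr rfl h5]
    have hab' := hab.ne
    have hbc' := hbc.ne
    have hcd' := hcd.ne
    have hac' := (hab.trans hbc).ne
    have hbd' := (hbc.trans hcd).ne
    have had' := ((hab.trans hbc).trans hcd).ne
    rw [Finset.sum_insert (by simp [*]), Finset.sum_insert (by simp [*]),
      Finset.sum_insert (by simp [*]), Finset.sum_singleton, hla, hlb, hlc, hld]
    refine Prod.ext ?_ ?_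
    · simp [orient, cr]; ring
    · simp [orient, cr]; ring
  · intro e he
    rw [extend_apply _ (mem_edges.2 (Or.inl he))]
    induction e with | _ i j
    have key : ∀ i j, IsNext {a, b, c, d} i j → 0 < μ s(i, j) := by
      intro i j hij
      rw [hμ]
      rcases hij.eq_of_four hab hbc hcd with ⟨rfl, rfl⟩ | ⟨rfl, rfl⟩ | ⟨rfl, rfl⟩ | ⟨rfl, rfl⟩
      · rw [hla, hlb]; have := mul_pos h1 h2; linarith
      · rw [hlb, hlc]; have := mul_pos h2 h3; linarith
      · rw [hlc, hld]; have := mul_pos h3 h4; linarith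
      · rw [hld, hla]; have := mul_pos h4 h1; linarith
    rcases (mem_sides (by omega)).1 he with h5 | h5
    · exact key i j h5
    · have h6 := key j i h5
      rw [Sym2.eq_swap] at h6
      exact h6
  · intro e he
    rw [extend_apply _ (mem_edges.2 (Or.inr he))]
    rw [hB, Finset.mem_insert, Finset.mem_singleton] at he
    rcases he with rfl | rfl
    · simp only [hμ]; rw [hla, hlc]; have := mul_pos h1 h3; linarith
    · simp only [hμ]; rw [hlb, hld]; have := mul_pos h2 h4; linarith

/-- A brace system on `V` with at least `|V| - 2` members has exactly that many, and then all
strictly convex realisations have proper stresses. The induction removes a vertex, collapsing it to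
the midpoint of its neighbours. -/
theorem BraceSystem.card_eq_and_exists_isProper {V : Finset ℕ} {B : Finset (Sym2 ℕ)}
    (h : BraceSystem V B) (hB : V.card ≤ B.card + 2) :
    B.card + 2 = V.card ∧ ∀ p, IsConvex V p → ∃ ω, IsProper V B p ω := by
  classical
  obtain ⟨n, hn⟩ : ∃ n, n = V.card := ⟨_, rfl⟩
  induction n using Nat.strong_induction_on generalizing V B with
  | _ n ih =>
    subst hn
    have h4 := h.four_le
    rcases h4.eq_or_lt with h4 | h4
    · refine ⟨?_, fun p hp => h.exists_isProper_of_card_eq_four h4.symm hp⟩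
      obtain ⟨a, b, c, d, hab, hbc, hcd, rfl⟩ := exists_eq_insert_of_card_eq_four h4.symm
      rw [h.eq_of_card_eq_four hab hbc hcd, ← h4, Finset.card_pair]
      rw [Ne, Sym2.eq_iff]
      omega
    · obtain ⟨x, hx, hr⟩ := h.exists_removable h4 hB
        (fun V' B' hlt h' => by
          by_contra hcon
          have := (ih _ hlt h' (by omega) rfl).1
          omega)
        (fun V' B' hlt h' hB' u x v hu hv huv =>
          h'.removable (ih _ hlt h' (by omega) rfl).2 hu hv huv)
      obtain ⟨w, hw, hwx⟩ := Finset.exists_mem_ne (by omega : 1 < V.card) x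
      obtain ⟨v, hv⟩ := exists_isNext hx hw hwx.symm
      obtain ⟨u, hu⟩ := exists_isNext_left hx hw hwx.symm
      obtain ⟨y, hxy, hy, huv, h'⟩ := h.erase h4 hu hv hr
      have hc1 := Finset.card_erase_add_one hx
      have hc2 := Finset.card_erase_add_one hxy
      obtain ⟨h1, h2⟩ := ih _ (by omega) h' (by omega) rfl
      exact ⟨by omega, fun p hp => h.exists_isProper_of_erase hB hu hv hxy hy huv h' h2 hp⟩

/-! ### Sparsity of the edge set -/

/-- A proper subset `W` of the vertices spans at most `2 |W| - 3` edges: otherwise these edges carry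
a nonzero stress, which vanishes on the sides at the other vertices. -/
theorem BraceSystem.card_le_of_ssubset {V : Finset ℕ} {B : Finset (Sym2 ℕ)} (h : BraceSystem V B)
    (hB : V.card ≤ B.card + 2) {W : Finset ℕ} (hWV : W ⊂ V) (hW : 2 ≤ W.card)
    {E : Finset (Sym2 ℕ)} (hE : E ⊆ edges V B) (hEW : ∀ a b, s(a, b) ∈ E → a ∈ W ∧ b ∈ W) :
    E.card + 3 ≤ 2 * W.card := by
  by_contra hcon
  have h4 := h.four_le
  have hp := isConvex_parabola V
  obtain ⟨ω, hω⟩ := (h.card_eq_and_exists_isProper hB).2 _ hp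
  obtain ⟨a, ha, b, hb, hab⟩ := Finset.one_lt_card.1 hW
  have hab' : parabola a ≠ parabola b := by
    intro h1
    exact hab (Nat.cast_injective (R := ℝ) (congrArg Prod.fst h1))
  obtain ⟨τ, hτ, hτ0⟩ := exists_stress_ne_zero (E := E) (by omega) ha hb hab'
  rw [mem_stressSpace] at hτ
  set σ := extend E τ with hσ
  have hσ0 : ∀ i j, (i ∉ W ∨ j ∉ W) → σ s(i, j) = 0 := by
    intro i j hij
    refine extend_eq_zero τ fun h1 => ?_
    have := hEW i j h1
    tauto
  have hσV : IsStress V parabola σ := by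
    intro i hi
    by_cases hiW : i ∈ W
    · rw [← hτ i hiW]
      symm
      refine Finset.sum_subset hWV.1 fun j _ hj => ?_
      rw [hσ0 i j (Or.inr hj), zero_smul]
    · refine Finset.sum_eq_zero fun j _ => ?_
      rw [hσ0 i j (Or.inl hiW), zero_smul]
  obtain ⟨e, he⟩ := exists_extend_ne_zero hτ0
  have hσE : ∀ e, e ∉ edges V B → σ e = 0 := fun e he => extend_eq_zero τ fun h1 => he (hE h1)
  have heE : e ∈ edges V B := by
    by_contra h1
    exact he (hσE e h1)
  have hmem : ∀ ω : Sym2 ℕ → ℝ, IsStress V parabola ω → (∀ e, e ∉ edges V B → ω e = 0) →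
      (fun e : edges V B => ω e) ∈ stressSpace V (edges V B) parabola := fun ω h1 h2 => by
    rw [mem_stressSpace, extend_restrict h2]
    exact h1
  have key := pos_or_neg_of_forall (stressSpace V (edges V B) parabola) Finset.univ
    (fun e => sgn V e) (fun ω hω hω0 hpos => by
      rw [mem_stressSpace] at hω
      obtain ⟨h1, h2⟩ := sgn_mul_nonneg h (ω := extend (edges V B) ω) fun e he => by
        rw [extend_apply ω he]
        exact hpos ⟨e, he⟩ (Finset.mem_univ _)
      intro e _
      have h3 := (h.isProper hp hω (fun e => extend_eq_zero ω) h1 h2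
        (exists_extend_ne_zero hω0)).sgn_mul_pos e.2
      rwa [extend_apply ω e.2] at h3)
    (hmem ω hω.isStress hω.eq_zero) (fun e _ => hω.sgn_mul_pos e.2) (hmem σ hσV hσE)
    (Function.ne_iff.2 ⟨⟨e, heE⟩, he⟩)
  obtain ⟨w, hw, hwW⟩ := Finset.exists_of_ssubset hWV
  obtain ⟨w', hw', hww'⟩ := Finset.exists_mem_ne (by omega : 1 < V.card) w
  obtain ⟨v, hv⟩ := exists_isNext hw hw' hww'.symm
  have hwv : s(w, v) ∈ edges V B := mem_edges.2 (Or.inl ((mem_sides (by omega)).2 (Or.inl hv)))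
  have h0 := hσ0 w v (Or.inl hwW)
  rcases key with h1 | h1
  · have := h1 ⟨_, hwv⟩ (Finset.mem_univ _)
    simp [h0] at this
  · have := h1 ⟨_, hwv⟩ (Finset.mem_univ _)
    simp [h0] at this

/-! ### Convexity from the sides -/

/-- A polygon is strictly convex if all other vertices are to the left of each side. -/
theorem isConvex_of_isNext {V : Finset ℕ} {p : ℕ → ℝ × ℝ}
    (h : ∀ a b, IsNext V a b → ∀ j ∈ V, j ≠ a → j ≠ b → 0 < orient (p a) (p b) (p j)) :
    IsConvex V p := by
  intro a ha b hb c hc habc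
  obtain ⟨r, hr⟩ := exists_rank V a ha
  obtain ⟨k, hk⟩ := exists_isNext ha hb habc.ne.1
  obtain ⟨m, hm⟩ : ∃ m, m = r c := ⟨_, rfl⟩
  induction m using Nat.strong_induction_on generalizing c with
  | _ m ih =>
    subst hm
    obtain ⟨d, hd⟩ := exists_isNext_left hc hb habc.ne.2.1.symm
    by_cases hdb : d = b
    · rw [← hdb, orient_rotate]
      exact h d c hd a ha (by rintro rfl; exact habc.ne.1 hdb) habc.ne.2.2
    have hda : d ≠ a := by
      rintro rfl
      exact hd.2.2.2 b hb habc
    have habd : Cyc a b d := by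
      have h1 := hd.2.2.2 b hb
      have h2 := hd.2.2.2 a ha
      have h3 := hd.2.2.1
      clear hd hk ih hr h
      unfold Cyc at *; omega
    have hlt : r d < r c := (hr d hd.1 c hc hda habc.ne.2.2.symm).2 (by
      have h2 := hd.2.2.2 a ha
      have h3 := hd.2.2.1
      clear hd hk ih hr h
      unfold Cyc at *; omega)
    have h1 := ih (r d) hlt d hd.1 habd rfl
    have hne : ∀ i ∈ V, Cyc a b i → i ≠ k := by
      rintro i _ h2 rfl
      exact hk.2.2.2 b hb h2
    have hkd := h a k hk d hd.1 hda (hne d hd.1 habd)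
    have hkc := h a k hk c hc habc.ne.2.2.symm (hne c hc habc)
    have hkb : 0 ≤ orient (p a) (p k) (p b) := by
      by_cases hbk : b = k
      · rw [hbk, ← orient_rotate, orient_swap]
        simp [orient, cr]
      · exact (h a k hk b hb habc.ne.1.symm hbk).le
    have hdc := h d c hd a ha hda.symm habc.ne.2.2
    rw [← orient_rotate] at hdc
    -- the Plücker relation of the directions from `a` to `k`, `b`, `d` and `c`
    have hpl : orient (p a) (p k) (p d) * orient (p a) (p b) (p c) =
        orient (p a) (p k) (p b) * orient (p a) (p d) (p c) +
          orient (p a) (p k) (p c) * orient (p a) (p b) (p d) := by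
      simp only [orient, cr]; ring
    have h2 := mul_nonneg hkb hdc.le
    have h3 := mul_pos hkc h1
    exact (mul_pos_iff_of_pos_left hkd).1 (by linarith)

theorem orient_swap_swap (a b c : ℝ × ℝ) : orient a.swap b.swap c.swap = - orient a b c := by
  simp [orient, cr]

/-- If each side of a polygon has all other vertices strictly on one side, then the polygon is
strictly convex, up to a reflection. -/
theorem isConvex_or_isConvex_swap {V : Finset ℕ} {p : ℕ → ℝ × ℝ} (hV : 3 ≤ V.card)
    (h0 : ∀ a b, IsNext V a b → ∀ j ∈ V, j ≠ a → j ≠ b → orient (p a) (p b) (p j) ≠ 0)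
    (h1 : ∀ a b, IsNext V a b → ∀ i ∈ V, ∀ j ∈ V, 0 < orient (p a) (p b) (p i) →
      0 ≤ orient (p a) (p b) (p j)) :
    IsConvex V p ∨ IsConvex V fun i => (p i).swap := by
  -- a positive triangle at a side makes all vertices lie to the left of all sides
  have key : ∀ q : ℕ → ℝ × ℝ,
      (∀ a b, IsNext V a b → ∀ j ∈ V, j ≠ a → j ≠ b → orient (q a) (q b) (q j) ≠ 0) →
      (∀ a b, IsNext V a b → ∀ i ∈ V, ∀ j ∈ V, 0 < orient (q a) (q b) (q i) →
        0 ≤ orient (q a) (q b) (q j)) →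
      ∀ a b, IsNext V a b → ∀ j ∈ V, 0 < orient (q a) (q b) (q j) → IsConvex V q := by
    intro q h0 h1 a b hab j hj hpos
    have hside : ∀ a b, IsNext V a b → ∀ j ∈ V, 0 < orient (q a) (q b) (q j) →
        ∀ i ∈ V, i ≠ a → i ≠ b → 0 < orient (q a) (q b) (q i) :=
      fun a b hab j hj hpos i hi hia hib =>
      lt_of_le_of_ne (h1 a b hab j hj i hi hpos) (h0 a b hab i hi hia hib).symm
    refine isConvex_of_isNext fun c d hcd => ?_
    refine forall_of_isNext (P := fun c => ∀ d, IsNext V c d → ∀ j ∈ V, j ≠ c → j ≠ d →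
      0 < orient (q c) (q d) (q j)) (fun c d hcd hc e hde => ?_) hab.1 (fun d hd => ?_) c hcd.1 d
        hcd
    · have hce : c ≠ e := by
        rintro rfl
        exact hcd.not_symm hV hde
      refine hside d e hde c hcd.1 ?_
      rw [← orient_rotate]
      exact hc d hcd e hde.2.1 hce.symm hde.2.2.1.symm
    · rw [hd.unique hab]
      exact hside a b hab j hj hpos
  obtain ⟨a, ha⟩ : V.Nonempty := Finset.card_pos.1 (by omega)
  obtain ⟨a', ha', haa'⟩ := Finset.exists_mem_ne (by omega : 1 < V.card) a
  obtain ⟨b, hab⟩ := exists_isNext ha ha' haa'.symm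
  obtain ⟨w, hw, hw'⟩ : ∃ w ∈ V, w ∉ ({a, b} : Finset ℕ) :=
    Finset.exists_mem_notMem_of_card_lt_card (lt_of_le_of_lt Finset.card_le_two hV)
  simp only [Finset.mem_insert, Finset.mem_singleton, not_or] at hw'
  rcases (h0 a b hab w hw hw'.1 hw'.2).lt_or_gt with h2 | h2
  · refine Or.inr (key _ ?_ ?_ a b hab w hw ?_)
    · intro a b hab j hj hja hjb
      rw [orient_swap_swap, neg_ne_zero]
      exact h0 a b hab j hj hja hjb
    · intro a b hab i hi j hj
      rw [orient_swap_swap, orient_swap_swap]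
      intro h3
      by_contra h4
      have := h1 a b hab j hj i hi (by linarith)
      linarith
    · rw [orient_swap_swap]; linarith
  · exact Or.inl (key p h0 h1 a b hab w hw h2)

theorem IsStress.of_swap {V : Finset ℕ} {p : ℕ → ℝ × ℝ} {ω : Sym2 ℕ → ℝ}
    (h : IsStress V (fun i => (p i).swap) ω) : IsStress V p ω := by
  intro i hi
  have h1 := h i hi
  refine Prod.ext ?_ ?_
  · have h2 := congrArg Prod.snd h1
    simpa [Prod.fst_sum, Prod.snd_sum] using h2
  · have h2 := congrArg Prod.fst h1
    simpa [Prod.fst_sum, Prod.snd_sum] using h2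

/-! ### Braced polygon graphs and brace systems -/

theorem isNext_range {n a b : ℕ} (hn : 2 ≤ n) :
    IsNext (Finset.range n) a b ↔ a < n ∧ b < n ∧ (a + 1 = b ∨ (a + 1 = n ∧ b = 0)) := by
  unfold IsNext
  simp only [Finset.mem_range]
  constructor
  · rintro ⟨ha, hb, hab, h⟩
    refine ⟨ha, hb, ?_⟩
    by_contra hcon
    rcases (by omega : a + 1 < n ∨ a + 1 = n) with h1 | h1
    · refine h (a + 1) h1 ?_
      unfold Cyc; omega
    · refine h 0 (by omega) ?_
      unfold Cyc; omega
  · rintro ⟨ha, hb, h⟩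
    refine ⟨ha, hb, by omega, fun c hc h1 => ?_⟩
    unfold Cyc at h1; omega

theorem cycleGraph_adj_iff {n : ℕ} (hn : 3 ≤ n) {i j : Fin n} :
    (SimpleGraph.cycleGraph n).Adj i j ↔
      IsNext (Finset.range n) i j ∨ IsNext (Finset.range n) j i := by
  have key : ∀ i j : Fin n, (i - j).val = 1 ↔ IsNext (Finset.range n) j i := by
    intro i j
    have hi := i.2
    have hj := j.2
    rw [isNext_range (by omega), Fin.val_sub]
    rcases lt_or_ge (n - j.val + i.val) n with h1 | h1
    · rw [Nat.mod_eq_of_lt h1]; omega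
    · rw [Nat.mod_eq_sub_mod h1, Nat.mod_eq_of_lt (by omega)]; omega
  rw [SimpleGraph.cycleGraph_adj', key, key, or_comm]

theorem cycleGraph_adj_iff_not_isChord {n : ℕ} (hn : 3 ≤ n) {i j : Fin n} (hij : i ≠ j) :
    (SimpleGraph.cycleGraph n).Adj i j ↔ ¬ IsChord (Finset.range n) i j := by
  rw [cycleGraph_adj_iff hn]
  constructor
  · rintro (h | h)
    · exact h.not_isChord
    · exact fun h1 => h.not_isChord h1.symm
  · intro h
    rcases isNext_or_isNext_or_isChord (Finset.mem_range.2 i.2) (Finset.mem_range.2 j.2)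
      (fun h1 => hij (Fin.ext h1)) with h1 | h1 | h1
    · exact Or.inl h1
    · exact Or.inr h1
    · exact absurd h1 h

/-- Running along the cycle from `i` to `j` without meeting `S`. -/
theorem reachable_of_forall_not_cyc {n : ℕ} {H : SimpleGraph (Fin n)} (hn : 3 ≤ n)
    (hH : SimpleGraph.cycleGraph n ≤ H) (S : Finset (Fin n)) {i j : Fin n} (hi : i ∉ S)
    (hj : j ∉ S) (hS : ∀ s ∈ S, ¬ Cyc i s j) :
    (H.induce {v | v ∉ S}).Reachable ⟨i, hi⟩ ⟨j, hj⟩ := by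
  obtain ⟨r, hr⟩ := exists_rank (Finset.range n) i (Finset.mem_range.2 i.2)
  obtain ⟨m, hm⟩ : ∃ m, m = r j := ⟨_, rfl⟩
  induction m using Nat.strong_induction_on generalizing j with
  | _ m ih =>
    subst hm
    by_cases hij : i = j
    · subst hij; exact SimpleGraph.Reachable.refl _
    have hij' : j.val ≠ i.val := fun h => hij (Fin.ext h.symm)
    obtain ⟨k, hk⟩ := exists_isNext_left (Finset.mem_range.2 j.2) (Finset.mem_range.2 i.2) hij'
    have hkn := Finset.mem_range.1 hk.1
    have hadj : H.Adj ⟨k, hkn⟩ j := hH ((cycleGraph_adj_iff hn).2 (Or.inl hk))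
    by_cases hki : k = i
    · have : (⟨k, hkn⟩ : Fin n) = i := Fin.ext hki
      rw [this] at hadj
      exact SimpleGraph.Adj.reachable hadj
    have hcyc : Cyc i k j := by
      have h1 := hk.2.2.2 i (Finset.mem_range.2 i.2)
      have h2 := hk.2.2.1
      clear hk hr ih hS
      unfold Cyc at *; omega
    have hkS : (⟨k, hkn⟩ : Fin n) ∉ S := fun h => hS _ h hcyc
    have h1 := ih (r k) ((hr k hk.1 j (Finset.mem_range.2 j.2) hki hij').2 hcyc) hkS
      (fun s hs h2 => hS s hs (by
        simp only at h2
        clear hk hr ih hS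
        unfold Cyc at *; omega)) rfl
    exact h1.trans (SimpleGraph.Adj.reachable hadj)

theorem exists_adj_crosses_of_isKConnected {n : ℕ} {H : SimpleGraph (Fin n)}
    (h : IsKConnected 3 H) {a b : ℕ} (hab : IsChord (Finset.range n) a b) :
    ∃ c d : Fin n, H.Adj c d ∧ Crosses a b c d := by
  obtain ⟨ha, hb, ⟨c, hc, hc'⟩, ⟨d, hd, hd'⟩⟩ := hab
  rw [Finset.mem_range] at ha hb hc hd
  have hconn := h.2 {⟨a, ha⟩, ⟨b, hb⟩} (lt_of_le_of_lt Finset.card_le_two (by norm_num))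
  have hmem : ∀ e : Fin n, e.val ≠ a → e.val ≠ b →
      e ∈ {v : Fin n | v ∉ ({⟨a, ha⟩, ⟨b, hb⟩} : Finset (Fin n))} := by
    intro e h1 h2
    simp only [Set.mem_ofPred_eq, Finset.mem_insert, Finset.mem_singleton, Fin.ext_iff, not_or]
    exact ⟨h1, h2⟩
  obtain ⟨w⟩ := hconn.preconnected
    ⟨⟨c, hc⟩, hmem ⟨c, hc⟩ hc'.ne.1.symm hc'.ne.2.1⟩
    ⟨⟨d, hd⟩, hmem ⟨d, hd⟩ hd'.ne.2.1 hd'.ne.1.symm⟩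
  obtain ⟨⟨⟨⟨e, he⟩, ⟨f, hf⟩⟩, hef⟩, -, h1, h2⟩ := w.exists_boundary_dart {x | Cyc a x.1 b} hc'
    (fun h => not_cyc_of_cyc h hd')
  refine ⟨e, f, hef, Or.inl ⟨h1, ?_⟩⟩
  simp only [Set.mem_ofPred_eq, Finset.mem_insert, Finset.mem_singleton, Fin.ext_iff, not_or] at hf
  exact ((cyc_total (Ne.symm hf.1) hf.2 (hc'.ne.2.2)).resolve_left h2)

/-- A graph that contains the cycle is 3-connected once each pair of non-consecutive vertices is
crossed by an edge. -/
theorem isKConnected_of_exists_adj_crosses {n : ℕ} {H : SimpleGraph (Fin n)} (hn : 4 ≤ n)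
    (hH : SimpleGraph.cycleGraph n ≤ H)
    (h : ∀ a b, IsChord (Finset.range n) a b → ∃ c d : Fin n, H.Adj c d ∧ Crosses a b c d) :
    IsKConnected 3 H := by
  refine ⟨by rw [Nat.card_eq_fintype_card, Fintype.card_fin]; omega, fun S hS => ?_⟩
  have hne : Nonempty {v | v ∉ S} := by
    obtain ⟨v, -, hv⟩ := Finset.exists_mem_notMem_of_card_lt_card
      (s := S) (t := (Finset.univ : Finset (Fin n)))
      (by rw [Finset.card_univ, Fintype.card_fin]; omega)
    exact ⟨⟨v, hv⟩⟩
  have hreach := fun {i j : Fin n} (hi : i ∉ S) (hj : j ∉ S) =>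
    reachable_of_forall_not_cyc (i := i) (j := j) (by omega) hH S hi hj
  refine ⟨?_⟩
  rintro ⟨i, hi⟩ ⟨j, hj⟩
  by_contra hcon
  obtain ⟨a, ha, ha'⟩ : ∃ a ∈ S, Cyc i a j := by
    by_contra h1
    push Not at h1
    exact hcon (hreach hi hj h1)
  obtain ⟨b, hb, hb'⟩ : ∃ b ∈ S, Cyc j b i := by
    by_contra h1
    push Not at h1
    exact hcon (hreach hj hi h1).symm
  have hab : a ≠ b := by
    rintro rfl
    exact not_cyc_of_cyc ha' hb'
  have hSab : ∀ s ∈ S, s = a ∨ s = b := by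
    intro s hs
    by_contra h1
    push Not at h1
    have h2 : ({s, a, b} : Finset (Fin n)).card = 3 :=
      Finset.card_eq_three.2 ⟨s, a, b, h1.1, h1.2, hab, rfl⟩
    have h3 : ({s, a, b} : Finset (Fin n)).card ≤ S.card := Finset.card_le_card (by
      intro t
      simp only [Finset.mem_insert, Finset.mem_singleton]
      rintro (rfl | rfl | rfl) <;> assumption)
    omega
  have hchord : IsChord (Finset.range n) a b := by
    refine ⟨Finset.mem_range.2 a.2, Finset.mem_range.2 b.2, ⟨j, Finset.mem_range.2 j.2, ?_⟩,
      ⟨i, Finset.mem_range.2 i.2, ?_⟩⟩ <;> (unfold Cyc at *; omega)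
  obtain ⟨c, d, hcd, hcr⟩ := h a b hchord
  have key : ∀ c d : Fin n, H.Adj c d → Cyc a c b → Cyc b d a → False := by
    intro c d hcd hc hd
    have hcS : c ∉ S := by
      intro h1
      rcases hSab c h1 with rfl | rfl
      · exact hc.ne.1 rfl
      · exact hc.ne.2.1 rfl
    have hdS : d ∉ S := by
      intro h1
      rcases hSab d h1 with rfl | rfl
      · exact hd.ne.2.1 rfl
      · exact hd.ne.1 rfl
    have hcj : (H.induce {v | v ∉ S}).Reachable ⟨c, hcS⟩ ⟨j, hj⟩ := by
      by_cases h1 : ∀ s ∈ S, ¬ Cyc c s j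
      · exact hreach hcS hj h1
      · refine (hreach hj hcS fun s hs h2 => h1 fun t ht h3 => ?_).symm
        rcases hSab s hs with rfl | rfl <;> rcases hSab t ht with rfl | rfl <;>
          (clear hSab hreach hchord hcr; unfold Cyc at *; omega)
    have hdi : (H.induce {v | v ∉ S}).Reachable ⟨d, hdS⟩ ⟨i, hi⟩ := by
      by_cases h1 : ∀ s ∈ S, ¬ Cyc d s i
      · exact hreach hdS hi h1
      · refine (hreach hi hdS fun s hs h2 => h1 fun t ht h3 => ?_).symm
        rcases hSab s hs with rfl | rfl <;> rcases hSab t ht with rfl | rfl <;>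
          (clear hSab hreach hchord hcr; unfold Cyc at *; omega)
    have hcd' : (H.induce {v | v ∉ S}).Adj ⟨c, hcS⟩ ⟨d, hdS⟩ := hcd
    exact hcon ((hdi.symm.trans hcd'.symm.reachable).trans hcj)
  rcases hcr with ⟨h1, h2⟩ | ⟨h1, h2⟩
  · exact key c d hcd h1 h2
  · exact key d c hcd.symm h1 h2

open Classical in
/-- The braces of `G`, as pairs of natural numbers. -/
noncomputable def braceSet {n : ℕ} (G : SimpleGraph (Fin n)) : Finset (Sym2 ℕ) :=
  (Finset.univ.filter fun e => e ∈ braces G).image (Sym2.map Fin.val)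

theorem mem_braceSet {n : ℕ} {G : SimpleGraph (Fin n)} {e : Sym2 ℕ} :
    e ∈ braceSet G ↔ ∃ e' ∈ braces G, Sym2.map Fin.val e' = e := by
  simp [braceSet]

theorem map_mem_braceSet {n : ℕ} {G : SimpleGraph (Fin n)} {e : Sym2 (Fin n)} :
    Sym2.map Fin.val e ∈ braceSet G ↔ e ∈ braces G := by
  rw [mem_braceSet]
  constructor
  · rintro ⟨e', he', h⟩
    rwa [← Sym2.map.injective Fin.val_injective h]
  · exact fun h => ⟨e, h, rfl⟩

theorem exists_of_mem_braceSet {n : ℕ} {G : SimpleGraph (Fin n)} {a b : ℕ}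
    (h : s(a, b) ∈ braceSet G) : ∃ i j : Fin n, (i : ℕ) = a ∧ (j : ℕ) = b ∧ s(i, j) ∈ braces G := by
  obtain ⟨e, he, heq⟩ := mem_braceSet.1 h
  induction e with | _ i j
  rw [Sym2.map_mk] at heq
  rcases Sym2.eq_iff.1 heq with ⟨h1, h2⟩ | ⟨h1, h2⟩
  · exact ⟨i, j, h1, h2, he⟩
  · exact ⟨j, i, h2, h1, Sym2.eq_swap ▸ he⟩

theorem mem_braces_iff {n : ℕ} {G : SimpleGraph (Fin n)} (hn : 3 ≤ n) {i j : Fin n} :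
    s(i, j) ∈ braces G ↔ G.Adj i j ∧ IsChord (Finset.range n) i j := by
  unfold braces boundaryEdges
  rw [Set.mem_sdiff, SimpleGraph.mem_edgeSet, SimpleGraph.mem_edgeSet]
  refine and_congr_right fun h => ?_
  rw [cycleGraph_adj_iff_not_isChord hn h.ne, not_not]

theorem mem_boundaryEdges_iff {n : ℕ} (hn : 3 ≤ n) {e : Sym2 (Fin n)} :
    e ∈ boundaryEdges n ↔ Sym2.map Fin.val e ∈ sides (Finset.range n) := by
  induction e with | _ i j
  unfold boundaryEdges
  rw [SimpleGraph.mem_edgeSet, cycleGraph_adj_iff hn, Sym2.map_mk,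
    mem_sides (by rwa [Finset.card_range])]

theorem map_mem_edges_iff {n : ℕ} {G : SimpleGraph (Fin n)} (hG : IsBracedPolygonGraph G)
    {e : Sym2 (Fin n)} :
    Sym2.map Fin.val e ∈ edges (Finset.range n) (braceSet G) ↔ e ∈ G.edgeSet := by
  rw [mem_edges, ← mem_boundaryEdges_iff hG.three_le, map_mem_braceSet]
  constructor
  · rintro (h | h)
    · exact SimpleGraph.edgeSet_mono hG.cycle_le h
    · exact h.1
  · intro h
    by_cases h1 : e ∈ boundaryEdges n
    · exact Or.inl h1
    · exact Or.inr ⟨h, h1⟩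

/-- The braces of a minimally 3-connected braced polygon graph form a brace system: 3-connectivity
says that each chord is crossed, and minimality provides the private chords. -/
theorem braceSystem_braceSet {n : ℕ} {G : SimpleGraph (Fin n)} (hG : IsBracedPolygonGraph G)
    (hmin : IsMinimallyKConnected 3 G) : BraceSystem (Finset.range n) (braceSet G) := by
  have hn : 4 ≤ n := by
    have := hmin.1.1
    rwa [Nat.card_eq_fintype_card, Fintype.card_fin] at this
  have hbrace : ∀ {c d : Fin n} {a b : ℕ}, G.Adj c d → IsChord (Finset.range n) a b →
      Crosses a b c d → s(c, d) ∈ braces G := by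
    intro c d a b hcd hab hc
    rw [mem_braces_iff hG.three_le]
    exact ⟨hcd, isChord_of_crosses (Finset.mem_range.2 c.2) (Finset.mem_range.2 d.2) hab.1 hab.2.1
      hc.comm⟩
  refine ⟨by rwa [Finset.card_range], ?_, ?_, ?_⟩
  · intro a b hab
    obtain ⟨i, j, rfl, rfl, hij⟩ := exists_of_mem_braceSet hab
    exact ((mem_braces_iff hG.three_le).1 hij).2
  · intro a b hab
    obtain ⟨c, d, hcd, hc⟩ := exists_adj_crosses_of_isKConnected hmin.1 hab
    exact ⟨c, d, map_mem_braceSet (e := s(c, d)).2 (hbrace hcd hab hc), hc⟩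
  · intro a b hab
    obtain ⟨i, j, rfl, rfl, hij⟩ := exists_of_mem_braceSet hab
    have hnot := hmin.2 _ hij
    have hle : SimpleGraph.cycleGraph n ≤ G.deleteEdges {s(i, j)} := by
      intro k l hkl
      rw [SimpleGraph.deleteEdges_adj, Set.mem_singleton_iff]
      refine ⟨hG.cycle_le hkl, fun h1 => hij.2 ?_⟩
      rw [← h1]
      exact hkl
    obtain ⟨c, d, hcd, hcr⟩ : ∃ c d, IsChord (Finset.range n) c d ∧
        ∀ e f : Fin n, (G.deleteEdges {s(i, j)}).Adj e f → ¬ Crosses c d e f := by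
      by_contra hcon
      push Not at hcon
      refine hnot (isKConnected_of_exists_adj_crosses hn hle fun c d hcd => ?_)
      exact hcon c d hcd
    have huniq : ∀ e f : Fin n, G.Adj e f → Crosses c d e f → s(e, f) = s(i, j) := by
      intro e f hef hc
      by_contra h1
      refine hcr e f ?_ hc
      rw [SimpleGraph.deleteEdges_adj, Set.mem_singleton_iff]
      exact ⟨hef, h1⟩
    refine ⟨c, d, hcd, ?_, ?_⟩
    · obtain ⟨e, f, hef, hc⟩ := exists_adj_crosses_of_isKConnected hmin.1 hcd
      have h1 := congrArg (Sym2.map Fin.val) (huniq e f hef hc)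
      exact hc.congr_right h1
    · intro e f hef hc
      obtain ⟨k, l, rfl, rfl, hkl⟩ := exists_of_mem_braceSet hef
      exact congrArg (Sym2.map Fin.val) (huniq k l hkl.1 hc)

theorem ncard_edgeSet {n : ℕ} {G : SimpleGraph (Fin n)} (hG : IsBracedPolygonGraph G)
    (hmin : IsMinimallyKConnected 3 G) : G.edgeSet.ncard = n + (braceSet G).card := by
  have h := braceSystem_braceSet hG hmin
  have h1 : Sym2.map Fin.val '' G.edgeSet =
      (edges (Finset.range n) (braceSet G) : Set (Sym2 ℕ)) := by
    ext e
    rw [Set.mem_image, Finset.mem_coe]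
    constructor
    · rintro ⟨e', he', rfl⟩
      exact (map_mem_edges_iff hG).2 he'
    · intro he
      induction e with | _ a b
      have h2 := h.mem_of_mem_edges he
      rw [Finset.mem_range, Finset.mem_range] at h2
      refine ⟨s(⟨a, h2.1⟩, ⟨b, h2.2.1⟩), ?_, rfl⟩
      rw [← map_mem_edges_iff hG]
      exact he
  rw [← Set.ncard_image_of_injective _ (Sym2.map.injective Fin.val_injective), h1,
    Set.ncard_coe_finset, h.card_edges, Finset.card_range]

theorem isGenericRigidityCircuit {n : ℕ} {G : SimpleGraph (Fin n)} (hG : IsBracedPolygonGraph G)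
    (hmin : IsMinimallyKConnected 3 G) (hm : 2 * n - 2 ≤ G.edgeSet.ncard) :
    IsGenericRigidityCircuit G := by
  classical
  have h := braceSystem_braceSet hG hmin
  have hn : 4 ≤ n := by simpa using h.four_le
  have hcard := ncard_edgeSet hG hmin
  have hB : (Finset.range n).card ≤ (braceSet G).card + 2 := by rw [Finset.card_range]; omega
  have hB' := (h.card_eq_and_exists_isProper hB).1
  rw [Finset.card_range] at hB'
  have hcn : Nat.card (Fin n) = n := by rw [Nat.card_eq_fintype_card, Fintype.card_fin]
  refine ⟨by rw [hcn]; omega, fun H h2 hlt => ?_⟩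
  rw [hcn] at hlt
  set W := H.verts.toFinset.image Fin.val with hW
  set E := H.edgeSet.toFinset.image (Sym2.map Fin.val) with hE
  have hWc : W.card = H.verts.ncard := by
    rw [hW, Finset.card_image_of_injective _ Fin.val_injective, Set.ncard_eq_toFinset_card']
  have hEc : E.card = H.edgeSet.ncard := by
    rw [hE, Finset.card_image_of_injective _ (Sym2.map.injective Fin.val_injective),
      Set.ncard_eq_toFinset_card']
  have hmem : ∀ e ∈ E, ∃ i j : Fin n, H.Adj i j ∧ s((i : ℕ), (j : ℕ)) = e := by
    intro e he
    obtain ⟨e', he', rfl⟩ := Finset.mem_image.1 he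
    rw [Set.mem_toFinset] at he'
    induction e' with | _ i j
    exact ⟨i, j, he', rfl⟩
  have hWn : W ⊂ Finset.range n := by
    refine Finset.ssubset_iff_subset_ne.2 ⟨?_, ?_⟩
    · intro a ha
      obtain ⟨i, -, rfl⟩ := Finset.mem_image.1 ha
      exact Finset.mem_range.2 i.2
    · intro h1
      rw [h1, Finset.card_range] at hWc
      omega
  have hmemW : ∀ i ∈ H.verts, (i : ℕ) ∈ W := fun i hi =>
    Finset.mem_image.2 ⟨i, Set.mem_toFinset.2 hi, rfl⟩
  have := h.card_le_of_ssubset hB hWn (by omega) (E := E) (by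
    intro e he
    obtain ⟨i, j, hij, rfl⟩ := hmem e he
    exact (map_mem_edges_iff (e := s(i, j)) hG).2 hij.adj_sub) (by
    intro a b hab
    obtain ⟨i, j, hij, heq⟩ := hmem _ hab
    rcases Sym2.eq_iff.1 heq with ⟨rfl, rfl⟩ | ⟨rfl, rfl⟩
    · exact ⟨hmemW i hij.fst_mem, hmemW j hij.snd_mem⟩
    · exact ⟨hmemW j hij.snd_mem, hmemW i hij.fst_mem⟩)
  omega

/-! ### Strictly convex realisations -/

/-- The coordinates of a point of the Euclidean plane. -/
def toPair (x : Plane) : ℝ × ℝ := (x 0, x 1)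

theorem ext_of_toPair {x y : Plane} (h : toPair x = toPair y) : x = y := by
  ext i
  fin_cases i
  · exact congrArg Prod.fst h
  · exact congrArg Prod.snd h

/-- Three distinct extreme points are not collinear. -/
theorem orient_ne_zero_of_mem_extremePoints {K : Set Plane} {a b c : Plane}
    (ha : a ∈ K.extremePoints ℝ) (hb : b ∈ K.extremePoints ℝ) (hc : c ∈ K.extremePoints ℝ)
    (hab : a ≠ b) (hac : a ≠ c) (hbc : b ≠ c) :
    orient (toPair a) (toPair b) (toPair c) ≠ 0 := by
  intro h0
  have key : ∀ {x y z : Plane}, x ∈ K.extremePoints ℝ → y ∈ K.extremePoints ℝ →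
      z ∈ K.extremePoints ℝ → y ≠ x → ∀ s t : ℝ, 0 < s → 0 < t → s + t = 1 →
      x = s • y + t • z → False := by
    intro x y z hx hy hz hyx s t hs ht hst h
    rw [mem_extremePoints] at hx
    exact hyx (hx.2 y hy.1 z hz.1 ⟨s, t, hs, ht, hst, h.symm⟩).1
  obtain ⟨t, ht⟩ : ∃ t : ℝ, c = (1 - t) • a + t • b := by
    have hn : (b 0 - a 0) * (b 0 - a 0) + (b 1 - a 1) * (b 1 - a 1) ≠ 0 := by
      intro h1
      refine hab (ext_of_toPair (Prod.ext ?_ ?_))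
      · simp only [toPair]; nlinarith
      · simp only [toPair]; nlinarith
    obtain ⟨t, ht⟩ : ∃ t : ℝ, t * ((b 0 - a 0) * (b 0 - a 0) + (b 1 - a 1) * (b 1 - a 1)) =
        (b 0 - a 0) * (c 0 - a 0) + (b 1 - a 1) * (c 1 - a 1) :=
      ⟨_, div_mul_cancel₀ _ hn⟩
    refine ⟨t, ?_⟩
    simp only [orient, cr, toPair, Prod.fst_sub, Prod.snd_sub] at h0
    refine ext_of_toPair (Prod.ext ?_ ?_)
    · simp only [toPair, PiLp.add_apply, PiLp.smul_apply, smul_eq_mul]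
      refine mul_left_cancel₀ hn ?_
      linear_combination (-(b 1 - a 1)) * h0 - (b 0 - a 0) * ht
    · simp only [toPair, PiLp.add_apply, PiLp.smul_apply, smul_eq_mul]
      refine mul_left_cancel₀ hn ?_
      linear_combination (b 0 - a 0) * h0 - (b 1 - a 1) * ht
  rcases lt_trichotomy t 0 with h1 | h1 | h1
  · have h2 : 0 < 1 - t := by linarith
    refine key ha hb hc hab.symm (-t / (1 - t)) (1 / (1 - t)) (div_pos (by linarith) h2)
      (div_pos one_pos h2) (by field_simp; ring) ?_
    rw [ht, smul_add, smul_smul, smul_smul, one_div_mul_cancel h2.ne', one_smul]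
    have h3 : (-t / (1 - t)) • b + (a + (1 / (1 - t) * t) • b) = a := by
      rw [add_left_comm, ← add_smul]
      have : -t / (1 - t) + 1 / (1 - t) * t = 0 := by field_simp; ring
      rw [this, zero_smul, add_zero]
    exact h3.symm
  · refine hac ?_
    rw [ht, h1, sub_zero, one_smul, zero_smul, add_zero]
  rcases lt_trichotomy t 1 with h2 | h2 | h2
  · exact key hc ha hb hac (1 - t) t (by linarith) h1 (by ring) ht
  · refine hbc ?_
    rw [ht, h2, sub_self, one_smul, zero_smul, zero_add]
  · refine key hb ha hc hab ((t - 1) / t) (1 / t) (div_pos (by linarith) h1)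
      (div_pos one_pos h1) (by field_simp; ring) ?_
    rw [ht, smul_add, smul_smul, smul_smul, one_div_mul_cancel h1.ne', one_smul, ← add_assoc,
      ← add_smul]
    have : (t - 1) / t + 1 / t * (1 - t) = 0 := by field_simp; ring
    rw [this, zero_smul, zero_add]

/-- A point with nonnegative barycentric coordinates with respect to a triangle in `K`. -/
theorem mem_of_orient {K : Set Plane} (hK : Convex ℝ K) {a b c x : Plane} (ha : a ∈ K)
    (hb : b ∈ K) (hc : c ∈ K) (h0 : orient (toPair a) (toPair b) (toPair c) ≠ 0)
    (h1 : 0 ≤ orient (toPair x) (toPair b) (toPair c) / orient (toPair a) (toPair b) (toPair c))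
    (h2 : 0 ≤ orient (toPair a) (toPair x) (toPair c) / orient (toPair a) (toPair b) (toPair c))
    (h3 : 0 ≤ orient (toPair a) (toPair b) (toPair x) / orient (toPair a) (toPair b) (toPair c)) :
    x ∈ K := by
  set D := orient (toPair a) (toPair b) (toPair c) with hD
  have hsum : orient (toPair x) (toPair b) (toPair c) + orient (toPair a) (toPair x) (toPair c) +
      orient (toPair a) (toPair b) (toPair x) = D := by
    simp only [hD, orient, cr, toPair, Prod.fst_sub, Prod.snd_sub]; ring
  have hx : (orient (toPair x) (toPair b) (toPair c) / D) • a +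
      (orient (toPair a) (toPair x) (toPair c) / D) • b +
      (orient (toPair a) (toPair b) (toPair x) / D) • c = x := by
    refine ext_of_toPair (Prod.ext ?_ ?_)
    · simp only [toPair, PiLp.add_apply, PiLp.smul_apply, smul_eq_mul]
      field_simp
      simp only [hD, orient, cr, toPair, Prod.fst_sub, Prod.snd_sub]; ring
    · simp only [toPair, PiLp.add_apply, PiLp.smul_apply, smul_eq_mul]
      field_simp
      simp only [hD, orient, cr, toPair, Prod.fst_sub, Prod.snd_sub]; ring
  have h4 := hK.sum_mem (t := (Finset.univ : Finset (Fin 3)))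
    (w := ![orient (toPair x) (toPair b) (toPair c) / D,
      orient (toPair a) (toPair x) (toPair c) / D, orient (toPair a) (toPair b) (toPair x) / D])
    (z := ![a, b, c]) (by
      intro i _
      fin_cases i
      · exact h1
      · exact h2
      · exact h3) (by
      rw [Fin.sum_univ_three]
      simp only [Matrix.cons_val]
      rw [← add_div, ← add_div, hsum, div_self h0]) (by
      intro i _
      fin_cases i
      · exact ha
      · exact hb
      · exact hc)
  rw [Fin.sum_univ_three] at h4
  simp only [Matrix.cons_val] at h4
  rwa [hx] at h4

/-- The midpoint of a segment in `K` is an interior point if `K` has points strictly on both sides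
of the segment. -/
theorem midpoint_mem_interior {K : Set Plane} (hK : Convex ℝ K) {a b c d : Plane} (ha : a ∈ K)
    (hb : b ∈ K) (hc : c ∈ K) (hd : d ∈ K) (h1 : 0 < orient (toPair a) (toPair b) (toPair c))
    (h2 : orient (toPair a) (toPair b) (toPair d) < 0) :
    (1 / 2 : ℝ) • a + (1 / 2 : ℝ) • b ∈ interior K := by
  rw [mem_interior_iff_mem_nhds]
  have hcont : ∀ c, (Continuous fun x => orient (toPair x) (toPair b) (toPair c)) ∧
      Continuous fun x => orient (toPair a) (toPair x) (toPair c) := by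
    intro c
    simp only [orient, cr, toPair, Prod.fst_sub, Prod.snd_sub]
    constructor <;> fun_prop
  have hval : ∀ c, orient (toPair ((1 / 2 : ℝ) • a + (1 / 2 : ℝ) • b)) (toPair b) (toPair c) =
      orient (toPair a) (toPair b) (toPair c) / 2 ∧
      orient (toPair a) (toPair ((1 / 2 : ℝ) • a + (1 / 2 : ℝ) • b)) (toPair c) =
      orient (toPair a) (toPair b) (toPair c) / 2 := by
    intro c
    simp only [orient, cr, toPair, Prod.fst_sub, Prod.snd_sub, PiLp.add_apply, PiLp.smul_apply,
      smul_eq_mul]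
    constructor <;> ring
  have hneg : orient (toPair a) (toPair b) (toPair d) / 2 < 0 := by linarith
  have e1 := (hcont c).1.continuousAt.eventually (lt_mem_nhds ((hval c).1 ▸ half_pos h1))
  have e2 := (hcont c).2.continuousAt.eventually (lt_mem_nhds ((hval c).2 ▸ half_pos h1))
  have e3 := (hcont d).1.continuousAt.eventually (gt_mem_nhds ((hval d).1 ▸ hneg))
  have e4 := (hcont d).2.continuousAt.eventually (gt_mem_nhds ((hval d).2 ▸ hneg))
  filter_upwards [e1, e2, e3, e4] with x e1 e2 e3 e4
  rcases le_total 0 (orient (toPair a) (toPair b) (toPair x)) with h3 | h3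
  · exact mem_of_orient hK ha hb hc h1.ne' (div_nonneg e1.le h1.le) (div_nonneg e2.le h1.le)
      (div_nonneg h3 h1.le)
  · exact mem_of_orient hK ha hb hd h2.ne (div_nonneg_of_nonpos e3.le h2.le)
      (div_nonneg_of_nonpos e4.le h2.le) (div_nonneg_of_nonpos h3 h2.le)

/-- The coordinates of a configuration in the plane, indexed by natural numbers. -/
noncomputable def coords {n : ℕ} (p : Fin n → Plane) (i : ℕ) : ℝ × ℝ :=
  if h : i < n then toPair (p ⟨i, h⟩) else 0

theorem coords_val {n : ℕ} (p : Fin n → Plane) (i : Fin n) : coords p i = toPair (p i) :=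
  dif_pos i.2

/-- The vertices of a strictly convex polygon are in convex position, up to a reflection: the
midpoint of a side lies in the frontier, so that no two vertices lie strictly on different sides of
a side, and no three vertices are collinear because they are extreme points. -/
theorem isConvex_coords {n : ℕ} {p : Fin n → Plane} (hp : IsStrictlyConvexPolygon p) :
    IsConvex (Finset.range n) (coords p) ∨
      IsConvex (Finset.range n) fun i => (coords p i).swap := by
  have hn := hp.three_le
  have hext : ∀ i, p i ∈ (convexHull ℝ (Set.range p)).extremePoints ℝ := fun i =>
    exposedPoints_subset_extremePoints (hp.exposed i)
  have hmem : ∀ i, p i ∈ convexHull ℝ (Set.range p) := fun i =>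
    subset_convexHull ℝ _ (Set.mem_range_self i)
  refine isConvex_or_isConvex_swap (by rwa [Finset.card_range]) ?_ ?_
  · intro a b hab j hj hja hjb
    obtain ⟨a, rfl⟩ : ∃ i : Fin n, (i : ℕ) = a := ⟨⟨a, Finset.mem_range.1 hab.1⟩, rfl⟩
    obtain ⟨b, rfl⟩ : ∃ i : Fin n, (i : ℕ) = b := ⟨⟨b, Finset.mem_range.1 hab.2.1⟩, rfl⟩
    obtain ⟨j, rfl⟩ : ∃ i : Fin n, (i : ℕ) = j := ⟨⟨j, Finset.mem_range.1 hj⟩, rfl⟩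
    rw [coords_val, coords_val, coords_val]
    refine orient_ne_zero_of_mem_extremePoints (hext a) (hext b) (hext j) ?_ ?_ ?_
    · exact fun h => hab.2.2.1 (congrArg Fin.val (hp.injective h))
    · exact fun h => hja (congrArg Fin.val (hp.injective h)).symm
    · exact fun h => hjb (congrArg Fin.val (hp.injective h)).symm
  · intro a b hab i hi j hj hpos
    obtain ⟨a, rfl⟩ : ∃ i : Fin n, (i : ℕ) = a := ⟨⟨a, Finset.mem_range.1 hab.1⟩, rfl⟩
    obtain ⟨b, rfl⟩ : ∃ i : Fin n, (i : ℕ) = b := ⟨⟨b, Finset.mem_range.1 hab.2.1⟩, rfl⟩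
    obtain ⟨j, rfl⟩ : ∃ i : Fin n, (i : ℕ) = j := ⟨⟨j, Finset.mem_range.1 hj⟩, rfl⟩
    obtain ⟨i, rfl⟩ : ∃ k : Fin n, (k : ℕ) = i := ⟨⟨i, Finset.mem_range.1 hi⟩, rfl⟩
    rw [coords_val, coords_val, coords_val] at *
    by_contra hneg
    push Not at hneg
    have hint := midpoint_mem_interior (convex_convexHull ℝ (Set.range p)) (hmem a) (hmem b)
      (hmem i) (hmem j) hpos hneg
    have hfr : (1 / 2 : ℝ) • p a + (1 / 2 : ℝ) • p b ∈ frontier (convexHull ℝ (Set.range p)) := by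
      rw [hp.frontier_eq]
      exact ⟨a, b, (cycleGraph_adj_iff hn).2 (Or.inl hab), 1 / 2, 1 / 2, by norm_num, by norm_num,
        by norm_num, rfl⟩
    exact hfr.2 hint

theorem isProperlyStressed {n : ℕ} {G : SimpleGraph (Fin n)} (hG : IsBracedPolygonGraph G)
    (hmin : IsMinimallyKConnected 3 G) (hm : 2 * n - 2 ≤ G.edgeSet.ncard) {p : Fin n → Plane}
    (hp : IsStrictlyConvexPolygon p) : IsProperlyStressed G p := by
  have h := braceSystem_braceSet hG hmin
  have hcard := ncard_edgeSet hG hmin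
  have hB : (Finset.range n).card ≤ (braceSet G).card + 2 := by rw [Finset.card_range]; omega
  have hex := (h.card_eq_and_exists_isProper hB).2
  obtain ⟨ω, hω, h0, hpos, hneg⟩ : ∃ ω, IsStress (Finset.range n) (coords p) ω ∧
      (∀ e, e ∉ edges (Finset.range n) (braceSet G) → ω e = 0) ∧
      (∀ e ∈ sides (Finset.range n), 0 < ω e) ∧ ∀ e ∈ braceSet G, ω e < 0 := by
    rcases isConvex_coords hp with h1 | h1
    · obtain ⟨ω, hω⟩ := hex _ h1
      exact ⟨ω, hω.isStress, hω.eq_zero, hω.pos, hω.neg⟩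
    · obtain ⟨ω, hω⟩ := hex _ h1
      exact ⟨ω, hω.isStress.of_swap, hω.eq_zero, hω.pos, hω.neg⟩
  refine ⟨fun e => ω (Sym2.map Fin.val e), ⟨?_, ?_⟩, ?_, ?_⟩
  · exact fun e he => h0 _ fun h1 => he ((map_mem_edges_iff hG).1 h1)
  · intro i
    have h1 := hω i (Finset.mem_range.2 i.2)
    rw [Finset.sum_range] at h1
    simp only [coords_val] at h1
    refine ext_of_toPair (Prod.ext ?_ ?_)
    · have h2 := congrArg Prod.fst h1
      rw [Prod.fst_sum, Prod.fst_zero, ← neg_eq_zero, ← Finset.sum_neg_distrib] at h2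
      simp only [toPair, WithLp.ofLp_sum, Finset.sum_apply, PiLp.smul_apply, PiLp.sub_apply,
        smul_eq_mul, PiLp.zero_apply]
      rw [← h2]
      refine Finset.sum_congr rfl fun j _ => ?_
      simp [toPair]; ring
    · have h2 := congrArg Prod.snd h1
      rw [Prod.snd_sum, Prod.snd_zero, ← neg_eq_zero, ← Finset.sum_neg_distrib] at h2
      simp only [toPair, WithLp.ofLp_sum, Finset.sum_apply, PiLp.smul_apply, PiLp.sub_apply,
        smul_eq_mul, PiLp.zero_apply]
      rw [← h2]
      refine Finset.sum_congr rfl fun j _ => ?_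
      simp [toPair]; ring
  · exact fun e he => hpos _ ((mem_boundaryEdges_iff hG.three_le).1 he)
  · exact fun e he => hneg _ (map_mem_braceSet.2 he)

end BracedPolygon

theorem mainTheorem6 {n : ℕ} (G : SimpleGraph (Fin n)) (hG : IsBracedPolygonGraph G)
    (hmin : IsMinimallyKConnected 3 G) (hm : 2 * n - 2 ≤ G.edgeSet.ncard) :
    IsGenericRigidityCircuit G ∧
      ∀ p : Fin n → Plane, IsStrictlyConvexPolygon p → IsProperlyStressed G p :=
  ⟨BracedPolygon.isGenericRigidityCircuit hG hmin hm, fun _ hp =>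
    BracedPolygon.isProperlyStressed hG hmin hm hp⟩
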